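/- Let $q\ge 3$ and $p=2q+1$ both be prime, and write $q-1=2^r s$ with $s$ odd; let $\sigma_0(s)$ be the number of positive divisors of $s$. A permutation group of degree $n$ means a group $G$ acting faithfully and transitively on a set of $n$ elements; two such are isomorphic if there are a group isomorphism and a compatible bijection of the underlying sets. For a finite separable field extension $L/K$ with normal closure $E$, a Hopf-Galois structure on $L/K$ is a cocommutative $K$-Hopf algebra $H$ with an $H$-module algebra structure on $L$ such that the map $L\otimes_K H\to \mathrm{End}_K(L)$, $x\otimes h\mapsto (y\mapsto x(h\cdot y))$, is bijective; such structures are counted up to isomorphism of Hopf algebras compatible with the action on $L$. Its type is the group $N$ (up to isomorphism) with $E\otimes_K H\cong E[N]$ as $E$-Hopf algebras. The extension $L/K$ realises $G$ if there is an isomorphism $G\to\mathrm{Gal}(E/K)$ taking the stabiliser of a point to $\mathrm{Gal}(E/L)$; $G$ is realised by a Hopf-Galois structure of cyclic type if a finite separable extension realising $G$ admits a Hopf-Galois structure whose type is a cyclic group. The extension $L/K$ is almost classically Galois if $\mathrm{Gal}(E/L)$ has a normal complement in $\mathrm{Gal}(E/K)$. There are exactly $(6r+4)\,\sigma_0(s)+2$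 isomorphism types of permutation groups of degree $pq$ which are realised by a Hopf-Galois structure of cyclic type. These include the two regular permutation groups of degree $pq$ (up to isomorphism), one cyclic and the other non-abelian; every finite separable extension realising one of them is Galois, and it has exactly $1$ Hopf-Galois structure of cyclic type in the cyclic case and exactly $p$ in the non-abelian case. For each of the remaining permutation groups $G$, every finite separable field extension $L/K$ realising $G$ is almost classically Galois and admits exactly one Hopf-Galois structure of cyclic type. -/

import Mathlib

universe u

noncomputable section

open scoped TensorProduct

namespace HopfGalois

/-! ### Hopf-Galois structures -/

section Structures

variable (K L : Type u) [Field K] [Field L] [Algebra K L]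

/-- A Hopf-Galois structure on `L/K`: a cocommutative `K`-Hopf algebra `H` together with an
action of `H` on `L` making `L` an `H`-module algebra for which `L/K` is `H`-Galois. -/
structure HopfGaloisStructure where
  /-- The Hopf algebra. -/
  H : Type u
  [ring : Ring H]
  [hopf : HopfAlgebra K H]
  [cocomm : Coalgebra.IsCocomm K H]
  /-- The action of `H` on `L` by `K`-linear endomorphisms. -/
  act : H →ₐ[K] Module.End K L
  /-- `h · (x y) = ∑ (h₁ · x) (h₂ · y)`. -/
  act_mul : ∀ (h : H) (x y : L),
    act h (x * y) =
      LinearMap.mul' K L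
        (TensorProduct.map (LinearMap.applyₗ x ∘ₗ act.toLinearMap)
          (LinearMap.applyₗ y ∘ₗ act.toLinearMap) (Coalgebra.comul (R := K) h))
  /-- `h · k = ε(h) k` for `k ∈ K`. -/
  act_algebraMap : ∀ (h : H) (k : K),
    act h (algebraMap K L k) = algebraMap K L (Coalgebra.counit (R := K) h * k)
  /-- The map `L ⊗ H → End_K(L)`, `x ⊗ h ↦ (y ↦ x (h · y))`, is bijective. -/
  galois : Function.Bijective
    (LinearMap.mul' K (Module.End K L) ∘ₗ
      TensorProduct.map (LinearMap.mul K L) act.toLinearMap)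

attribute [instance] HopfGaloisStructure.ring HopfGaloisStructure.hopf
  HopfGaloisStructure.cocomm

variable {K L}

/-- Two Hopf-Galois structures on `L/K` are identified when there is an isomorphism of
`K`-Hopf algebras compatible with the actions on `L`. -/
def HopfGaloisStructure.Equivalent (S T : HopfGaloisStructure K L) : Prop :=
  ∃ e : S.H ≃ₐc[K] T.H, ∀ h : S.H, T.act (e h) = S.act h

theorem HopfGaloisStructure.equivalent_equivalence :
    Equivalence (HopfGaloisStructure.Equivalent (K := K) (L := L)) where
  refl S := ⟨BialgEquiv.refl K S.H, fun _ => rfl⟩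
  symm := by
    rintro S T ⟨e, he⟩
    refine ⟨e.symm, fun h => ?_⟩
    rw [← he (e.symm h), BialgEquiv.apply_symm_apply]
  trans := by
    rintro S T U ⟨e, he⟩ ⟨f, hf⟩
    exact ⟨e.trans f, fun h => (hf (e h)).trans (he h)⟩

variable (K L)

/-- Hopf-Galois structures up to isomorphism. -/
instance HopfGaloisStructure.setoid : Setoid (HopfGaloisStructure K L) where
  r := HopfGaloisStructure.Equivalent
  iseqv := HopfGaloisStructure.equivalent_equivalence

/-- The normal closure `E` of `L/K` inside an algebraic closure. -/
abbrev NormalClosure : IntermediateField K (AlgebraicClosure L) :=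
  IntermediateField.normalClosure K L (AlgebraicClosure L)

variable {K L}

/-- The Hopf-Galois structure has type `N`: `E ⊗_K H ≅ E[N]` as `E`-Hopf algebras, where `E`
is the normal closure of `L/K`. -/
def HopfGaloisStructure.HasType (S : HopfGaloisStructure K L) (N : Type*) [Group N] : Prop :=
  Nonempty ((NormalClosure K L ⊗[K] S.H) ≃ₐc[NormalClosure K L]
    MonoidAlgebra (NormalClosure K L) N)

variable (K L)

/-- The number of Hopf-Galois structures of type `N` on `L/K`, up to isomorphism. -/
def numStructures (N : Type*) [Group N] : ℕ :=
  {c : Quotient (HopfGaloisStructure.setoid K L) |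
    ∃ S : HopfGaloisStructure K L, ⟦S⟧ = c ∧ S.HasType N}.ncard

/-- `Gal(E/L)` as a subgroup of `Gal(E/K)`, with `E` the normal closure of `L/K`. -/
def stabGal : Subgroup (NormalClosure K L ≃ₐ[K] NormalClosure K L) where
  carrier := {g | ∀ x : L, g (algebraMap L (NormalClosure K L) x) =
    algebraMap L (NormalClosure K L) x}
  mul_mem' := by
    intro a b ha hb x
    rw [AlgEquiv.mul_apply, hb x, ha x]
  one_mem' := fun _ => rfl
  inv_mem' := by
    intro a ha x
    have h := ha x
    rw [AlgEquiv.aut_inv, AlgEquiv.symm_apply_eq]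
    exact h.symm

/-- `L/K` is almost classically Galois: `Gal(E/L)` has a normal complement in `Gal(E/K)`. -/
def AlmostClassicallyGalois : Prop :=
  ∃ C : Subgroup (NormalClosure K L ≃ₐ[K] NormalClosure K L),
    C.Normal ∧ Subgroup.IsComplement' C (stabGal K L)

/-- `L/K` realises the permutation group `G` acting on `X`: there is an isomorphism
`G ≅ Gal(E/K)` which takes the stabiliser of a point to `Gal(E/L)`. -/
def Realises (G X : Type*) [Group G] [MulAction G X] : Prop :=
  ∃ (θ : G ≃* (NormalClosure K L ≃ₐ[K] NormalClosure K L)) (x : X),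
    (MulAction.stabilizer G x).map θ.toMonoidHom = stabGal K L

end Structures

/-! ### Permutation groups -/

/-- Transitive permutation groups on `n` letters. -/
abbrev TransPermGroup (n : ℕ) : Type :=
  {G : Subgroup (Equiv.Perm (Fin n)) // MulAction.IsPretransitive G (Fin n)}

namespace TransPermGroup

variable {n : ℕ}

/-- Isomorphism of permutation groups: a group isomorphism together with a compatible bijection
of the underlying sets. -/
def Isom (G H : TransPermGroup n) : Prop :=
  ∃ (θ : G.1 ≃* H.1) (f : Fin n ≃ Fin n), ∀ (g : G.1) (x : Fin n), f (g • x) = θ g • f x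

theorem isom_equivalence : Equivalence (Isom (n := n)) where
  refl G := ⟨MulEquiv.refl _, Equiv.refl _, fun _ _ => rfl⟩
  symm := by
    rintro G H ⟨θ, f, h⟩
    refine ⟨θ.symm, f.symm, fun g x => ?_⟩
    rw [Equiv.symm_apply_eq, h, MulEquiv.apply_symm_apply, Equiv.apply_symm_apply]
  trans := by
    rintro G H J ⟨θ, f, h⟩ ⟨η, k, h'⟩
    refine ⟨θ.trans η, f.trans k, fun g x => ?_⟩
    simp [h, h']

/-- The setoid whose classes are the isomorphism types of permutation groups of degree `n`. -/
instance setoid (n : ℕ) : Setoid (TransPermGroup n) where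
  r := Isom
  iseqv := isom_equivalence

/-- A permutation group is regular if for all `x`, `y` a unique element takes `x` to `y`. -/
def IsRegular (G : TransPermGroup n) : Prop :=
  ∀ x y : Fin n, ∃! g : G.1, g • x = y

/-- `G` is realised by a Hopf-Galois structure of type `N`: some finite separable field extension
`L/K` which realises `G` admits a Hopf-Galois structure of type `N`. -/
def RealisedByType (G : TransPermGroup n) (N : Type*) [Group N] : Prop :=
  ∃ (K L : Type u) (_ : Field K) (_ : Field L) (_ : Algebra K L),
    FiniteDimensional K L ∧ Algebra.IsSeparable K L ∧ Realises K L G.1 (Fin n) ∧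
      ∃ S : HopfGaloisStructure K L, S.HasType N

end TransPermGroup

/-- The cyclic group of order `n`, written multiplicatively. -/
abbrev Cyc (n : ℕ) : Type := Multiplicative (ZMod n)

end HopfGalois

end

/-! The field theory is reduced to permutation groups by the theorem of Greither and Pareigis. Let
`E` be the normal closure of `L/K`. For a Hopf-Galois structure with Hopf algebra `H`, the algebra
`E ⊗ H` acts on families of linear maps `L → E` indexed by the `K`-embeddings of `L` in `E`. If `E ⊗
H ≅ E[N]`, the elements of `N` are group-like, hence carry embeddings to embeddings, and `N` becomes
a regular group of permutations of the embeddings, normalised by `Gal(E/K)`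
(`exists_regular_action`). Conversely, `Gal(E/K)` acts by conjugation on a regular group that it
normalises, and by Galois descent the fixed points in `E[N]` form a `K`-Hopf algebra which acts on
`L` (`exists_structure`). The image of `H` in `End_K(L)` determines the structure, and the
permutation group determines this image. Hence `numStructures` is the size of `regularSet`
(`numStructures_eq_ncard_regularSet`), which depends only on the permutation group realised by
`L/K`. Every transitive group is realised, by permuting the variables of a rational function field
(`exists_realises`).

What remains is to classify the transitive groups of degree `pq` normalising a regular cyclic group.
In suitable coordinates that cyclic group consists of the translations of `ZMod p × ZMod q`, and its
normaliser consists of the maps `(x, y) ↦ (a x + b, c y + d)`. Since `p` divides none of `p - 1`,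
`q`, `q - 1`, a transitive group of such maps contains every translation of `x`; it also contains
some `(x, y) ↦ (u x, y + 1)` with `u ^ q = 1`. Either it contains all translations, and is then
`holGroup p q A` for a subgroup `A` of `(ZMod p)ˣ × (ZMod q)ˣ`, or it is `excGroup χ A` with `χ` a
non-trivial character of `ZMod q` and `A` inside `{1, -1}` (`exists_eq_excGroup`). Rescaling `y`
makes `χ` irrelevant, so the second kind contributes two types. Distinct `A` give non-isomorphic
groups of the first kind: an isomorphism must respect the translations, so it is affine, and
conjugation by it preserves linear parts.

A regular cyclic group of affine maps consists of the translations (`eq_translGroup_of_le`), so a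
group containing a regular cyclic group that it normalises normalises no other. For `excGroup χ A`
the normalised regular cyclic groups are conjugates of the translation group by shears `(x, y) ↦ (x
+ h χ(y), y)`: all `p` of them if `A` is trivial, only `h = 0` otherwise (`exists_eq_map_shear`).
Every group on the list contains the translation group or `excGroup χ ⊥` as a regular normal
subgroup, which gives the normal complements.

The number of types is therefore two more than the number of subgroups of `(ZMod p)ˣ × (ZMod q)ˣ ≅
C_q × C_2 × C_{q-1}`. The factor `C_q` splits off by coprimality and contributes `2`. In `C_2 ×
C_{q-1}`, each subgroup of even order of `C_{q-1}` accounts for three subgroups and each one of odd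
order for two, in total `(3 r + 2) σ₀(s)` (`card_subgroup_units`). -/

noncomputable section

open scoped TensorProduct

namespace HopfGalois

/-! ### Forms of vector spaces and of Hopf algebras -/

section Forms

open Module

variable {K E : Type u} [Field K] [Field E] [Algebra K E]
variable {M M' P P' : Type u} [AddCommGroup M] [Module K M]
  [AddCommGroup M'] [Module K M'] [Module E M'] [IsScalarTower K E M']
  [AddCommGroup P] [Module K P]
  [AddCommGroup P'] [Module K P'] [Module E P'] [IsScalarTower K E P']

variable (E) in
/-- The `K`-linear map `f : M → M'` exhibits `M` as a `K`-form of the `E`-space `M'`: some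
`K`-basis of `M` is mapped to an `E`-basis of `M'`. -/
def IsForm (f : M →ₗ[K] M') : Prop :=
  ∃ (ι : Type u) (b : Basis ι K M) (b' : Basis ι E M'), ∀ i, f (b i) = b' i

/-- Matching bases identify the form with the vectors having coordinates in `K`; this and
`mem_range_of_repr_mem` are the two directions. -/
theorem repr_of_form {ι : Type u} {f : M →ₗ[K] M'} (b : Basis ι K M) (b' : Basis ι E M')
    (h : ∀ i, f (b i) = b' i) (m : M) (i : ι) :
    b'.repr (f m) i = algebraMap K E (b.repr m i) := by
  have : (Finsupp.lapply i ∘ₗ b'.repr.toLinearMap).restrictScalars K ∘ₗ f =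
      Algebra.linearMap K E ∘ₗ Finsupp.lapply i ∘ₗ b.repr.toLinearMap := by
    apply b.ext
    intro j
    classical simp [h, Finsupp.single_apply, apply_ite (algebraMap K E)]
  exact LinearMap.congr_fun this m

theorem IsForm.injective {f : M →ₗ[K] M'} (hf : IsForm E f) : Function.Injective f := by
  obtain ⟨ι, b, b', h⟩ := hf
  intro x y hxy
  apply b.repr.injective
  ext i
  apply (algebraMap K E).injective
  rw [← repr_of_form b b' h, ← repr_of_form b b' h, hxy]

theorem mem_range_of_repr_mem {ι : Type u} {f : M →ₗ[K] M'} (b : Basis ι K M)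
    (b' : Basis ι E M') (h : ∀ i, f (b i) = b' i) (m' : M')
    (hm : ∀ i, b'.repr m' i ∈ Set.range (algebraMap K E)) : m' ∈ LinearMap.range f := by
  rw [← b'.linearCombination_repr m', Finsupp.linearCombination_apply, Finsupp.sum]
  refine Submodule.sum_mem _ fun i _ => ?_
  obtain ⟨k, hk⟩ := hm i
  refine ⟨k • b i, ?_⟩
  rw [map_smul, h, ← hk, algebraMap_smul]

variable (E) in
/-- The map `M ⊗[K] P → M' ⊗[E] P'` induced by `K`-linear maps `M → M'` and `P → P'`. -/
def tmap (f : M →ₗ[K] M') (g : P →ₗ[K] P') : M ⊗[K] P →ₗ[K] M' ⊗[E] P' :=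
  TensorProduct.lift (LinearMap.mk₂ K (fun m p => f m ⊗ₜ[E] g p)
    (by intros; simp [TensorProduct.add_tmul])
    (by intros; simp [TensorProduct.smul_tmul'])
    (by intros; simp [TensorProduct.tmul_add])
    (by
      intro c m p
      rw [map_smul, ← algebraMap_smul E c (g p), ← TensorProduct.smul_tmul,
        algebraMap_smul, TensorProduct.smul_tmul']))

@[simp]
theorem tmap_tmul (f : M →ₗ[K] M') (g : P →ₗ[K] P') (m : M) (p : P) :
    tmap E f g (m ⊗ₜ p) = f m ⊗ₜ g p := rfl

theorem IsForm.tmap {f : M →ₗ[K] M'} {g : P →ₗ[K] P'} (hf : IsForm E f) (hg : IsForm E g) :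
    IsForm E (tmap E f g) := by
  obtain ⟨ι, b, b', h⟩ := hf
  obtain ⟨κ, c, c', h'⟩ := hg
  refine ⟨ι × κ, b.tensorProduct c, b'.tensorProduct c', fun i => ?_⟩
  rw [Basis.tensorProduct_apply', Basis.tensorProduct_apply', tmap_tmul, h, h']

theorem IsForm.liftBaseChange_bijective {f : M →ₗ[K] M'} (hf : IsForm E f) :
    Function.Bijective (f.liftBaseChange E) := by
  obtain ⟨ι, b, b', h⟩ := hf
  have : f.liftBaseChange E = ((b.baseChange E).equiv b' (Equiv.refl _)).toLinearMap := by
    apply (b.baseChange E).ext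
    intro i
    rw [LinearEquiv.coe_coe, Basis.equiv_apply]
    simp [h]
  rw [this]
  exact LinearEquiv.bijective _

end Forms

/-! ### Descent of Hopf algebra structures to a form -/

section HopfForms

open Coalgebra

variable {K E H C : Type u} [Field K] [Field E] [Algebra K E]
  [Ring H] [Algebra K H] [Ring C] [HopfAlgebra E C] [Algebra K C] [IsScalarTower K E C]

/-- The algebra map `i : H → C` exhibits `H` as a `K`-form of the `E`-Hopf algebra `C`. -/
structure IsHopfForm (i : H →ₐ[K] C) : Prop where
  form : IsForm E i.toLinearMap
  comul_mem : ∀ h, comul (R := E) (i h) ∈ LinearMap.range (tmap E i.toLinearMap i.toLinearMap)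
  counit_mem : ∀ h, counit (R := E) (i h) ∈ LinearMap.range (Algebra.linearMap K E)
  antipode_mem : ∀ h, HopfAlgebra.antipode E (i h) ∈ LinearMap.range i.toLinearMap

theorem tmap_mul (i : H →ₐ[K] C) (x y : H ⊗[K] H) :
    tmap E i.toLinearMap i.toLinearMap (x * y) =
      tmap E i.toLinearMap i.toLinearMap x * tmap E i.toLinearMap i.toLinearMap y := by
  induction x with
  | zero => simp
  | add a b ha hb => simp [add_mul, ha, hb]
  | tmul a b =>
    induction y with
    | zero => simp
    | add c d hc hd => simp [mul_add, hc, hd]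
    | tmul c d => simp

namespace IsHopfForm

variable {i : H →ₐ[K] C} (hi : IsHopfForm (E := E) i)
include hi

/-- The comultiplication of a form of a Hopf algebra. -/
def comulMap : H →ₗ[K] H ⊗[K] H :=
  (LinearEquiv.ofInjective _ (hi.form.tmap hi.form).injective).symm.toLinearMap ∘ₗ
    ((comul (R := E) (A := C)).restrictScalars K ∘ₗ i.toLinearMap).codRestrict _ hi.comul_mem

theorem tmap_comulMap (h : H) :
    tmap E i.toLinearMap i.toLinearMap (hi.comulMap h) = comul (R := E) (i h) := by
  have := LinearEquiv.apply_symm_apply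
    (LinearEquiv.ofInjective _ (hi.form.tmap hi.form).injective)
    (⟨comul (R := E) (i h), hi.comul_mem h⟩ : LinearMap.range _)
  exact congrArg Subtype.val this

/-- The counit of a form of a Hopf algebra. -/
def counitMap : H →ₗ[K] K :=
  (LinearEquiv.ofInjective (Algebra.linearMap K E) (algebraMap K E).injective).symm.toLinearMap ∘ₗ
    ((counit (R := E) (A := C)).restrictScalars K ∘ₗ i.toLinearMap).codRestrict _ hi.counit_mem

theorem algebraMap_counitMap (h : H) :
    algebraMap K E (hi.counitMap h) = counit (R := E) (i h) := by
  have := LinearEquiv.apply_symm_apply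
    (LinearEquiv.ofInjective (Algebra.linearMap K E) (algebraMap K E).injective)
    (⟨counit (R := E) (i h), hi.counit_mem h⟩ : LinearMap.range _)
  exact congrArg Subtype.val this

/-- The antipode of a form of a Hopf algebra. -/
def antipodeMap : H →ₗ[K] H :=
  (LinearEquiv.ofInjective _ hi.form.injective).symm.toLinearMap ∘ₗ
    ((HopfAlgebra.antipode E (A := C)).restrictScalars K ∘ₗ i.toLinearMap).codRestrict _
      hi.antipode_mem

theorem map_antipodeMap (h : H) :
    i (hi.antipodeMap h) = HopfAlgebra.antipode E (i h) := by
  have := LinearEquiv.apply_symm_apply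
    (LinearEquiv.ofInjective _ hi.form.injective)
    (⟨HopfAlgebra.antipode E (i h), hi.antipode_mem h⟩ : LinearMap.range i.toLinearMap)
  exact congrArg Subtype.val this

theorem map_injective : Function.Injective i := hi.form.injective

/-- The coalgebra structure on a form of a Hopf algebra. -/
@[reducible]
def coalgebra : Coalgebra K H where
  comul := hi.comulMap
  counit := hi.counitMap
  coassoc := by
    have h1 : ∀ t : H ⊗[K] H, tmap E i.toLinearMap (tmap E i.toLinearMap i.toLinearMap)
        (TensorProduct.assoc K H H H (hi.comulMap.rTensor H t)) =
        TensorProduct.assoc E C C C ((comul (R := E) (A := C)).rTensor C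
          (tmap E i.toLinearMap i.toLinearMap t)) := by
      intro t
      induction t with
      | zero => simp
      | add a b ha hb => simp only [map_add, ha, hb]
      | tmul a b =>
        simp only [LinearMap.rTensor_tmul, tmap_tmul, AlgHom.toLinearMap_apply]
        rw [← hi.tmap_comulMap a]
        generalize hi.comulMap a = s
        induction s with
        | zero => simp
        | add a b ha hb => simp only [map_add, TensorProduct.add_tmul, ha, hb]
        | tmul c d => simp
    have h2 : ∀ t : H ⊗[K] H, tmap E i.toLinearMap (tmap E i.toLinearMap i.toLinearMap)
        (hi.comulMap.lTensor H t) =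
        (comul (R := E) (A := C)).lTensor C (tmap E i.toLinearMap i.toLinearMap t) := by
      intro t
      induction t with
      | zero => simp
      | add a b ha hb => simp only [map_add, ha, hb]
      | tmul a b => simp [hi.tmap_comulMap b]
    ext h
    -- The axioms are tested after an injection into the corresponding tensor power of `C`, where
    -- they are known.
    apply (hi.form.tmap (hi.form.tmap hi.form)).injective
    simp only [LinearMap.comp_apply, LinearEquiv.coe_coe, h1, h2, hi.tmap_comulMap,
      coassoc_apply]
  rTensor_counit_comp_comul := by
    have h1 : ∀ t : H ⊗[K] H, tmap E (Algebra.linearMap K E) i.toLinearMap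
        (hi.counitMap.rTensor H t) =
        (counit (R := E) (A := C)).rTensor C (tmap E i.toLinearMap i.toLinearMap t) := by
      intro t
      induction t with
      | zero => simp
      | add a b ha hb => simp only [map_add, ha, hb]
      | tmul a b => simp [hi.algebraMap_counitMap a]
    ext h
    apply (TensorProduct.lid K H).injective
    apply hi.map_injective
    have h2 : ∀ t : K ⊗[K] H, i (TensorProduct.lid K H t) =
        TensorProduct.lid E C (tmap E (Algebra.linearMap K E) i.toLinearMap t) := by
      intro t
      induction t with
      | zero => simp
      | add a b ha hb => simp only [map_add, ha, hb]
      | tmul a b => simp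
    simp only [LinearMap.comp_apply, h2, h1, hi.tmap_comulMap]
    simp
  lTensor_counit_comp_comul := by
    have h1 : ∀ t : H ⊗[K] H, tmap E i.toLinearMap (Algebra.linearMap K E)
        (hi.counitMap.lTensor H t) =
        (counit (R := E) (A := C)).lTensor C (tmap E i.toLinearMap i.toLinearMap t) := by
      intro t
      induction t with
      | zero => simp
      | add a b ha hb => simp only [map_add, ha, hb]
      | tmul a b => simp [hi.algebraMap_counitMap b]
    ext h
    apply (TensorProduct.rid K H).injective
    apply hi.map_injective
    have h2 : ∀ t : H ⊗[K] K, i (TensorProduct.rid K H t) =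
        TensorProduct.rid E C (tmap E i.toLinearMap (Algebra.linearMap K E) t) := by
      intro t
      induction t with
      | zero => simp
      | add a b ha hb => simp only [map_add, ha, hb]
      | tmul a b => simp
    simp only [LinearMap.comp_apply, h2, h1, hi.tmap_comulMap]
    simp

/-- The bialgebra structure on a form of a Hopf algebra. -/
@[reducible]
def bialgebra : Bialgebra K H :=
  letI := hi.coalgebra
  Bialgebra.mk' K H
    ((algebraMap K E).injective (by
      change algebraMap K E (hi.counitMap 1) = _
      rw [hi.algebraMap_counitMap]; simp))
    (fun {a b} => (algebraMap K E).injective (by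
      change algebraMap K E (hi.counitMap _) = algebraMap K E (hi.counitMap _ * hi.counitMap _)
      rw [map_mul (algebraMap K E)]
      simp only [hi.algebraMap_counitMap]; simp))
    ((hi.form.tmap hi.form).injective (by
      change tmap E i.toLinearMap i.toLinearMap (hi.comulMap _) = _
      rw [hi.tmap_comulMap]; simp [Algebra.TensorProduct.one_def]))
    (fun {a b} => (hi.form.tmap hi.form).injective (by
      change tmap E i.toLinearMap i.toLinearMap (hi.comulMap _) =
        tmap E i.toLinearMap i.toLinearMap (hi.comulMap _ * hi.comulMap _)
      rw [tmap_mul]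
      simp only [hi.tmap_comulMap]; simp))

/-- The Hopf algebra structure on a form of a Hopf algebra. -/
@[reducible]
def hopfAlgebra : HopfAlgebra K H :=
  letI := hi.bialgebra
  { antipode := hi.antipodeMap
    mul_antipode_rTensor_comul := by
      have h1 : ∀ t : H ⊗[K] H, i (LinearMap.mul' K H (hi.antipodeMap.rTensor H t)) =
          LinearMap.mul' E C ((HopfAlgebra.antipode E (A := C)).rTensor C
            (tmap E i.toLinearMap i.toLinearMap t)) := by
        intro t
        induction t with
        | zero => simp
        | add a b ha hb => simp only [map_add, ha, hb]
        | tmul a b => simp [hi.map_antipodeMap a]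
      ext h
      apply hi.map_injective
      change i (LinearMap.mul' K H (hi.antipodeMap.rTensor H (hi.comulMap h))) =
        i (algebraMap K H (hi.counitMap h))
      rw [h1, hi.tmap_comulMap, HopfAlgebra.mul_antipode_rTensor_comul_apply, AlgHom.commutes,
        IsScalarTower.algebraMap_apply K E C, hi.algebraMap_counitMap]
    mul_antipode_lTensor_comul := by
      have h1 : ∀ t : H ⊗[K] H, i (LinearMap.mul' K H (hi.antipodeMap.lTensor H t)) =
          LinearMap.mul' E C ((HopfAlgebra.antipode E (A := C)).lTensor C
            (tmap E i.toLinearMap i.toLinearMap t)) := by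
        intro t
        induction t with
        | zero => simp
        | add a b ha hb => simp only [map_add, ha, hb]
        | tmul a b => simp [hi.map_antipodeMap b]
      ext h
      apply hi.map_injective
      change i (LinearMap.mul' K H (hi.antipodeMap.lTensor H (hi.comulMap h))) =
        i (algebraMap K H (hi.counitMap h))
      rw [h1, hi.tmap_comulMap, HopfAlgebra.mul_antipode_lTensor_comul_apply, AlgHom.commutes,
        IsScalarTower.algebraMap_apply K E C, hi.algebraMap_counitMap] }

theorem isCocomm [IsCocomm E C] :
    letI := hi.hopfAlgebra
    IsCocomm K H := by
  let _ := hi.hopfAlgebra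
  refine ⟨?_⟩
  have h1 : ∀ t : H ⊗[K] H, tmap E i.toLinearMap i.toLinearMap (TensorProduct.comm K H H t) =
      TensorProduct.comm E C C (tmap E i.toLinearMap i.toLinearMap t) := by
    intro t
    induction t with
    | zero => simp
    | add a b ha hb => simp only [map_add, ha, hb]
    | tmul a b => simp
  ext h
  apply (hi.form.tmap hi.form).injective
  change tmap E i.toLinearMap i.toLinearMap (TensorProduct.comm K H H (hi.comulMap h)) =
    tmap E i.toLinearMap i.toLinearMap (hi.comulMap h)
  rw [h1, hi.tmap_comulMap, comm_comul]

/-- The base change of a form of a Hopf algebra is the Hopf algebra itself. -/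
theorem exists_bialgEquiv :
    letI := hi.hopfAlgebra
    Nonempty ((E ⊗[K] H) ≃ₐc[E] C) := by
  let _ := hi.hopfAlgebra
  let ψ : E ⊗[K] H →ₐ[E] C := Algebra.TensorProduct.lift (Algebra.ofId E C) i
    (fun e h => Algebra.commutes e (i h))
  have hψ : ∀ e h, ψ (e ⊗ₜ h) = e • i h := fun e h =>
    (Algebra.TensorProduct.lift_tmul _ _ _ e h).trans (Algebra.smul_def e (i h)).symm
  have hbij : Function.Bijective ψ := by
    have : ψ.toLinearMap = i.toLinearMap.liftBaseChange E := by
      ext h; simp [hψ]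
    have h2 := hi.form.liftBaseChange_bijective
    rw [← this] at h2
    exact h2
  have hcounit : ∀ x, counit (R := E) (ψ x) = counit (R := E) x := by
    intro x
    induction x with
    | zero => simp
    | add a b ha hb => simp only [map_add, ha, hb]
    | tmul e h =>
      rw [hψ, TensorProduct.counit_tmul, map_smul, ← hi.algebraMap_counitMap]
      change e • _ = hi.counitMap h • e
      rw [Algebra.smul_def (hi.counitMap h), smul_eq_mul, mul_comm]
  have hcomul : ∀ x, TensorProduct.map ψ.toLinearMap ψ.toLinearMap (comul (R := E) x) =
      comul (R := E) (ψ x) := by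
    intro x
    induction x with
    | zero => simp
    | add a b ha hb => simp only [map_add, ha, hb]
    | tmul e h =>
      rw [hψ, TensorProduct.comul_tmul, map_smul, ← hi.tmap_comulMap]
      change TensorProduct.map ψ.toLinearMap ψ.toLinearMap
        (TensorProduct.AlgebraTensorModule.tensorTensorTensorComm K E K E E E H H
          ((1 ⊗ₜ e) ⊗ₜ hi.comulMap h)) = _
      generalize hi.comulMap h = t
      induction t with
      | zero => simp
      | add a b ha hb => simp only [map_add, TensorProduct.tmul_add, ha, hb, smul_add]
      | tmul a b => simp [hψ, TensorProduct.smul_tmul']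
  let φ : E ⊗[K] H →ₐc[E] C := BialgHom.ofAlgHom ψ
    (by apply AlgHom.ext; intro x; exact hcounit x)
    (by apply AlgHom.ext; intro x; exact hcomul x)
  exact ⟨BialgEquiv.ofBijective φ hbij⟩

end IsHopfForm

end HopfForms

/-! ### Galois descent for group algebras -/

section Descent

open Module MonoidAlgebra Coalgebra

variable {K E : Type u} [Field K] [Field E] [Algebra K E]
variable {N : Type u} [Group N] (κ : (E ≃ₐ[K] E) →* MulAut N)

/-- The semilinear action of `Gal(E/K)` on the group algebra `E[N]` coming from an action on
`N` by automorphisms. -/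
def galAct (γ : E ≃ₐ[K] E) : MonoidAlgebra E N →+* MonoidAlgebra E N :=
  (mapDomainRingHom E (κ γ).toMonoidHom).comp (mapRingHom N (γ : E →+* E))

@[simp]
theorem galAct_single (γ : E ≃ₐ[K] E) (n : N) (e : E) :
    galAct κ γ (single n e) = single (κ γ n) (γ e) := by
  simp [galAct]

theorem galAct_smul (γ : E ≃ₐ[K] E) (e : E) (x : MonoidAlgebra E N) :
    galAct κ γ (e • x) = γ e • galAct κ γ x := by
  induction x using MonoidAlgebra.induction_linear with
  | zero => simp
  | add x y hx hy => simp only [smul_add, map_add, hx, hy]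
  | single n r => simp [smul_single]

/-- The `K`-algebra of fixed points of `Gal(E/K)` in `E[N]`. -/
def fixedAlg : Subalgebra K (MonoidAlgebra E N) where
  carrier := {x | ∀ γ, galAct κ γ x = x}
  mul_mem' := fun ha hb γ => by rw [map_mul, ha γ, hb γ]
  add_mem' := fun ha hb γ => by rw [map_add, ha γ, hb γ]
  algebraMap_mem' := fun k γ => by
    rw [Algebra.algebraMap_eq_smul_one, ← algebraMap_smul E k, galAct_smul, map_one,
      AlgEquiv.commutes]

/-- In a basis of fixed vectors the semilinear action is the Galois action on coordinates, so fixed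
elements have coordinates in `K`. -/
theorem repr_mem_of_fixed {ι : Type*} (b : Basis ι E (MonoidAlgebra E N))
    (hb : ∀ i, b i ∈ fixedAlg κ) (γ : E ≃ₐ[K] E) (x : MonoidAlgebra E N) (i : ι) :
    b.repr (galAct κ γ x) i = γ (b.repr x i) := by
  have h : galAct κ γ x = Finsupp.linearCombination E b
      ((b.repr x).mapRange γ (map_zero γ)) := by
    conv_lhs => rw [← b.linearCombination_repr x]
    rw [Finsupp.linearCombination_apply, Finsupp.linearCombination_apply, Finsupp.sum,
      Finsupp.sum_mapRange_index (by simp), Finsupp.sum, map_sum]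
    refine Finset.sum_congr rfl fun j _ => ?_
    rw [galAct_smul, hb j γ]
  rw [h, b.repr_linearCombination]
  simp

variable [FiniteDimensional K E]

/-- Galois descent. A functional killing all fixed elements kills the orbit sums `∑ γ(e) κ(γ)(n)`
for every `e`; Dedekind independence of the automorphisms makes each coefficient vanish, and the one
at the identity is the value at `n`. -/
theorem span_fixedAlg : Submodule.span E (fixedAlg κ : Set (MonoidAlgebra E N)) = ⊤ := by
  have key : ∀ n : N, single n (1 : E) ∈
      Submodule.span E (fixedAlg κ : Set (MonoidAlgebra E N)) := by
    intro n
    by_contra hn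
    obtain ⟨f, hf, hle⟩ := Submodule.exists_le_ker_of_notMem hn
    apply hf
    have hli := linearIndependent_toLinearMap K E E
    have hli' := hli.comp (fun γ : E ≃ₐ[K] E => (γ : E →ₐ[K] E))
      (fun a b h => AlgEquiv.coe_toAlgHom_injective h)
    rw [Fintype.linearIndependent_iff] at hli'
    have h0 := hli' (fun γ => f (single (κ γ n) 1)) (by
      ext e
      have hmem : ∑ γ : E ≃ₐ[K] E, single (κ γ n) (γ e) ∈ fixedAlg κ := by
        intro δ
        rw [map_sum]
        simp only [galAct_single]
        refine Fintype.sum_equiv (Equiv.mulLeft δ) _ _ (fun γ => ?_)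
        simp
      have := hle (Submodule.subset_span hmem)
      rw [LinearMap.mem_ker, map_sum] at this
      simp only [LinearMap.coe_sum, Finset.sum_apply, LinearMap.smul_apply, Function.comp_apply,
        LinearMap.zero_apply]
      rw [← this]
      refine Finset.sum_congr rfl fun γ _ => ?_
      rw [← mul_one (γ e), ← smul_eq_mul (γ e) 1, ← smul_single, map_smul]
      simp [mul_comm]) 1
    simpa using h0
  rw [eq_top_iff]
  intro x _
  induction x using MonoidAlgebra.induction_linear with
  | zero => exact Submodule.zero_mem _
  | add x y hx hy => exact Submodule.add_mem _ (hx trivial) (hy trivial)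
  | single m r =>
    rw [← mul_one r, ← smul_eq_mul r 1, ← smul_single]
    exact Submodule.smul_mem _ _ (key m)

theorem mem_range_algebraMap_of_fixed [IsGalois K E] {e : E} (h : ∀ γ : E ≃ₐ[K] E, γ e = e) :
    e ∈ Set.range (algebraMap K E) :=
  (IsGalois.mem_range_algebraMap_iff_fixed e).2 h

variable [IsGalois K E]

/-- An `E`-basis can be extracted from the spanning set of fixed elements. Fixed elements have
Galois-invariant coordinates in it, so it is also a `K`-basis of the fixed algebra. -/
theorem exists_fixed_basis : ∃ (ι : Type u) (b : Basis ι K (fixedAlg κ))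
    (b' : Basis ι E (MonoidAlgebra E N)), ∀ i, (fixedAlg κ).val.toLinearMap (b i) = b' i := by
  let b' := Basis.ofSpan (span_fixedAlg κ).ge
  have hb' : ∀ i, b' i ∈ fixedAlg κ := fun i =>
    Basis.ofSpan_subset (span_fixedAlg κ).ge ⟨i, rfl⟩
  let v : _ → fixedAlg κ := fun i => ⟨b' i, hb' i⟩
  have hli : LinearIndependent K v := by
    refine LinearIndependent.of_comp (fixedAlg κ).val.toLinearMap ?_
    exact b'.linearIndependent.restrict_scalars' K
  have hsp : ⊤ ≤ Submodule.span K (Set.range v) := by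
    rintro ⟨x, hx⟩ -
    have hc : ∀ i, ∃ k : K, algebraMap K E k = b'.repr x i := fun i =>
      mem_range_algebraMap_of_fixed fun γ => by
        rw [← repr_mem_of_fixed κ b' hb', hx γ]
    choose k hk using hc
    have : (⟨x, hx⟩ : fixedAlg κ) = ∑ i ∈ (b'.repr x).support, k i • v i := by
      apply Subtype.ext
      rw [AddSubmonoidClass.coe_finsetSum]
      refine (b'.linearCombination_repr x).symm.trans ?_
      rw [Finsupp.linearCombination_apply, Finsupp.sum]
      refine Finset.sum_congr rfl fun i _ => ?_
      rw [← hk i, algebraMap_smul]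
      rfl
    rw [this]
    exact Submodule.sum_mem _ fun i _ =>
      Submodule.smul_mem _ _ (Submodule.subset_span ⟨i, rfl⟩)
  exact ⟨_, Basis.mk hli hsp, b', fun i => by simp [v]⟩

/-- The structure maps of `E[N]` commute with the semilinear action, hence send fixed elements to
elements defined over `K`. -/
theorem isHopfForm_fixedAlg : IsHopfForm (E := E) (fixedAlg κ).val := by
  obtain ⟨ι, b, b', hb⟩ := exists_fixed_basis κ
  have hb' : ∀ i, b' i ∈ fixedAlg κ := fun i => by rw [← hb i]; exact (b i).2
  refine ⟨⟨ι, b, b', hb⟩, ?_, ?_, ?_⟩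
  · rintro ⟨h, hh⟩
    refine mem_range_of_repr_mem (f := tmap E _ _) (b.tensorProduct b) (b'.tensorProduct b') ?_ _ ?_
    · intro i
      rw [Basis.tensorProduct_apply', Basis.tensorProduct_apply', tmap_tmul, hb, hb]
    · rintro ⟨j, k⟩
      refine mem_range_algebraMap_of_fixed fun γ => ?_
      have hγ : ∀ x : MonoidAlgebra E N,
          (b'.tensorProduct b').repr (comul (R := E) (galAct κ γ x)) (j, k) =
            γ ((b'.tensorProduct b').repr (comul (R := E) x) (j, k)) := by
        intro x
        induction x using MonoidAlgebra.induction_linear with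
        | zero => simp
        | add x y hx hy => simp [hx, hy]
        | single n r =>
          have hs : ∀ (n : N) (r : E), (comul (R := E) (single n r : MonoidAlgebra E N)) =
              r • (single n 1 ⊗ₜ[E] single n 1) := by
            intro n r
            have : (single n r : MonoidAlgebra E N) = r • single n 1 := by simp
            rw [this, map_smul]
            simp
          have h1 : (single (κ γ n) 1 : MonoidAlgebra E N) = galAct κ γ (single n 1) := by simp
          rw [galAct_single, hs, hs, h1]
          simp only [map_smul, Finsupp.smul_apply, Basis.tensorProduct_repr_tmul_apply,
            repr_mem_of_fixed κ b' hb', smul_eq_mul, map_mul]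
      rw [← hγ]
      exact congrArg (fun x => (b'.tensorProduct b').repr (comul (R := E) x) (j, k)) (hh γ)
  · rintro ⟨h, hh⟩
    obtain ⟨k, hk⟩ := mem_range_algebraMap_of_fixed (K := K) (e := counit (R := E) h) fun γ => by
      have hγ : ∀ x : MonoidAlgebra E N,
          counit (R := E) (galAct κ γ x) = γ (counit (R := E) x) := by
        intro x
        induction x using MonoidAlgebra.induction_linear with
        | zero => simp
        | add x y hx hy => simp [hx, hy]
        | single n r => simp
      rw [← hγ, hh γ]
    exact ⟨k, hk⟩
  · rintro ⟨h, hh⟩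
    refine ⟨⟨HopfAlgebra.antipode E h, fun γ => ?_⟩, rfl⟩
    have hγ : ∀ x : MonoidAlgebra E N,
        galAct κ γ (HopfAlgebra.antipode E x) = HopfAlgebra.antipode E (galAct κ γ x) := by
      intro x
      induction x using MonoidAlgebra.induction_linear with
      | zero => simp
      | add x y hx hy => simp [hx, hy]
      | single n r => simp
    rw [hγ, hh γ]

theorem finrank_fixedAlg [Finite N] : finrank K (fixedAlg κ) = Nat.card N := by
  obtain ⟨ι, b, b', hb⟩ := exists_fixed_basis κ
  rw [finrank_eq_nat_card_basis b, ← finrank_eq_nat_card_basis b',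
    (MonoidAlgebra.coeffLinearEquiv E).finrank_eq]
  have := Fintype.ofFinite N
  rw [finrank_finsupp_self, Nat.card_eq_fintype_card]

end Descent

/-! ### Operators on embeddings -/

section Embeddings

open Module MonoidAlgebra

variable {K L E : Type u} [Field K] [Field L] [Field E] [Algebra K L] [Algebra K E]

variable (K L E) in
/-- Families of `K`-linear maps `L → E` indexed by the embeddings of `L` in `E`. -/
abbrev EmbSpace : Type u := (L →ₐ[K] E) → (L →ₗ[K] E)

variable (K L E) in
/-- The family of all `y ∘ T`, for `T` an endomorphism of `L`. -/
def transMap : Module.End K L →ₗ[K] EmbSpace K L E where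
  toFun T y := y.toLinearMap ∘ₗ T
  map_add' _ _ := by ext; simp
  map_smul' _ _ := by ext; simp

@[simp]
theorem transMap_apply (T : Module.End K L) (y : L →ₐ[K] E) (l : L) :
    transMap K L E T y l = y (T l) := rfl

/-- The family `y ↦ π⁻¹ y` attached to a permutation of the embeddings. -/
def permMap (π : Equiv.Perm (L →ₐ[K] E)) : EmbSpace K L E := fun y => (π⁻¹ y).toLinearMap

@[simp]
theorem permMap_apply (π : Equiv.Perm (L →ₐ[K] E)) (y : L →ₐ[K] E) (l : L) :
    permMap π y l = (π⁻¹ y) l := rfl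

/-- The action of `Gal(E/K)` on the embeddings of `L` in `E`. -/
def galPerm : (E ≃ₐ[K] E) →* Equiv.Perm (L →ₐ[K] E) where
  toFun γ :=
    { toFun := fun y => (γ : E →ₐ[K] E).comp y
      invFun := fun y => (γ.symm : E →ₐ[K] E).comp y
      left_inv := fun y => by ext; simp
      right_inv := fun y => by ext; simp }
  map_one' := by ext; rfl
  map_mul' _ _ := by ext; rfl

@[simp]
theorem galPerm_apply (γ : E ≃ₐ[K] E) (y : L →ₐ[K] E) (l : L) : galPerm γ y l = γ (y l) := rfl

@[simp]
theorem galPerm_inv_apply (γ : E ≃ₐ[K] E) (y : L →ₐ[K] E) (l : L) :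
    (galPerm γ)⁻¹ y l = γ⁻¹ (y l) := rfl

/-- The semilinear action of `Gal(E/K)` on families of linear maps. -/
def galMap (γ : E ≃ₐ[K] E) : EmbSpace K L E →+ EmbSpace K L E where
  toFun F y := γ.toLinearMap ∘ₗ F ((galPerm γ)⁻¹ y)
  map_zero' := by ext; simp
  map_add' _ _ := by ext; simp

theorem galMap_apply (γ : E ≃ₐ[K] E) (F : EmbSpace K L E) (y : L →ₐ[K] E) (l : L) :
    galMap γ F y l = γ (F ((galPerm γ)⁻¹ y) l) := rfl

theorem galMap_smul (γ : E ≃ₐ[K] E) (e : E) (F : EmbSpace K L E) :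
    galMap γ (e • F) = γ e • galMap γ F := by
  ext y l
  simp [galMap_apply]

theorem galMap_transMap (γ : E ≃ₐ[K] E) (T : Module.End K L) :
    galMap γ (transMap K L E T) = transMap K L E T := by
  ext y l
  simp only [galMap_apply, transMap_apply, galPerm_inv_apply]
  exact γ.apply_symm_apply _

/-- This turns Galois stability of a space of families into the condition that a permutation group
is normalised. -/
theorem galMap_permMap (γ : E ≃ₐ[K] E) (π : Equiv.Perm (L →ₐ[K] E)) :
    galMap γ (permMap π) = permMap (galPerm γ * π * (galPerm γ)⁻¹) := by
  ext y l
  simp [galMap_apply, mul_assoc]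

/-- The `E`-span of the families attached to a space of endomorphisms of `L`. -/
def opSpan (A : Submodule K (Module.End K L)) : Submodule E (EmbSpace K L E) :=
  Submodule.span E (transMap K L E '' A)

theorem galMap_mem_opSpan {A : Submodule K (Module.End K L)} (γ : E ≃ₐ[K] E)
    {F : EmbSpace K L E} (hF : F ∈ opSpan A) : galMap γ F ∈ opSpan A := by
  induction hF using Submodule.span_induction with
  | mem x hx =>
    obtain ⟨T, hT, rfl⟩ := hx
    rw [galMap_transMap]
    exact Submodule.subset_span ⟨T, hT, rfl⟩
  | zero => rw [map_zero]; exact Submodule.zero_mem _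
  | add x y _ _ hx hy => rw [map_add]; exact Submodule.add_mem _ hx hy
  | smul e x _ hx => rw [galMap_smul]; exact Submodule.smul_mem _ _ hx

theorem linearIndependent_embeddings :
    LinearIndependent E (fun y : L →ₐ[K] E => y.toLinearMap) :=
  linearIndependent_toLinearMap K L E

/-! ### Group algebras acting through permutations of the embeddings -/

section Regular

variable {N : Type*} [Group N] (ρ : N →* Equiv.Perm (L →ₐ[K] E))

/-- The `E`-linear extension of `n ↦ permMap (ρ n)`. -/
def permLin : MonoidAlgebra E N →ₗ[E] EmbSpace K L E :=
  Finsupp.linearCombination E (fun n => permMap (ρ n)) ∘ₗ (coeffLinearEquiv E).toLinearMap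

@[simp]
theorem permLin_single (n : N) (e : E) : permLin ρ (single n e) = e • permMap (ρ n) := by
  simp [permLin]

/-- The inverse in `permMap` makes left multiplication by `n` a shift of the index; the
multiplicativity of the action built in `exists_structure` rests on it. -/
theorem permLin_mul_single (x : MonoidAlgebra E N) (n : N) (e : E) (y : L →ₐ[K] E) :
    permLin ρ (single n e * x) y = e • permLin ρ x ((ρ n)⁻¹ y) := by
  induction x using MonoidAlgebra.induction_linear with
  | zero => simp
  | add a b ha hb => simp only [mul_add, map_add, Pi.add_apply, ha, hb, smul_add]
  | single m r =>
    rw [single_mul_single, permLin_single, permLin_single]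
    ext l
    simp [mul_assoc]

variable {ρ}

/-- By regularity different `n` move `y` to different embeddings, and embeddings are linearly
independent. -/
theorem permLin_apply_injective (hρ : ∀ x y, ∃! n, ρ n x = y) (y : L →ₐ[K] E) :
    Function.Injective (fun x : MonoidAlgebra E N => permLin ρ x y) := by
  have hinj : Function.Injective (fun n : N => (ρ n)⁻¹ y) := by
    intro n m h
    have h' : (ρ n)⁻¹ y = (ρ m)⁻¹ y := h
    refine (hρ ((ρ n)⁻¹ y) y).unique (by simp) ?_
    rw [h']
    simp
  have hli := linearIndependent_embeddings.comp _ hinj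
  have : (fun x : MonoidAlgebra E N => permLin ρ x y) =
      fun x => Finsupp.linearCombination E
        ((fun y : L →ₐ[K] E => y.toLinearMap) ∘ fun n : N => (ρ n)⁻¹ y) x.coeff := by
    funext x
    induction x using MonoidAlgebra.induction_linear with
    | zero => simp
    | add a b ha hb => simp only [map_add, Pi.add_apply, ha, hb, coeff_add]
    | single m r => rw [permLin_single]; ext l; simp
  rw [this]
  exact Function.Injective.comp hli coeff_injective

/-- At each `y` the family of `π` agrees with that of the unique `n` moving `π⁻¹ y` to `y`.
Injectivity of evaluation at `y` forces the preimage to be the group element `n`, which therefore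
does not depend on `y`. -/
theorem mem_range_of_permMap_mem [Nonempty (L →ₐ[K] E)] (hρ : ∀ x y, ∃! n, ρ n x = y)
    {π : Equiv.Perm (L →ₐ[K] E)} (h : permMap π ∈ LinearMap.range (permLin ρ)) :
    π ∈ ρ.range := by
  obtain ⟨w, hw⟩ := h
  have key : ∀ y, ∃ n : N, w = single n 1 ∧ ρ n (π⁻¹ y) = y := by
    intro y
    obtain ⟨n, hn, -⟩ := hρ (π⁻¹ y) y
    refine ⟨n, permLin_apply_injective hρ y ?_, hn⟩
    have : (ρ n)⁻¹ y = π⁻¹ y := by rw [Equiv.Perm.inv_eq_iff_eq, hn]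
    simp only [hw, permLin_single, one_smul]
    ext l
    simp [this]
  obtain ⟨y⟩ := ‹Nonempty (L →ₐ[K] E)›
  obtain ⟨n, hwn, -⟩ := key y
  refine ⟨n, ?_⟩
  ext1 z
  obtain ⟨m, hwm, hm⟩ := key (π z)
  have : n = m := by
    rw [hwn] at hwm
    exact single_left_injective one_ne_zero hwm
  rw [this]
  simpa using hm

theorem range_eq_of_range_permLin_eq [Nonempty (L →ₐ[K] E)] (hρ : ∀ x y, ∃! n, ρ n x = y) :
    (ρ.range : Set (Equiv.Perm (L →ₐ[K] E))) =
      {π | permMap π ∈ LinearMap.range (permLin (E := E) ρ)} := by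
  ext π
  constructor
  · rintro ⟨n, rfl⟩
    exact ⟨single n 1, by simp⟩
  · exact fun h => mem_range_of_permMap_mem hρ h

theorem range_permLin : LinearMap.range (permLin (E := E) ρ) =
    Submodule.span E (permMap '' (ρ.range : Set (Equiv.Perm (L →ₐ[K] E)))) := by
  apply le_antisymm
  · rintro _ ⟨x, rfl⟩
    induction x using MonoidAlgebra.induction_linear with
    | zero => simp
    | add a b ha hb => rw [map_add]; exact Submodule.add_mem _ ha hb
    | single m r =>
      rw [permLin_single]
      exact Submodule.smul_mem _ _ (Submodule.subset_span ⟨_, ⟨m, rfl⟩, rfl⟩)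
  · rw [Submodule.span_le]
    rintro _ ⟨_, ⟨n, rfl⟩, rfl⟩
    exact ⟨single n 1, by simp⟩

end Regular

variable [Algebra L E] [IsScalarTower K L E] [FiniteDimensional K E] [IsGalois K E]

theorem exists_galPerm_eq (y : L →ₐ[K] E) :
    ∃ γ : E ≃ₐ[K] E, galPerm γ (IsScalarTower.toAlgHom K L E) = y := by
  let f : E →ₐ[K] E := y.liftNormal E
  refine ⟨AlgEquiv.ofBijective f (Algebra.IsAlgebraic.algHom_bijective f), ?_⟩
  ext l
  exact y.liftNormal_commutes E l

theorem exists_galPerm_eq' (x y : L →ₐ[K] E) : ∃ γ : E ≃ₐ[K] E, galPerm γ x = y := by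
  obtain ⟨γ, rfl⟩ := exists_galPerm_eq x
  obtain ⟨δ, rfl⟩ := exists_galPerm_eq y
  exact ⟨δ * γ⁻¹, by rw [map_mul, map_inv, Equiv.Perm.mul_apply]; simp⟩

omit [FiniteDimensional K E] [IsGalois K E] in
theorem nonempty_embedding : Nonempty (L →ₐ[K] E) := ⟨IsScalarTower.toAlgHom K L E⟩

theorem card_embeddings : Nat.card (L →ₐ[K] E) = finrank K L := by
  have : FiniteDimensional K L := FiniteDimensional.left K L E
  have : Algebra.IsSeparable K L := Algebra.isSeparable_tower_bot_of_isSeparable K L E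
  rw [Nat.card_eq_fintype_card]
  refine AlgHom.card_of_splits K L E fun x => ?_
  rw [← minpoly.algebraMap_eq (algebraMap L E).injective x]
  exact Normal.splits inferInstance _

/-- Averaging over `Gal(E/K)` replaces the `E`-coefficients by their traces, so it takes `opSpan A`
back to the families coming from `A`. -/
theorem mem_of_transMap_mem {A : Submodule K (Module.End K L)} {T : Module.End K L}
    (hT : transMap K L E T ∈ opSpan (E := E) A) : T ∈ A := by
  have havg : ∀ F ∈ opSpan (E := E) A, ∑ γ : E ≃ₐ[K] E, galMap γ F ∈ transMap K L E '' A := by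
    intro F hF
    have hF' : F ∈ Submodule.span E (transMap K L E '' A) := hF
    rw [Submodule.mem_span_iff_exists_finset_subset] at hF'
    obtain ⟨c, t, ht, -, rfl⟩ := hF'
    have hsum : ∀ x ∈ transMap K L E '' A, ∀ e : E,
        ∑ γ : E ≃ₐ[K] E, galMap γ (e • x) = Algebra.trace K E e • x := by
      rintro _ ⟨T, _, rfl⟩ e
      simp only [galMap_smul, galMap_transMap]
      rw [← Finset.sum_smul, ← trace_eq_sum_automorphisms, algebraMap_smul]
    simp only [map_sum]
    rw [Finset.sum_comm]
    have : transMap K L E '' A = (A.map (transMap K L E) : Set _) := rfl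
    rw [this]
    refine Submodule.sum_mem _ fun x hx => ?_
    rw [hsum x (ht hx)]
    exact Submodule.smul_mem _ _ (by simpa using ht hx)
  -- Scaling by an element of trace one makes the average return the family of `T` itself.
  obtain ⟨c, hc⟩ := Algebra.trace_surjective K E 1
  obtain ⟨T', hT', h⟩ := havg (c • transMap K L E T) (Submodule.smul_mem _ _ hT)
  have h2 : ∑ γ : E ≃ₐ[K] E, galMap γ (c • transMap K L E T) = transMap K L E T := by
    simp only [galMap_smul, galMap_transMap]
    rw [← Finset.sum_smul, ← trace_eq_sum_automorphisms, hc, map_one, one_smul]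
  rw [h2] at h
  have : T' = T := by
    ext l
    have := congrArg (fun F => F (IsScalarTower.toAlgHom K L E) l) h
    exact (algebraMap L E).injective this
  exact this ▸ hT'

theorem opSpan_injective :
    Function.Injective (opSpan (K := K) (L := L) (E := E)) := by
  intro A B h
  apply le_antisymm
  · intro T hT
    exact mem_of_transMap_mem (E := E) (h ▸ Submodule.subset_span ⟨T, hT, rfl⟩)
  · intro T hT
    exact mem_of_transMap_mem (E := E) (h ▸ Submodule.subset_span ⟨T, hT, rfl⟩)

/-- A family of linear maps which is compatible with the action of `Gal(E/K)` comes from an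
endomorphism of `L`. -/
theorem exists_transMap_eq {F : EmbSpace K L E} (hF : ∀ γ, galMap γ F = F) :
    ∃ T, transMap K L E T = F := by
  have : IsGalois L E := IsGalois.tower_top_of_isGalois K L E
  have : FiniteDimensional L E := FiniteDimensional.right K L E
  let i : L →ₗ[K] E := (IsScalarTower.toAlgHom K L E).toLinearMap
  have hi : Function.Injective i := (algebraMap L E).injective
  have hmem : ∀ l, F (IsScalarTower.toAlgHom K L E) l ∈ LinearMap.range i := by
    intro l
    have : F (IsScalarTower.toAlgHom K L E) l ∈ Set.range (algebraMap L E) := by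
      rw [IsGalois.mem_range_algebraMap_iff_fixed]
      intro γ
      have h1 := congrArg (fun F => F (IsScalarTower.toAlgHom K L E) l) (hF (γ.restrictScalars K))
      have h2 : (galPerm (γ.restrictScalars K))⁻¹ (IsScalarTower.toAlgHom K L E) =
          IsScalarTower.toAlgHom K L E := by
        rw [Equiv.Perm.inv_eq_iff_eq]
        ext l
        simp
      simp only [galMap_apply, h2] at h1
      exact h1
    exact this
  refine ⟨(LinearEquiv.ofInjective i hi).symm.toLinearMap ∘ₗ
    (F (IsScalarTower.toAlgHom K L E)).codRestrict _ hmem, ?_⟩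
  ext y l
  obtain ⟨γ, rfl⟩ := exists_galPerm_eq y
  have h1 := LinearEquiv.apply_symm_apply (LinearEquiv.ofInjective i hi)
    ⟨F (IsScalarTower.toAlgHom K L E) l, hmem l⟩
  have h2 := congrArg Subtype.val h1
  have h3 := congrArg (fun F => F (galPerm γ (IsScalarTower.toAlgHom K L E)) l) (hF γ)
  have h4 : ∀ z, (galPerm (L := L) γ)⁻¹ (galPerm γ z) = z := fun z => by simp
  simp only [galMap_apply, h4] at h3
  rw [← h3]
  exact congrArg γ h2

end Embeddings

/-! ### From Hopf-Galois structures to regular subgroups -/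

namespace HopfGaloisStructure

open Module MonoidAlgebra Coalgebra

variable {K L : Type u} [Field K] [Field L] [Algebra K L] (S : HopfGaloisStructure K L)

/-- The image of the Hopf algebra in the endomorphisms of `L`. -/
def actRange : Submodule K (Module.End K L) := LinearMap.range S.act.toLinearMap

theorem act_injective : Function.Injective S.act := by
  intro a b h
  have h1 : (1 : L) ⊗ₜ[K] a = (1 : L) ⊗ₜ[K] b := by
    apply S.galois.1
    simp [h]
  exact Algebra.TensorProduct.includeRight_injective (A := L) (algebraMap K L).injective h1

/-- The bilinear map `L × L → L` attached to an element of `H ⊗ H`. -/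
def bilinAct (x y : L) : S.H ⊗[K] S.H →ₗ[K] L :=
  LinearMap.mul' K L ∘ₗ TensorProduct.map (LinearMap.applyₗ x ∘ₗ S.act.toLinearMap)
    (LinearMap.applyₗ y ∘ₗ S.act.toLinearMap)

@[simp]
theorem bilinAct_tmul (x y : L) (a b : S.H) :
    S.bilinAct x y (a ⊗ₜ b) = S.act a x * S.act b y := by
  simp [bilinAct]

theorem bilinAct_comul (h : S.H) (x y : L) : S.bilinAct x y (comul h) = S.act h (x * y) :=
  (S.act_mul h x y).symm

/-- Write `t = ∑ cᵢ ⊗ bᵢ` with `b` a basis of `H`. For fixed `x`, injectivity of the Galois map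
gives `cᵢ · x = 0` for all `i`, and the action is faithful. -/
theorem eq_zero_of_bilinAct_eq_zero {t : S.H ⊗[K] S.H} (ht : ∀ x y, S.bilinAct x y t = 0) :
    t = 0 := by
  classical
  let b := Basis.ofVectorSpace K S.H
  -- The Galois map in coordinates: the operators of the basis elements are linearly independent
  -- over `L`.
  have hinj : ∀ c : _ →₀ L, (∀ x, c.sum (fun i l => l * S.act (b i) x) = 0) → c = 0 := by
    intro c hc
    have h0 : (c.sum fun i l => l ⊗ₜ[K] b i) = 0 := by
      apply S.galois.1
      rw [map_zero]
      ext x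
      rw [Finsupp.sum, map_sum, LinearMap.sum_apply, LinearMap.zero_apply, ← hc x, Finsupp.sum]
      simp
    rw [← TensorProduct.equivFinsuppOfBasisRight_symm_apply b c] at h0
    exact (LinearEquiv.map_eq_zero_iff _).1 h0
  obtain ⟨c, rfl⟩ := (TensorProduct.equivFinsuppOfBasisRight (M := S.H) b).symm.surjective t
  rw [TensorProduct.equivFinsuppOfBasisRight_symm_apply] at ht ⊢
  have hc : c = 0 := by
    ext i
    apply S.act_injective
    rw [Finsupp.coe_zero, Pi.zero_apply, map_zero]
    ext x
    have h1 := hinj (c.mapRange (fun a => S.act a x) (by simp)) (fun y => by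
      rw [Finsupp.sum_mapRange_index (by simp)]
      have := ht x y
      rw [Finsupp.sum, map_sum] at this
      simpa [Finsupp.sum] using this)
    simpa using DFunLike.congr_fun h1 i
  simp [hc]

/-- The actions are faithful, so equal images give an algebra isomorphism. It is a Hopf map because
the action on `1` determines the counit and the action on products determines the comultiplication.
-/
theorem equivalent_of_actRange_eq {S T : HopfGaloisStructure K L}
    (h : S.actRange = T.actRange) : S.Equivalent T := by
  have hr : S.act.range = T.act.range := by
    ext x
    exact SetLike.ext_iff.1 h x
  let e : S.H ≃ₐ[K] T.H := (AlgEquiv.ofInjective S.act S.act_injective).trans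
    ((Subalgebra.equivOfEq _ _ hr).trans (AlgEquiv.ofInjective T.act T.act_injective).symm)
  have he : ∀ a, T.act (e a) = S.act a := by
    intro a
    have := AlgEquiv.apply_symm_apply (AlgEquiv.ofInjective T.act T.act_injective)
      (Subalgebra.equivOfEq _ _ hr (AlgEquiv.ofInjective S.act S.act_injective a))
    exact congrArg Subtype.val this
  have hbil : ∀ (t : S.H ⊗[K] S.H) (x y : L),
      T.bilinAct x y (TensorProduct.map e.toLinearMap e.toLinearMap t) = S.bilinAct x y t := by
    intro t x y
    induction t with
    | zero => simp
    | add a b ha hb => simp only [map_add, ha, hb]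
    | tmul a b => simp [he]
  have hcounit : ∀ a, counit (R := K) (e a) = counit (R := K) a := by
    intro a
    apply (algebraMap K L).injective
    have h1 := S.act_algebraMap a 1
    have h2 := T.act_algebraMap (e a) 1
    rw [he, h1, mul_one, mul_one] at h2
    exact h2.symm
  have hcomul : ∀ a, TensorProduct.map e.toLinearMap e.toLinearMap (comul (R := K) a) =
      comul (R := K) (e a) := by
    intro a
    rw [← sub_eq_zero]
    apply T.eq_zero_of_bilinAct_eq_zero
    intro x y
    rw [map_sub, hbil, bilinAct_comul, bilinAct_comul, he, sub_self]
  let φ : S.H →ₐc[K] T.H := BialgHom.ofAlgHom (e : S.H →ₐ[K] T.H)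
    (by apply AlgHom.ext; intro x; exact hcounit x)
    (by apply AlgHom.ext; intro x; exact hcomul x)
  exact ⟨BialgEquiv.ofBijective φ e.bijective, fun a => he a⟩

theorem actRange_eq_of_equivalent {S T : HopfGaloisStructure K L} (h : S.Equivalent T) :
    S.actRange = T.actRange := by
  obtain ⟨e, he⟩ := h
  ext x
  constructor
  · rintro ⟨a, rfl⟩
    exact ⟨e a, he a⟩
  · rintro ⟨a, rfl⟩
    refine ⟨e.symm a, ?_⟩
    have := he (e.symm a)
    rw [BialgEquiv.apply_symm_apply] at this
    exact this.symm

variable (E : Type u) [Field E] [Algebra K E]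

/-- The action of `E ⊗ H` on families of linear maps. -/
def baseAct : E ⊗[K] S.H →ₗ[E] EmbSpace K L E :=
  (transMap K L E ∘ₗ S.act.toLinearMap).liftBaseChange E

@[simp]
theorem baseAct_tmul (e : E) (h : S.H) :
    S.baseAct E (e ⊗ₜ h) = e • transMap K L E (S.act h) := by
  simp [baseAct]

theorem range_baseAct : LinearMap.range (S.baseAct E) = opSpan S.actRange := by
  rw [baseAct, LinearMap.range_liftBaseChange, opSpan]
  congr 1
  ext x
  simp [actRange]

variable {E}

theorem baseAct_mul_tmul (w : E ⊗[K] S.H) (e : E) (h : S.H) (y : L →ₐ[K] E) :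
    S.baseAct E (w * (e ⊗ₜ h)) y = e • S.baseAct E w y ∘ₗ S.act h := by
  induction w with
  | zero => simp
  | add a b ha hb => simp only [add_mul, map_add, Pi.add_apply, ha, hb, LinearMap.add_comp,
      smul_add]
  | tmul c d =>
    ext l
    simp
    ring

theorem baseAct_mul {w : E ⊗[K] S.H} {y z : L →ₐ[K] E}
    (h : S.baseAct E w y = z.toLinearMap) (w' : E ⊗[K] S.H) :
    S.baseAct E (w * w') y = S.baseAct E w' z := by
  induction w' with
  | zero => simp
  | add a b ha hb => simp only [mul_add, map_add, Pi.add_apply, ha, hb]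
  | tmul c d => rw [baseAct_mul_tmul, h, baseAct_tmul]; rfl

theorem baseAct_one (y : L →ₐ[K] E) : S.baseAct E 1 y = y.toLinearMap := by
  ext l
  simp [Algebra.TensorProduct.one_def]

/-- Evaluation at `y` and `l` of the action of `E ⊗ H`. -/
def evalAct (y : L →ₐ[K] E) (l : L) : E ⊗[K] S.H →ₗ[E] E where
  toFun w := S.baseAct E w y l
  map_add' _ _ := by simp
  map_smul' _ _ := by simp

theorem baseAct_apply_mul (w : E ⊗[K] S.H) (y : L →ₐ[K] E) (l m : L) :
    S.baseAct E w y (l * m) =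
      LinearMap.mul' E E (TensorProduct.map (S.evalAct y l) (S.evalAct y m)
        (comul (R := E) w)) := by
  induction w with
  | zero => simp
  | add a b ha hb => simp only [map_add, Pi.add_apply, LinearMap.add_apply, ha, hb]
  | tmul e h =>
    rw [baseAct_tmul]
    simp only [Pi.smul_apply, LinearMap.smul_apply, transMap_apply]
    rw [← bilinAct_comul, TensorProduct.comul_tmul, CommSemiring.comul_apply]
    generalize comul (R := K) h = t
    induction t with
    | zero => simp
    | add a b ha hb => simp only [map_add, TensorProduct.tmul_add, smul_add, ha, hb]
    | tmul a b =>
      simp [evalAct]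
      ring

theorem baseAct_apply_one (w : E ⊗[K] S.H) (y : L →ₐ[K] E) :
    S.baseAct E w y 1 = counit (R := E) w := by
  induction w with
  | zero => simp
  | add a b ha hb => simp only [map_add, Pi.add_apply, LinearMap.add_apply, ha, hb]
  | tmul e h =>
    have := S.act_algebraMap h 1
    rw [map_one, mul_one] at this
    simp [this, Algebra.smul_def, mul_comm]

/-- For a group-like element the module algebra law reduces to multiplicativity, so an embedding is
carried to an embedding. -/
theorem exists_baseAct_eq_of_isGroupLikeElem {w : E ⊗[K] S.H} (hw : IsGroupLikeElem E w)
    (y : L →ₐ[K] E) : ∃ z : L →ₐ[K] E, S.baseAct E w y = z.toLinearMap := by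
  refine ⟨AlgHom.ofLinearMap (S.baseAct E w y) ?_ ?_, rfl⟩
  · rw [baseAct_apply_one, hw.counit_eq_one]
  · intro l m
    rw [baseAct_apply_mul, hw.comul_eq_tmul_self]
    simp [evalAct]

theorem baseAct_apply_surjective [FiniteDimensional K L] (y : L →ₐ[K] E) :
    Function.Surjective (fun w => S.baseAct E w y) := by
  have h1 : ∀ t : L ⊗[K] S.H, ∃ w, S.baseAct E w y = y.toLinearMap ∘ₗ
      (LinearMap.mul' K (Module.End K L) ∘ₗ
        TensorProduct.map (LinearMap.mul K L) S.act.toLinearMap) t := by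
    intro t
    induction t with
    | zero => exact ⟨0, by simp⟩
    | add a b ha hb =>
      obtain ⟨w, hw⟩ := ha
      obtain ⟨w', hw'⟩ := hb
      refine ⟨w + w', ?_⟩
      rw [map_add, Pi.add_apply, hw, hw', map_add, LinearMap.comp_add]
    | tmul a h =>
      refine ⟨y a ⊗ₜ h, ?_⟩
      ext l
      simp
  have h2 : ∀ T : Module.End K L, ∃ w, S.baseAct E w y = y.toLinearMap ∘ₗ T := by
    intro T
    obtain ⟨t, rfl⟩ := S.galois.2 T
    exact h1 t
  intro f
  let b := Module.finBasis K L
  -- Rank-one endomorphisms with image in `K` suffice: their combinations with coefficients in `E`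
  -- give every linear map `L → E`.
  choose w hw using fun i => h2 ((b.coord i).smulRight (1 : L))
  refine ⟨∑ i, f (b i) • w i, ?_⟩
  apply b.ext
  intro j
  simp only [map_sum, map_smul, Finset.sum_apply, Pi.smul_apply, hw]
  simp [LinearMap.sum_apply, Finsupp.single_apply]

variable [Algebra L E] [IsScalarTower K L E] [FiniteDimensional K E] [IsGalois K E]

/-- A Hopf-Galois structure of type `N` gives a regular action of `N` on the embeddings. -/
theorem exists_regular_action {N : Type*} [Group N] [Finite N] (hN : Nat.card N = finrank K L)
    (φ : (E ⊗[K] S.H) ≃ₐc[E] MonoidAlgebra E N) :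
    ∃ ρ : N →* Equiv.Perm (L →ₐ[K] E), (∀ x y, ∃! n, ρ n x = y) ∧
      opSpan S.actRange = LinearMap.range (permLin (E := E) ρ) := by
  have : FiniteDimensional K L := FiniteDimensional.left K L E
  let u : N → E ⊗[K] S.H := fun n => φ.symm (single n 1)
  have hgl : ∀ n, IsGroupLikeElem E (u n) := fun n =>
    IsGroupLikeElem.map φ.symm (isGroupLikeElem_of n)
  have hmul : ∀ n m, u (n * m) = u n * u m := fun n m => by
    simp only [u]
    rw [← map_mul, single_mul_single, one_mul]
  have hone : u 1 = 1 := by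
    simp only [u]
    rw [← one_def, map_one]
  choose f hf using fun n y => S.exists_baseAct_eq_of_isGroupLikeElem (hgl n) y
  have hext : ∀ y z : L →ₐ[K] E, y.toLinearMap = z.toLinearMap → y = z := fun y z h =>
    AlgHom.toLinearMap_injective h
  have hf1 : ∀ y, f 1 y = y := fun y => hext _ _ (by rw [← hf, hone, baseAct_one])
  have hfm : ∀ n m y, f (n * m) y = f m (f n y) := fun n m y => hext _ _ (by
    rw [← hf, ← hf, hmul, S.baseAct_mul (hf n y)])
  let ρ : N →* Equiv.Perm (L →ₐ[K] E) := MonoidHom.toHomPerm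
    -- Products in `E ⊗ H` act on the index embedding in reverse order; the inverse turns this into
    -- a left action.
    { toFun := fun n y => f n⁻¹ y
      map_one' := by funext y; exact (congrArg (f · y) inv_one).trans (hf1 y)
      map_mul' := fun n m => by
        funext y
        rw [mul_inv_rev, hfm]
        rfl }
  have hρ : ∀ n y, ρ n y = f n⁻¹ y := fun n y => rfl
  have hρ' : ∀ n y, (ρ n)⁻¹ y = f n y := fun n y => by
    rw [← map_inv, hρ, inv_inv]
  have hlin : S.baseAct E ∘ₗ (φ.symm : MonoidAlgebra E N →ₐ[E] E ⊗[K] S.H).toLinearMap =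
      permLin ρ := by
    ext n y l
    have h := LinearMap.congr_fun (hf n y) l
    simpa [hρ'] using h
  have hlin' : ∀ x, S.baseAct E (φ.symm x) = permLin ρ x := fun x => LinearMap.congr_fun hlin x
  have hrange : opSpan S.actRange = LinearMap.range (permLin (E := E) ρ) := by
    rw [← range_baseAct]
    ext F
    constructor
    · rintro ⟨w, rfl⟩
      exact ⟨φ w, by rw [← hlin', BialgEquiv.symm_apply_apply]⟩
    · rintro ⟨x, rfl⟩
      exact ⟨φ.symm x, hlin' x⟩
  have hsurj : ∀ y, Function.Surjective (fun n => ρ n y) := by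
    intro y z
    obtain ⟨w, hw⟩ := S.baseAct_apply_surjective y z.toLinearMap
    have hw' : permLin ρ (φ w) y = z.toLinearMap := by
      rw [← hlin', BialgEquiv.symm_apply_apply]
      exact hw
    -- An embedding outside the orbit of `y` would be a linear combination of the embeddings in the
    -- orbit.
    by_contra hz
    have hz' : z ∉ Set.range (fun n => ρ n y) := hz
    refine linearIndependent_embeddings.notMem_span_image hz' ?_
    rw [← hw']
    generalize φ w = x
    induction x using MonoidAlgebra.induction_linear with
    | zero => simp
    | add a b ha hb => rw [map_add]; exact Submodule.add_mem _ ha hb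
    | single m r =>
      rw [permLin_single]
      refine Submodule.smul_mem _ _ (Submodule.subset_span ⟨(ρ m)⁻¹ y, ⟨m⁻¹, ?_⟩, rfl⟩)
      simp
  refine ⟨ρ, fun x y => ?_, hrange⟩
  have hbij : Function.Bijective (fun n => ρ n x) := by
    refine (Nat.bijective_iff_surjective_and_card _).2 ⟨hsurj x, ?_⟩
    rw [hN, card_embeddings]
  exact hbij.existsUnique y

end HopfGaloisStructure

/-! ### From regular subgroups to Hopf-Galois structures -/

/-- A group of permutations is regular if a unique element takes any point to any other. -/
def IsRegularSubgroup {X : Type*} (N : Subgroup (Equiv.Perm X)) : Prop :=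
  ∀ x y : X, ∃! n : N, n.1 x = y

section Construction

open Module MonoidAlgebra Coalgebra

variable {K L E : Type u} [Field K] [Field L] [Field E] [Algebra K L] [Algebra K E]
variable (N : Subgroup (Equiv.Perm (L →ₐ[K] E)))

/-- The conjugation action of `Gal(E/K)` on a group of permutations of the embeddings. -/
def conjAct (hN : ∀ (γ : E ≃ₐ[K] E), ∀ n ∈ N, galPerm γ * n * (galPerm γ)⁻¹ ∈ N) :
    (E ≃ₐ[K] E) →* MulAut N where
  toFun γ :=
    { toFun := fun n => ⟨galPerm γ * n.1 * (galPerm γ)⁻¹, hN γ n n.2⟩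
      invFun := fun n => ⟨(galPerm γ)⁻¹ * n.1 * galPerm γ, by
        have := hN γ⁻¹ n n.2
        rwa [map_inv, inv_inv] at this⟩
      left_inv := fun n => by ext1; simp [mul_assoc]
      right_inv := fun n => by ext1; simp [mul_assoc]
      map_mul' := fun n m => by ext1; simp [mul_assoc] }
  map_one' := by ext1 n; ext1; simp
  map_mul' γ δ := by ext1 n; ext1; simp [mul_assoc]

variable {N}

/-- By this equivariance the fixed points of `E[N]` give Galois-invariant families, which come from
endomorphisms of `L`. -/
theorem galMap_permLin (hN : ∀ (γ : E ≃ₐ[K] E), ∀ n ∈ N, galPerm γ * n * (galPerm γ)⁻¹ ∈ N)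
    (γ : E ≃ₐ[K] E) (x : MonoidAlgebra E N) :
    galMap γ (permLin N.subtype x) = permLin N.subtype (galAct (conjAct N hN) γ x) := by
  induction x using MonoidAlgebra.induction_linear with
  | zero => simp
  | add a b ha hb => simp only [map_add, ha, hb]
  | single n r =>
    rw [galAct_single, permLin_single, permLin_single, galMap_smul, galMap_permMap]
    rfl

theorem permLin_apply_mul_tensor (x : MonoidAlgebra E N) (y : L →ₐ[K] E) (l m : L) :
    permLin N.subtype x y (l * m) =
      LinearMap.mul' E E (TensorProduct.map
        (LinearMap.applyₗ' E l ∘ₗ LinearMap.proj y ∘ₗ permLin (E := E) N.subtype)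
        (LinearMap.applyₗ' E m ∘ₗ LinearMap.proj y ∘ₗ permLin (E := E) N.subtype)
        (comul (R := E) x)) := by
  induction x using MonoidAlgebra.induction_linear with
  | zero => simp
  | add a b ha hb => simp only [map_add, Pi.add_apply, LinearMap.add_apply, ha, hb]
  | single n r =>
    simp
    ring

theorem permLin_apply_algebraMap (x : MonoidAlgebra E N) (y : L →ₐ[K] E) (k : K) :
    permLin N.subtype x y (algebraMap K L k) = counit (R := E) x * algebraMap K E k := by
  induction x using MonoidAlgebra.induction_linear with
  | zero => simp
  | add a b ha hb => simp only [map_add, Pi.add_apply, LinearMap.add_apply, ha, hb, add_mul]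
  | single n r => simp

theorem transMap_injective [Algebra L E] [IsScalarTower K L E] :
    Function.Injective (transMap K L E) := by
  intro T T' h
  ext l
  exact (algebraMap L E).injective (congrArg (fun F => F (IsScalarTower.toAlgHom K L E) l) h)

variable [Algebra L E] [IsScalarTower K L E] [FiniteDimensional K E] [IsGalois K E]

/-- A regular group of permutations of the embeddings which is normalised by `Gal(E/K)` comes
from a Hopf-Galois structure. -/
theorem exists_structure (hreg : IsRegularSubgroup N)
    (hN : ∀ (γ : E ≃ₐ[K] E), ∀ n ∈ N, galPerm γ * n * (galPerm γ)⁻¹ ∈ N) :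
    ∃ S : HopfGaloisStructure K L, Nonempty ((E ⊗[K] S.H) ≃ₐc[E] MonoidAlgebra E N) ∧
      opSpan S.actRange = LinearMap.range (permLin (E := E) N.subtype) := by
  have : FiniteDimensional K L := FiniteDimensional.left K L E
  have hfin : Finite N := Subtype.finite
  let κ := conjAct N hN
  have hi := isHopfForm_fixedAlg κ
  let _ := hi.hopfAlgebra
  have hcocomm : IsCocomm K (fixedAlg κ) := hi.isCocomm
  have hex : ∀ h : fixedAlg κ, ∃ T, transMap K L E T = permLin N.subtype h.1 := fun h =>
    exists_transMap_eq fun γ => by rw [galMap_permLin hN, h.2 γ]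
  choose a ha using hex
  have ha' : ∀ h y l, y (a h l) = permLin N.subtype h.1 y l := fun h y l =>
    congrArg (fun F : EmbSpace K L E => F y l) (ha h)
  let x0 : L →ₐ[K] E := IsScalarTower.toAlgHom K L E
  let act : fixedAlg κ →ₐ[K] Module.End K L := AlgHom.ofLinearMap
    { toFun := a
      map_add' := fun h h' => transMap_injective (E := E) (by
        rw [map_add, ha, ha, ha]
        exact map_add _ _ _)
      map_smul' := fun k h => transMap_injective (E := E) (by
        rw [map_smul, ha, ha, RingHom.id_apply, ← algebraMap_smul E k (permLin N.subtype h.1),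
          ← map_smul,
          algebraMap_smul]
        rfl) }
    (by
      ext l
      apply x0.injective
      change x0 (a 1 l) = x0 l
      rw [ha']
      change permLin N.subtype 1 x0 l = x0 l
      simp [one_def])
    (by
      intro h h'
      ext l
      apply x0.injective
      change x0 (a (h * h') l) = x0 (a h (a h' l))
      rw [ha', ha']
      change permLin N.subtype (h.1 * h'.1) x0 l = _
      generalize h.1 = x
      induction x using MonoidAlgebra.induction_linear with
      | zero => simp
      | add c d hc hd => simp only [add_mul, map_add, Pi.add_apply, LinearMap.add_apply, hc, hd]
      | single n r =>
        rw [permLin_mul_single, permLin_single, LinearMap.smul_apply, Pi.smul_apply,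
          LinearMap.smul_apply, permMap_apply, ← ha'])
  have hact : ∀ h y l, y (act h l) = permLin N.subtype h.1 y l := ha'
  have hgal : Function.Bijective (LinearMap.mul' K (Module.End K L) ∘ₗ
      TensorProduct.map (LinearMap.mul K L) act.toLinearMap) := by
    -- Composed with the embedding `x0`, the Galois map becomes evaluation of `permLin` at `x0`,
    -- which is injective by regularity.
    have hinj : Function.Injective (LinearMap.mul' K (Module.End K L) ∘ₗ
        TensorProduct.map (LinearMap.mul K L) act.toLinearMap) := by
      rw [injective_iff_map_eq_zero]
      intro t ht
      have h1 : ∀ t : L ⊗[K] fixedAlg κ, ∀ l, x0 ((LinearMap.mul' K (Module.End K L) ∘ₗ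
          TensorProduct.map (LinearMap.mul K L) act.toLinearMap) t l) =
          permLin N.subtype ((fixedAlg κ).val.toLinearMap.liftBaseChange E
            (x0.toLinearMap.rTensor (fixedAlg κ) t)) x0 l := by
        intro t l
        induction t with
        | zero => simp
        | add c d hc hd => simp only [map_add, Pi.add_apply, LinearMap.add_apply, hc, hd]
        | tmul c d =>
          have := hact d x0 l
          simp [this]
      have h2 : (fixedAlg κ).val.toLinearMap.liftBaseChange E
            (x0.toLinearMap.rTensor (fixedAlg κ) t) = 0 := by
        apply permLin_apply_injective (ρ := N.subtype) hreg x0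
        ext l
        rw [← h1, ht]
        simp
      have h3 := hi.form.liftBaseChange_bijective.1 (h2.trans (map_zero _).symm)
      have h4 : Function.Injective (x0.toLinearMap.rTensor (fixedAlg κ)) :=
        Module.Flat.rTensor_preserves_injective_linearMap _ x0.injective
      exact h4 (h3.trans (map_zero _).symm)
    -- Both dimensions are the square of the degree, since a regular group has as many elements as
    -- there are embeddings.
    have hfr : finrank K (L ⊗[K] fixedAlg κ) = finrank K (Module.End K L) := by
      have hc : Nat.card N = finrank K L := by
        rw [← card_embeddings (K := K) (L := L) (E := E)]
        exact Nat.card_congr (Equiv.ofBijective (fun n : N => n.1 x0)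
          ⟨fun n m h => (hreg x0 (n.1 x0)).unique rfl h.symm, fun y => (hreg x0 y).exists⟩)
      rw [finrank_tensorProduct, finrank_fixedAlg, finrank_linearMap, hc]
    have : FiniteDimensional K (fixedAlg κ) := by
      apply Module.finite_of_finrank_pos
      rw [finrank_fixedAlg]
      exact Nat.card_pos
    exact ⟨hinj, (LinearMap.injective_iff_surjective_of_finrank_eq_finrank hfr).1 hinj⟩
  have hmul : ∀ h l m, act h (l * m) = LinearMap.mul' K L (TensorProduct.map
      (LinearMap.applyₗ l ∘ₗ act.toLinearMap) (LinearMap.applyₗ m ∘ₗ act.toLinearMap)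
      (hi.comulMap h)) := by
    intro h l m
    apply (algebraMap L E).injective
    change x0 _ = x0 _
    have h0 := hi.tmap_comulMap h
    rw [hact, permLin_apply_mul_tensor, show h.1 = (fixedAlg κ).val h from rfl, ← h0]
    generalize hi.comulMap h = t
    induction t with
    | zero => simp
    | add c d hc hd => simp only [map_add, hc, hd]
    | tmul c d =>
      have h1 := hact c x0 l
      have h2 := hact d x0 m
      simp [h1, h2]
  have hunit : ∀ h k, act h (algebraMap K L k) = algebraMap K L (hi.counitMap h * k) := by
    intro h k
    apply (algebraMap L E).injective
    have h1 := hact h x0 (algebraMap K L k)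
    have h2 := hi.algebraMap_counitMap h
    rw [permLin_apply_algebraMap] at h1
    rw [← IsScalarTower.algebraMap_apply, map_mul, h2]
    exact h1
  let S : HopfGaloisStructure K L :=
    { H := fixedAlg κ
      act := act
      act_mul := hmul
      act_algebraMap := hunit
      galois := hgal }
  refine ⟨S, hi.exists_bialgEquiv, ?_⟩
  apply le_antisymm
  · rw [opSpan, Submodule.span_le]
    rintro _ ⟨_, ⟨h, rfl⟩, rfl⟩
    exact ⟨h.1, (ha h).symm⟩
  · have hspan := span_fixedAlg κ
    rintro _ ⟨x, rfl⟩
    have hx : x ∈ Submodule.span E (fixedAlg κ : Set (MonoidAlgebra E N)) := by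
      rw [hspan]; trivial
    induction hx using Submodule.span_induction with
    | mem x hx =>
      refine Submodule.subset_span ⟨a ⟨x, hx⟩, ⟨⟨x, hx⟩, rfl⟩, ha ⟨x, hx⟩⟩
    | zero => rw [map_zero]; exact Submodule.zero_mem _
    | add x y _ _ hx hy => rw [map_add]; exact Submodule.add_mem _ hx hy
    | smul e x _ hx => rw [map_smul]; exact Submodule.smul_mem _ _ hx

end Construction

/-! ### Counting Hopf-Galois structures by regular subgroups -/

/-- The regular groups of permutations which are isomorphic to `N₀` and normalised by `P`. -/
def regularSet {X : Type*} (P : Subgroup (Equiv.Perm X)) (N₀ : Type*) [Group N₀] :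
    Set (Subgroup (Equiv.Perm X)) :=
  {N | IsRegularSubgroup N ∧ Nonempty (N ≃* N₀) ∧ ∀ g ∈ P, ∀ n ∈ N, g * n * g⁻¹ ∈ N}

theorem MonoidAlgebra.exists_bialgEquiv_of_mulEquiv (R : Type*) [CommRing R] {M M' : Type*}
    [Group M] [Group M'] (e : M ≃* M') :
    Nonempty (MonoidAlgebra R M ≃ₐc[R] MonoidAlgebra R M') := by
  refine ⟨BialgEquiv.ofBialgHom (MonoidAlgebra.mapDomainBialgHom R e.toMonoidHom)
    (MonoidAlgebra.mapDomainBialgHom R e.symm.toMonoidHom) ?_ ?_⟩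
  · rw [← MonoidAlgebra.mapDomainBialgHom_comp]
    simp
  · rw [← MonoidAlgebra.mapDomainBialgHom_comp]
    simp

section Counting

open Module

variable (K L : Type u) [Field K] [Field L] [Algebra K L] [FiniteDimensional K L]
  [Algebra.IsSeparable K L]

instance isGalois_normalClosure : IsGalois K (NormalClosure K L) := by
  have : Normal K (AlgebraicClosure L) := by
    have : Algebra.IsAlgebraic K (AlgebraicClosure L) := Algebra.IsAlgebraic.trans K L _
    have : IsAlgClosure K (AlgebraicClosure L) := ⟨inferInstance, inferInstance⟩
    exact IsAlgClosure.normal K (AlgebraicClosure L)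
  have h : Algebra.IsSeparable K (NormalClosure K L) := by
    rw [← le_separableClosure_iff]
    refine iSup_le fun f => ?_
    rw [le_separableClosure_iff]
    exact Algebra.IsSeparable.of_algHom K L
      (AlgEquiv.ofInjectiveField f).symm.toAlgHom
  exact ⟨⟩

variable {K L}

theorem mem_regularSet_of_hasType {N₀ : Type*} [Group N₀] [Finite N₀]
    (hN₀ : Nat.card N₀ = finrank K L) {S : HopfGaloisStructure K L} (hS : S.HasType N₀) :
    ∃ N ∈ regularSet (galPerm (K := K) (L := L) (E := NormalClosure K L)).range N₀,
      (N : Set (Equiv.Perm (L →ₐ[K] NormalClosure K L))) =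
        {π | permMap π ∈ opSpan S.actRange} ∧
      opSpan S.actRange = Submodule.span (NormalClosure K L)
        (permMap '' {π | permMap π ∈ opSpan (E := NormalClosure K L) S.actRange}) := by
  obtain ⟨φ⟩ := hS
  obtain ⟨ρ, hρ, hspan⟩ := S.exists_regular_action hN₀ φ
  have := nonempty_embedding (K := K) (L := L) (E := NormalClosure K L)
  have hset := range_eq_of_range_permLin_eq (E := NormalClosure K L) hρ
  rw [← hspan] at hset
  have hinj : Function.Injective ρ := by
    obtain ⟨y⟩ := this
    intro n m h
    exact (hρ y (ρ n y)).unique rfl (by rw [h])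
  refine ⟨ρ.range, ⟨?_, ⟨(MonoidHom.ofInjective hinj).symm⟩, ?_⟩, hset, ?_⟩
  · intro x y
    obtain ⟨n, hn, hu⟩ := hρ x y
    refine ⟨⟨ρ n, n, rfl⟩, hn, ?_⟩
    rintro ⟨_, m, rfl⟩ hm
    exact Subtype.ext (congrArg ρ (hu m hm))
  · rintro _ ⟨γ, rfl⟩ n hn
    rw [← SetLike.mem_coe, hset] at hn ⊢
    rw [Set.mem_ofPred_eq, ← galMap_permMap]
    exact galMap_mem_opSpan γ hn
  · rw [← hset, ← range_permLin, hspan]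

theorem exists_hasType_of_mem_regularSet {N₀ : Type*} [Group N₀]
    {N : Subgroup (Equiv.Perm (L →ₐ[K] NormalClosure K L))}
    (hN : N ∈ regularSet (galPerm (K := K) (L := L) (E := NormalClosure K L)).range N₀) :
    ∃ S : HopfGaloisStructure K L, S.HasType N₀ ∧
      (N : Set (Equiv.Perm (L →ₐ[K] NormalClosure K L))) =
        {π | permMap π ∈ opSpan S.actRange} := by
  obtain ⟨hreg, ⟨e⟩, hnorm⟩ := hN
  obtain ⟨S, ⟨φ⟩, hspan⟩ := exists_structure hreg (fun γ => hnorm _ ⟨γ, rfl⟩)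
  obtain ⟨ψ⟩ := MonoidAlgebra.exists_bialgEquiv_of_mulEquiv (NormalClosure K L) e
  refine ⟨S, ⟨φ.trans ψ⟩, ?_⟩
  have := nonempty_embedding (K := K) (L := L) (E := NormalClosure K L)
  rw [hspan, ← range_eq_of_range_permLin_eq (E := NormalClosure K L) (ρ := N.subtype) hreg]
  simp

/-- The theorem of Greither and Pareigis. -/
theorem numStructures_eq_ncard_regularSet {N₀ : Type*} [Group N₀] [Finite N₀]
    (hN₀ : Nat.card N₀ = finrank K L) :
    numStructures K L N₀ =
      (regularSet (galPerm (K := K) (L := L) (E := NormalClosure K L)).range N₀).ncard := by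
  let f : Quotient (HopfGaloisStructure.setoid K L) →
      Set (Equiv.Perm (L →ₐ[K] NormalClosure K L)) :=
    Quotient.lift (fun S => {π | permMap π ∈ opSpan S.actRange}) (fun S T h => by
      rw [HopfGaloisStructure.actRange_eq_of_equivalent h])
  rw [numStructures, ← Set.InjOn.ncard_image (f := f),
    ← Set.ncard_image_of_injective _ (SetLike.coe_injective
      (A := Subgroup (Equiv.Perm (L →ₐ[K] NormalClosure K L))))]
  · congr 1
    ext s
    constructor
    · rintro ⟨_, ⟨S, rfl, hS⟩, rfl⟩
      obtain ⟨N, hN, h, -⟩ := mem_regularSet_of_hasType hN₀ hS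
      exact ⟨N, hN, h⟩
    · rintro ⟨N, hN, rfl⟩
      obtain ⟨S, hS, h⟩ := exists_hasType_of_mem_regularSet hN
      exact ⟨⟦S⟧, ⟨S, rfl, hS⟩, h.symm⟩
  -- The permutations in the operator span generate it, so equal groups give equal spans, hence
  -- equal images in `End_K(L)`.
  · rintro _ ⟨S, rfl, hS⟩ _ ⟨T, rfl, hT⟩ h
    obtain ⟨-, -, -, h1⟩ := mem_regularSet_of_hasType hN₀ hS
    obtain ⟨-, -, -, h2⟩ := mem_regularSet_of_hasType hN₀ hT
    have h' : {π | permMap π ∈ opSpan (E := NormalClosure K L) S.actRange} =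
      {π | permMap π ∈ opSpan (E := NormalClosure K L) T.actRange} := h
    rw [h', ← h2] at h1
    exact Quotient.sound (HopfGaloisStructure.equivalent_of_actRange_eq (opSpan_injective h1))

theorem exists_hasType_iff {N₀ : Type*} [Group N₀] [Finite N₀]
    (hN₀ : Nat.card N₀ = finrank K L) :
    (∃ S : HopfGaloisStructure K L, S.HasType N₀) ↔
      (regularSet (galPerm (K := K) (L := L) (E := NormalClosure K L)).range N₀).Nonempty := by
  constructor
  · rintro ⟨S, hS⟩
    obtain ⟨N, hN, -⟩ := mem_regularSet_of_hasType hN₀ hS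
    exact ⟨N, hN⟩
  · rintro ⟨N, hN⟩
    obtain ⟨S, hS, -⟩ := exists_hasType_of_mem_regularSet hN
    exact ⟨S, hS⟩

end Counting

/-! ### Transport of regular subgroups along a bijection -/

section Transfer

variable {X X' : Type*} (e : X ≃ X')

theorem isRegularSubgroup_map {N : Subgroup (Equiv.Perm X)} (hN : IsRegularSubgroup N) :
    IsRegularSubgroup (N.map e.permCongrHom.toMonoidHom) := by
  intro x y
  obtain ⟨n, hn, hu⟩ := hN (e.symm x) (e.symm y)
  refine ⟨⟨e.permCongrHom n.1, n.1, n.2, rfl⟩, ?_, ?_⟩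
  · change e (n.1 (e.symm x)) = y
    rw [hn, e.apply_symm_apply]
  · rintro ⟨_, m, hm, rfl⟩ h
    have h' : e (m (e.symm x)) = y := h
    have := hu ⟨m, hm⟩ (by simp [← h'])
    exact Subtype.ext (congrArg e.permCongrHom (congrArg Subtype.val this))

theorem map_mem_regularSet {P : Subgroup (Equiv.Perm X)} {N₀ : Type*} [Group N₀]
    {N : Subgroup (Equiv.Perm X)} (hN : N ∈ regularSet P N₀) :
    N.map e.permCongrHom.toMonoidHom ∈
      regularSet (P.map e.permCongrHom.toMonoidHom) N₀ := by
  obtain ⟨h1, ⟨h2⟩, h3⟩ := hN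
  refine ⟨isRegularSubgroup_map e h1, ⟨(N.equivMapOfInjective _
    e.permCongrHom.injective).symm.trans h2⟩, ?_⟩
  rintro _ ⟨g, hg, rfl⟩ _ ⟨n, hn, rfl⟩
  exact ⟨g * n * g⁻¹, h3 g hg n hn, by rw [map_mul, map_mul, map_inv]⟩

theorem map_permCongrHom_symm (N : Subgroup (Equiv.Perm X)) :
    (N.map e.permCongrHom.toMonoidHom).map e.symm.permCongrHom.toMonoidHom = N := by
  rw [Subgroup.map_map]
  convert Subgroup.map_id N
  ext π x
  simp

theorem ncard_regularSet_map (P : Subgroup (Equiv.Perm X)) (N₀ : Type*) [Group N₀] :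
    (regularSet (P.map e.permCongrHom.toMonoidHom) N₀).ncard = (regularSet P N₀).ncard := by
  rw [← Set.ncard_image_of_injective (regularSet P N₀)
    (Subgroup.map_injective (f := e.permCongrHom.toMonoidHom) e.permCongrHom.injective)]
  congr 1
  ext N
  constructor
  · intro hN
    refine ⟨N.map e.symm.permCongrHom.toMonoidHom, ?_, map_permCongrHom_symm e.symm N⟩
    have := map_mem_regularSet e.symm hN
    rwa [map_permCongrHom_symm] at this
  · rintro ⟨N, hN, rfl⟩
    exact map_mem_regularSet e hN

end Transfer

/-! ### Extensions realising a given permutation group -/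

section Realising

variable {K L : Type u} [Field K] [Field L] [Algebra K L] [FiniteDimensional K L]
  [Algebra.IsSeparable K L]

omit [FiniteDimensional K L] [Algebra.IsSeparable K L] in
theorem mem_stabGal_iff {γ : NormalClosure K L ≃ₐ[K] NormalClosure K L} :
    γ ∈ stabGal K L ↔
      galPerm γ (IsScalarTower.toAlgHom K L (NormalClosure K L)) =
        IsScalarTower.toAlgHom K L (NormalClosure K L) := by
  rw [AlgHom.ext_iff]
  rfl

/-- If `L/K` realises a transitive permutation group, its points correspond to the embeddings. -/
theorem exists_equiv_embeddings {n : ℕ} {G : TransPermGroup n}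
    (h : Realises K L G.1 (Fin n)) :
    ∃ e : Fin n ≃ (L →ₐ[K] NormalClosure K L),
      G.1.map e.permCongrHom.toMonoidHom =
        (galPerm (K := K) (L := L) (E := NormalClosure K L)).range := by
  obtain ⟨θ, x, hθ⟩ := h
  have htrans := G.2
  let x0 := IsScalarTower.toAlgHom K L (NormalClosure K L)
  -- The points and the embeddings are both coset spaces, for stabilisers that correspond under `θ`.
  have key : ∀ g h : G.1, galPerm (θ g) x0 = galPerm (θ h) x0 ↔ g • x = h • x := by
    intro g h
    have h1 : galPerm (θ g) x0 = galPerm (θ h) x0 ↔ θ (h⁻¹ * g) ∈ stabGal K L := by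
      rw [mem_stabGal_iff, map_mul, map_inv, map_mul, map_inv, Equiv.Perm.mul_apply,
        Equiv.Perm.inv_eq_iff_eq]
    rw [h1, ← hθ, ← inv_smul_eq_iff (g := h), smul_smul]
    constructor
    · rintro ⟨k, hk, hk'⟩
      rw [← θ.injective hk']
      exact hk
    · intro hk
      exact ⟨_, hk, rfl⟩
  choose c hc using fun z => MulAction.exists_smul_eq G.1 x z
  let f : Fin n → (L →ₐ[K] NormalClosure K L) := fun z => galPerm (θ (c z)) x0
  have hf : ∀ g : G.1, f (g • x) = galPerm (θ g) x0 := fun g => (key _ _).2 (hc _)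
  have hbij : Function.Bijective f := by
    constructor
    · intro z w h
      have := (key _ _).1 h
      rwa [hc, hc] at this
    · intro y
      obtain ⟨γ, rfl⟩ := exists_galPerm_eq y
      refine ⟨θ.symm γ • x, ?_⟩
      rw [hf, MulEquiv.apply_symm_apply]
  have hequiv : ∀ (g : G.1) z, f (g.1 z) = galPerm (θ g) (f z) := by
    intro g z
    obtain ⟨h, rfl⟩ := MulAction.exists_smul_eq G.1 x z
    change f (g • h • x) = _
    rw [smul_smul, hf, hf, map_mul, map_mul]
    rfl
  refine ⟨Equiv.ofBijective f hbij, ?_⟩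
  have hperm : ∀ g : G.1, (Equiv.ofBijective f hbij).permCongrHom g.1 = galPerm (θ g) := by
    intro g
    ext1 y
    obtain ⟨z, rfl⟩ := hbij.2 y
    change f (g.1 ((Equiv.ofBijective f hbij).symm (Equiv.ofBijective f hbij z))) = _
    rw [Equiv.symm_apply_apply, hequiv]
  ext π
  constructor
  · rintro ⟨g, hg, rfl⟩
    exact ⟨θ ⟨g, hg⟩, (hperm ⟨g, hg⟩).symm⟩
  · rintro ⟨γ, rfl⟩
    refine ⟨(θ.symm γ).1, (θ.symm γ).2, ?_⟩
    refine (hperm (θ.symm γ)).trans ?_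
    rw [MulEquiv.apply_symm_apply]

theorem finrank_eq_of_realises {n : ℕ} {G : TransPermGroup n}
    (h : Realises K L G.1 (Fin n)) : Module.finrank K L = n := by
  obtain ⟨e, -⟩ := exists_equiv_embeddings h
  rw [← card_embeddings (K := K) (L := L) (E := NormalClosure K L), ← Nat.card_congr e,
    Nat.card_eq_fintype_card, Fintype.card_fin]

theorem card_cyc (n : ℕ) : Nat.card (Cyc n) = n := by
  rw [Nat.card_congr Multiplicative.toAdd, Nat.card_zmod]

/-- The number of Hopf-Galois structures of cyclic type on an extension realising `G`. -/
theorem numStructures_of_realises {n : ℕ} [NeZero n] {G : TransPermGroup n}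
    (h : Realises K L G.1 (Fin n)) :
    numStructures K L (Cyc n) = (regularSet G.1 (Cyc n)).ncard := by
  obtain ⟨e, he⟩ := exists_equiv_embeddings h
  rw [numStructures_eq_ncard_regularSet (by rw [card_cyc, finrank_eq_of_realises h]), ← he,
    ncard_regularSet_map]

theorem exists_hasType_iff_of_realises {n : ℕ} [NeZero n] {G : TransPermGroup n}
    (h : Realises K L G.1 (Fin n)) :
    (∃ S : HopfGaloisStructure K L, S.HasType (Cyc n)) ↔
      (regularSet G.1 (Cyc n)).Nonempty := by
  obtain ⟨e, he⟩ := exists_equiv_embeddings h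
  rw [exists_hasType_iff (by rw [card_cyc, finrank_eq_of_realises h]), ← he]
  constructor
  · rintro ⟨N, hN⟩
    have := map_mem_regularSet e.symm hN
    rw [map_permCongrHom_symm] at this
    exact ⟨_, this⟩
  · rintro ⟨N, hN⟩
    exact ⟨_, map_mem_regularSet e hN⟩

end Realising

/-! ### Realising transitive permutation groups -/

section Realisation

/-- The action of the permutations of `σ` on the field of rational functions in variables
indexed by `σ`. -/
def permRatFunc (σ : Type u) : Equiv.Perm σ →*
    RingAut (FractionRing (MvPolynomial σ (ULift.{u} ℚ))) :=
  (IsFractionRing.ringEquivOfRingEquivHom (MvPolynomial σ (ULift.{u} ℚ))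
    (FractionRing (MvPolynomial σ (ULift.{u} ℚ)))).comp
  { toFun := fun π => (MvPolynomial.renameEquiv (ULift.{u} ℚ) π).toRingEquiv
    map_one' := by ext1 x; simp
    map_mul' := fun π τ => by
      ext1 x
      change MvPolynomial.rename _ _ = MvPolynomial.rename _ (MvPolynomial.rename _ _)
      rw [MvPolynomial.rename_rename]
      rfl }

theorem permRatFunc_injective (σ : Type u) : Function.Injective (permRatFunc σ) := by
  intro π τ h
  ext1 i
  have h1 : ∀ π : Equiv.Perm σ, permRatFunc σ π (algebraMap (MvPolynomial σ (ULift.{u} ℚ)) _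
      (MvPolynomial.X i)) = algebraMap (MvPolynomial σ (ULift.{u} ℚ)) _
        (MvPolynomial.X (π i)) := by
    intro π
    simp [permRatFunc]
  have h2 := h1 π
  rw [h, h1 τ] at h2
  exact (MvPolynomial.X_injective (IsFractionRing.injective _ _ h2)).symm

/-- An extension `L/K` inside a Galois extension `E/K` such that no non-trivial automorphism of
`E/K` fixes all conjugates of `L` has `E` as its normal closure. -/
theorem exists_algEquiv_normalClosure {K L E : Type u} [Field K] [Field L] [Field E]
    [Algebra K L] [Algebra K E] [Algebra L E] [IsScalarTower K L E] [FiniteDimensional K E]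
    [IsGalois K E] (hcore : ∀ γ : E ≃ₐ[K] E, galPerm (L := L) γ = 1 → γ = 1) :
    ∃ ψ : E ≃ₐ[K] NormalClosure K L,
      ∀ l : L, ψ (algebraMap L E l) = algebraMap L (NormalClosure K L) l := by
  have : FiniteDimensional K L := FiniteDimensional.left K L E
  have : Algebra.IsSeparable K L := Algebra.isSeparable_tower_bot_of_isSeparable K L E
  have h1 : IsNormalClosure K L E := by
    rw [Algebra.IsAlgebraic.isNormalClosure_iff]
    refine ⟨fun x => ?_, ?_⟩
    · rw [← minpoly.algebraMap_eq (algebraMap L E).injective x]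
      exact Normal.splits inferInstance _
    · rw [← IsGalois.fixedField_fixingSubgroup (IntermediateField.normalClosure K L E),
        ← IsGalois.fixedField_fixingSubgroup (⊤ : IntermediateField K E)]
      congr 1
      rw [IntermediateField.fixingSubgroup_top, eq_bot_iff]
      intro γ hγ
      rw [IntermediateField.mem_fixingSubgroup_iff] at hγ
      rw [Subgroup.mem_bot]
      apply hcore
      ext y l
      exact hγ (y l) (y.fieldRange_le_normalClosure ⟨l, rfl⟩)
  have h2 : IsNormalClosure K L (NormalClosure K L) :=
    Algebra.IsAlgebraic.isNormalClosure_normalClosure fun x => IsAlgClosed.splits _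
  let ψ : E ≃ₐ[K] NormalClosure K L := IsNormalClosure.equiv (K := L) (h := h1) (h' := h2)
  -- The isomorphism `ψ` need not respect the given embeddings of `L`; an automorphism of the target
  -- corrects it.
  obtain ⟨δ, hδ⟩ := exists_galPerm_eq' ((ψ : E →ₐ[K] NormalClosure K L).comp
    (IsScalarTower.toAlgHom K L E)) (IsScalarTower.toAlgHom K L (NormalClosure K L))
  exact ⟨ψ.trans δ, fun l => DFunLike.congr_fun hδ l⟩

/-- An automorphism fixing all conjugates of the fixed field lies in every conjugate of the point
stabiliser, so it fixes every point and is trivial. Hence `E` is the normal closure. -/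
theorem realises_fixedField {K E : Type u} [Field K] [Field E] [Algebra K E]
    [FiniteDimensional K E] [IsGalois K E] {n : ℕ} {G : TransPermGroup n}
    (θ : G.1 ≃* (E ≃ₐ[K] E)) (x : Fin n) :
    Realises K (IntermediateField.fixedField ((MulAction.stabilizer G.1 x).map θ.toMonoidHom))
      G.1 (Fin n) := by
  have htrans := G.2
  generalize hH : (MulAction.stabilizer G.1 x).map θ.toMonoidHom = H
  have hHmem : ∀ g, θ g ∈ H ↔ g • x = x := by
    intro g
    rw [← hH]
    constructor
    · rintro ⟨k, hk, hk'⟩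
      rw [← θ.injective hk']
      exact hk
    · exact fun h => ⟨g, h, rfl⟩
  have hmem : ∀ γ : E ≃ₐ[K] E, γ ∈ H ↔ ∀ l : IntermediateField.fixedField H,
      γ (algebraMap _ E l) = algebraMap _ E l := by
    intro γ
    rw [← IntermediateField.fixingSubgroup_fixedField H,
      IntermediateField.mem_fixingSubgroup_iff, IntermediateField.fixingSubgroup_fixedField H]
    exact ⟨fun h l => h l.1 l.2, fun h y hy => h ⟨y, hy⟩⟩
  generalize IntermediateField.fixedField H = L at hmem
  have hcore : ∀ γ : E ≃ₐ[K] E, galPerm (L := L) γ = 1 → γ = 1 := by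
    intro γ hγ
    obtain ⟨g, rfl⟩ := θ.surjective γ
    have hg : g = 1 := by
      ext1
      ext1 z
      obtain ⟨h, rfl⟩ := MulAction.exists_smul_eq G.1 x z
      have h1 : θ (h⁻¹ * g * h) ∈ H := by
        rw [hmem]
        intro l
        have h2 := DFunLike.congr_fun (Equiv.congr_fun hγ
          (galPerm (θ h) (IsScalarTower.toAlgHom K L E))) l
        have h3 : θ g (θ h (algebraMap L E l)) = θ h (algebraMap L E l) := h2
        rw [map_mul, map_mul, AlgEquiv.mul_apply, AlgEquiv.mul_apply, h3, ← AlgEquiv.mul_apply,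
          ← map_mul, inv_mul_cancel, map_one, AlgEquiv.one_apply]
      rw [hHmem, mul_smul, mul_smul, inv_smul_eq_iff] at h1
      exact h1
    rw [hg, map_one]
  obtain ⟨ψ, hψ⟩ := exists_algEquiv_normalClosure (K := K) (L := L) (E := E) hcore
  have hiff : ∀ γ : E ≃ₐ[K] E, ψ.autCongr γ ∈ stabGal K L ↔ γ ∈ H := by
    intro γ
    rw [hmem]
    refine forall_congr' fun l => ?_
    have h1 : ψ.autCongr γ (algebraMap L (NormalClosure K L) l) = ψ (γ (algebraMap L E l)) := by
      rw [← hψ, AlgEquiv.autCongr_apply]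
      simp
    rw [h1, ← hψ, ψ.injective.eq_iff]
  refine ⟨θ.trans ψ.autCongr, x, ?_⟩
  ext δ
  constructor
  · rintro ⟨g, hg, rfl⟩
    exact (hiff (θ g)).2 ((hHmem g).2 hg)
  · intro hδ
    obtain ⟨γ, rfl⟩ := ψ.autCongr.surjective δ
    obtain ⟨g, rfl⟩ := θ.surjective γ
    exact ⟨g, (hHmem g).1 ((hiff _).1 hδ), rfl⟩

/-- `G` acts faithfully on rational functions by permuting variables, so by Artin's theorem it is
the Galois group over the fixed field; `L` is the fixed field of a point stabiliser. -/
theorem exists_realises {n : ℕ} [NeZero n] (G : TransPermGroup n) :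
    ∃ (K L : Type u) (_ : Field K) (_ : Field L) (_ : Algebra K L),
      FiniteDimensional K L ∧ Algebra.IsSeparable K L ∧ Realises K L G.1 (Fin n) := by
  let E := FractionRing (MvPolynomial (ULift.{u} (Fin n)) (ULift.{u} ℚ))
  let φ : G.1 →* RingAut E := (permRatFunc (ULift.{u} (Fin n))).comp
    ((Equiv.ulift.symm.permCongrHom : Equiv.Perm (Fin n) ≃* _).toMonoidHom.comp G.1.subtype)
  have hφ : Function.Injective φ := by
    intro g h hgh
    have h1 := permRatFunc_injective _ hgh
    exact Subtype.ext ((Equiv.ulift.symm.permCongrHom : Equiv.Perm (Fin n) ≃* _).injective h1)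
  let _ : MulSemiringAction G.1 E := MulSemiringAction.compHom E φ
  have : FaithfulSMul G.1 E := ⟨fun {g h} H => hφ (RingEquiv.ext H)⟩
  have hGal : IsGalois (FixedPoints.subfield G.1 E) E := ⟨⟩
  let θ := FixedPoints.toAlgAutMulEquiv G.1 E
  exact ⟨FixedPoints.subfield G.1 E, IntermediateField.fixedField
    ((MulAction.stabilizer G.1 (0 : Fin n)).map θ.toMonoidHom), inferInstance, inferInstance,
    inferInstance, inferInstance, inferInstance, realises_fixedField θ 0⟩

variable {n : ℕ} [NeZero n] {G : TransPermGroup n}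

theorem realisedByType_iff :
    TransPermGroup.RealisedByType.{u} G (Cyc n) ↔ (regularSet G.1 (Cyc n)).Nonempty := by
  constructor
  · rintro ⟨K, L, _, _, _, _, _, hR, hS⟩
    exact (exists_hasType_iff_of_realises hR).1 hS
  · intro h
    obtain ⟨K, L, _, _, _, h1, h2, hR⟩ := exists_realises.{u} G
    exact ⟨K, L, _, _, _, h1, h2, hR, (exists_hasType_iff_of_realises hR).2 h⟩

variable {K L : Type u} [Field K] [Field L] [Algebra K L]

omit [NeZero n] in
/-- A regular normal subgroup of `G` yields a normal complement of `Gal(E/L)`. -/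
theorem almostClassicallyGalois_of_realises (h : Realises K L G.1 (Fin n))
    {C : Subgroup (Equiv.Perm (Fin n))} (hC : IsRegularSubgroup C) (hle : C ≤ G.1)
    (hnorm : ∀ g ∈ G.1, ∀ c ∈ C, g * c * g⁻¹ ∈ C) : AlmostClassicallyGalois K L := by
  obtain ⟨θ, x, hθ⟩ := h
  have hN : (C.subgroupOf G.1).Normal := ⟨fun c hc g => hnorm g.1 g.2 c.1 hc⟩
  refine ⟨(C.subgroupOf G.1).map θ.toMonoidHom, hN.map _ θ.surjective, ?_⟩
  rw [← hθ]
  have hcomp : Subgroup.IsComplement' (C.subgroupOf G.1) (MulAction.stabilizer G.1 x) := by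
    refine Subgroup.isComplement'_of_disjoint_and_mul_eq_univ ?_ ?_
    · rw [Subgroup.disjoint_def]
      intro g hg hg'
      have h1 : (⟨g.1, hg⟩ : C) = 1 := (hC x x).unique hg' rfl
      have h2 : g.1 = 1 := congrArg (fun c : C => c.1) h1
      exact Subtype.ext h2
    · rw [Set.eq_univ_iff_forall]
      intro g
      obtain ⟨c, hc, -⟩ := hC x (g.1 x)
      refine ⟨⟨c.1, hle c.2⟩, c.2, ⟨c.1, hle c.2⟩⁻¹ * g, ?_, by simp⟩
      change (⟨c.1, hle c.2⟩⁻¹ * g : G.1) • x = x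
      rw [mul_smul, inv_smul_eq_iff]
      exact hc.symm
  refine Subgroup.isComplement'_of_disjoint_and_mul_eq_univ ?_ ?_
  · rw [Subgroup.disjoint_def]
    rintro _ ⟨g, hg, rfl⟩ ⟨g', hg', h'⟩
    have : g' = g := θ.injective h'
    subst this
    have := (Subgroup.disjoint_def.1 hcomp.disjoint) hg hg'
    rw [this]
    exact map_one _
  · rw [Set.eq_univ_iff_forall]
    intro γ
    obtain ⟨g, rfl⟩ := θ.surjective γ
    obtain ⟨a, ha, b, hb, rfl⟩ := (Set.eq_univ_iff_forall.1 hcomp.mul_eq) g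
    exact ⟨θ a, ⟨a, ha, rfl⟩, θ b, ⟨b, hb, rfl⟩, (map_mul θ a b).symm⟩

omit [NeZero n] in
-- Point stabilisers in a regular group are trivial, so `Gal(E/L)` is trivial and `L` is its own
-- normal closure.
theorem isGalois_of_realises [FiniteDimensional K L] [Algebra.IsSeparable K L]
    (h : Realises K L G.1 (Fin n)) (hG : G.IsRegular) : IsGalois K L := by
  obtain ⟨θ, x, hθ⟩ := h
  have hstab : stabGal K L = ⊥ := by
    rw [← hθ, eq_bot_iff]
    rintro _ ⟨g, hg, rfl⟩
    have : g = 1 := (hG x x).unique hg (one_smul _ _)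
    rw [this]
    exact map_one _
  have : IsGalois L (NormalClosure K L) := IsGalois.tower_top_of_isGalois K L _
  have : FiniteDimensional L (NormalClosure K L) := FiniteDimensional.right K L _
  have hsurj : Function.Surjective (algebraMap L (NormalClosure K L)) := by
    intro e
    have : e ∈ Set.range (algebraMap L (NormalClosure K L)) := by
      rw [IsGalois.mem_range_algebraMap_iff_fixed]
      intro γ
      have h1 : γ.restrictScalars K ∈ stabGal K L := fun l => γ.commutes l
      rw [hstab, Subgroup.mem_bot] at h1
      exact DFunLike.congr_fun h1 e
    exact this
  exact IsGalois.of_algEquiv (AlgEquiv.ofBijective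
    (IsScalarTower.toAlgHom K L (NormalClosure K L))
    ⟨(algebraMap L (NormalClosure K L)).injective, hsurj⟩).symm

end Realisation

/-! ### Affine permutations of `ZMod p × ZMod q` -/

section Affine

variable {p q : ℕ}

/-- The permutation `(x, y) ↦ (a x + b, c y + d)`. -/
def aff (a : (ZMod p)ˣ) (b : ZMod p) (c : (ZMod q)ˣ) (d : ZMod q) :
    Equiv.Perm (ZMod p × ZMod q) where
  toFun v := (a * v.1 + b, c * v.2 + d)
  invFun v := (a⁻¹.1 * (v.1 - b), c⁻¹.1 * (v.2 - d))
  left_inv v := by simp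
  right_inv v := by simp

@[simp]
theorem aff_apply (a : (ZMod p)ˣ) (b : ZMod p) (c : (ZMod q)ˣ) (d : ZMod q)
    (v : ZMod p × ZMod q) : aff a b c d v = (a * v.1 + b, c * v.2 + d) := rfl

theorem aff_mul (a a' : (ZMod p)ˣ) (b b' : ZMod p) (c c' : (ZMod q)ˣ) (d d' : ZMod q) :
    aff a b c d * aff a' b' c' d' = aff (a * a') (a * b' + b) (c * c') (c * d' + d) := by
  ext v
  · simp; ring
  · simp; ring

@[simp]
theorem aff_one : aff (1 : (ZMod p)ˣ) 0 (1 : (ZMod q)ˣ) 0 = 1 := by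
  ext v <;> simp

theorem aff_inv (a : (ZMod p)ˣ) (b : ZMod p) (c : (ZMod q)ˣ) (d : ZMod q) :
    (aff a b c d)⁻¹ = aff a⁻¹ (-(a⁻¹.1 * b)) c⁻¹ (-(c⁻¹.1 * d)) := by
  rw [inv_eq_iff_mul_eq_one, aff_mul]
  simp

theorem aff_inj {a a' : (ZMod p)ˣ} {b b' : ZMod p} {c c' : (ZMod q)ˣ} {d d' : ZMod q} :
    aff a b c d = aff a' b' c' d' ↔ a = a' ∧ b = b' ∧ c = c' ∧ d = d' := by
  constructor
  · intro h
    have h0 := Equiv.congr_fun h (0, 0)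
    have h1 := Equiv.congr_fun h (1, 1)
    simp only [aff_apply, mul_zero, zero_add, mul_one, Prod.mk.injEq] at h0 h1
    obtain ⟨rfl, rfl⟩ := h0
    simp only [add_left_inj] at h1
    exact ⟨Units.ext h1.1, rfl, Units.ext h1.2, rfl⟩
  · rintro ⟨rfl, rfl, rfl, rfl⟩
    rfl

theorem aff_pow_exists (a : (ZMod p)ˣ) (b : ZMod p) (c : (ZMod q)ˣ) (d : ZMod q) (k : ℕ) :
    ∃ b' d', aff a b c d ^ k = aff (a ^ k) b' (c ^ k) d' := by
  induction k with
  | zero => exact ⟨0, 0, by simp⟩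
  | succ k ih =>
    obtain ⟨b', d', h⟩ := ih
    exact ⟨_, _, by rw [pow_succ, h, aff_mul, pow_succ, pow_succ]⟩

theorem transl_pow (b : ZMod p) (d : ZMod q) (k : ℕ) :
    aff (1 : (ZMod p)ˣ) b (1 : (ZMod q)ˣ) d ^ k =
      aff 1 ((k : ZMod p) * b) 1 ((k : ZMod q) * d) := by
  induction k with
  | zero => simp
  | succ k ih =>
    rw [pow_succ, ih, aff_mul, aff_inj]
    refine ⟨by simp, ?_, by simp, ?_⟩ <;> push_cast <;> simp <;> ring

theorem scale_pow (a : (ZMod p)ˣ) (d : ZMod q) (k : ℕ) :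
    aff a 0 (1 : (ZMod q)ˣ) d ^ k = aff (a ^ k) 0 1 ((k : ZMod q) * d) := by
  induction k with
  | zero => simp
  | succ k ih =>
    rw [pow_succ, ih, aff_mul, aff_inj]
    refine ⟨by rw [pow_succ], by simp, by simp, ?_⟩
    push_cast
    simp
    ring

variable (p q)

/-- The group of all translations of `ZMod p × ZMod q`. -/
def translGroup : Subgroup (Equiv.Perm (ZMod p × ZMod q)) where
  carrier := {g | ∃ b d, g = aff 1 b 1 d}
  mul_mem' := by
    rintro _ _ ⟨b, d, rfl⟩ ⟨b', d', rfl⟩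
    exact ⟨b' + b, d' + d, by rw [aff_mul]; simp⟩
  one_mem' := ⟨0, 0, by simp⟩
  inv_mem' := by
    rintro _ ⟨b, d, rfl⟩
    exact ⟨-b, -d, by rw [aff_inv]; simp⟩

/-- The group of all affine permutations with linear part in `A`. -/
def holGroup (A : Subgroup ((ZMod p)ˣ × (ZMod q)ˣ)) :
    Subgroup (Equiv.Perm (ZMod p × ZMod q)) where
  carrier := {g | ∃ a b c d, (a, c) ∈ A ∧ g = aff a b c d}
  mul_mem' := by
    rintro _ _ ⟨a, b, c, d, h, rfl⟩ ⟨a', b', c', d', h', rfl⟩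
    exact ⟨_, _, _, _, A.mul_mem h h', by rw [aff_mul]⟩
  one_mem' := ⟨1, 0, 1, 0, A.one_mem, by simp⟩
  inv_mem' := by
    rintro _ ⟨a, b, c, d, h, rfl⟩
    exact ⟨_, _, _, _, A.inv_mem h, by rw [aff_inv]⟩

variable {p q}

theorem aff_mem_holGroup {A : Subgroup ((ZMod p)ˣ × (ZMod q)ˣ)}
    {a : (ZMod p)ˣ} {b : ZMod p} {c : (ZMod q)ˣ} {d : ZMod q} :
    aff a b c d ∈ holGroup p q A ↔ (a, c) ∈ A := by
  constructor
  · rintro ⟨a', b', c', d', h, h'⟩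
    obtain ⟨rfl, -, rfl, -⟩ := aff_inj.1 h'
    exact h
  · exact fun h => ⟨_, _, _, _, h, rfl⟩

theorem translGroup_le_holGroup (A : Subgroup ((ZMod p)ˣ × (ZMod q)ˣ)) :
    translGroup p q ≤ holGroup p q A := by
  rintro _ ⟨b, d, rfl⟩
  exact aff_mem_holGroup.2 A.one_mem

theorem isRegularSubgroup_translGroup : IsRegularSubgroup (translGroup p q) := by
  intro x y
  refine ⟨⟨aff 1 (y.1 - x.1) 1 (y.2 - x.2), _, _, rfl⟩, by simp, ?_⟩
  rintro ⟨_, b, d, rfl⟩ h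
  apply Subtype.ext
  change aff 1 b 1 d = _
  rw [aff_inj]
  simp only [aff_apply, Units.val_one, one_mul] at h
  rw [← h]
  simp

theorem conj_mem_translGroup (a : (ZMod p)ˣ) (b : ZMod p) (c : (ZMod q)ˣ) (d : ZMod q)
    {n : Equiv.Perm (ZMod p × ZMod q)} (hn : n ∈ translGroup p q) :
    aff a b c d * n * (aff a b c d)⁻¹ ∈ translGroup p q := by
  obtain ⟨b', d', rfl⟩ := hn
  rw [aff_inv, aff_mul, aff_mul]
  exact ⟨_, _, by rw [aff_inj]; exact ⟨by simp, rfl, by simp, rfl⟩⟩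

/-- The group of translations is cyclic. -/
theorem nonempty_translGroup_mulEquiv (h : p.Coprime q) :
    Nonempty (translGroup p q ≃* Cyc (p * q)) := by
  let f : Multiplicative (ZMod p × ZMod q) ≃* translGroup p q :=
    { toFun := fun v => ⟨aff 1 v.toAdd.1 1 v.toAdd.2, _, _, rfl⟩
      invFun := fun g => Multiplicative.ofAdd (g.1 (0, 0))
      left_inv := fun v => by simp
      right_inv := by
        rintro ⟨_, b, d, rfl⟩
        ext1
        simp
      map_mul' := fun v w => by
        ext1
        simp [aff_mul, add_comm] }
  exact ⟨f.symm.trans (ZMod.chineseRemainder h).symm.toAddEquiv.toMultiplicative⟩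

/-- Every regular cyclic group of degree `p q` is the group of translations in suitable
coordinates. -/
theorem exists_equiv_map_eq_translGroup (h : p.Coprime q) {X : Type*} [Nonempty X]
    {N : Subgroup (Equiv.Perm X)} (hN : IsRegularSubgroup N) (e : N ≃* Cyc (p * q)) :
    ∃ f : X ≃ ZMod p × ZMod q, N.map f.permCongrHom.toMonoidHom = translGroup p q := by
  obtain ⟨x⟩ := ‹Nonempty X›
  let ν : Multiplicative (ZMod p × ZMod q) ≃* N :=
    (e.trans (ZMod.chineseRemainder h).toAddEquiv.toMultiplicative).symm
  let g : ZMod p × ZMod q → X := fun v => (ν (Multiplicative.ofAdd v)).1 x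
  have hg : Function.Bijective g := by
    constructor
    · intro v w hvw
      have := (hN x (g v)).unique rfl hvw.symm
      exact Multiplicative.ofAdd.injective (ν.injective this)
    · intro y
      obtain ⟨n, hn, -⟩ := hN x y
      refine ⟨(ν.symm n).toAdd, ?_⟩
      simpa [g] using hn
  let f := (Equiv.ofBijective g hg).symm
  have key : ∀ w : ZMod p × ZMod q,
      f.permCongrHom (ν (Multiplicative.ofAdd w)).1 = aff 1 w.1 1 w.2 := by
    intro w
    ext1 v
    change f ((ν (Multiplicative.ofAdd w)).1 (g v)) = _
    have h1 : (ν (Multiplicative.ofAdd w)).1 (g v) = g (w + v) := by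
      simp [g, ofAdd_add]
    rw [h1]
    have h2 : f (g (w + v)) = w + v := (Equiv.ofBijective g hg).symm_apply_apply _
    rw [h2, aff_apply]
    ext <;> simp [add_comm]
  refine ⟨f, ?_⟩
  ext π
  constructor
  · rintro ⟨n, hn, rfl⟩
    obtain ⟨w, hw⟩ := ν.surjective ⟨n, hn⟩
    have := key w.toAdd
    rw [ofAdd_toAdd, hw] at this
    exact ⟨_, _, this⟩
  · rintro ⟨b, d, rfl⟩
    exact ⟨_, (ν (Multiplicative.ofAdd (b, d))).2, key (b, d)⟩

/-- The normaliser of the group of translations consists of the affine permutations. -/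
theorem exists_eq_aff_of_normalises [NeZero p] [NeZero q] (h : p.Coprime q)
    {g : Equiv.Perm (ZMod p × ZMod q)}
    (hg : ∀ n ∈ translGroup p q, g * n * g⁻¹ ∈ translGroup p q) :
    ∃ a b c d, g = aff a b c d := by
  have hw : ∀ w : ZMod p × ZMod q, ∃ w' : ZMod p × ZMod q, ∀ v, g (w + v) = w' + g v := by
    intro w
    obtain ⟨b, d, hbd⟩ := hg (aff 1 w.1 1 w.2) ⟨_, _, rfl⟩
    refine ⟨(b, d), fun v => ?_⟩
    have := Equiv.congr_fun hbd (g v)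
    simp only [Equiv.Perm.mul_apply, aff_apply, Units.val_one, one_mul] at this
    rw [show g⁻¹ (g v) = v from g.symm_apply_apply v] at this
    rw [show w + v = (v.1 + w.1, v.2 + w.2) by ext <;> simp [add_comm], this]
    ext <;> simp [add_comm]
  choose φ hφ using hw
  have hφ0 : ∀ w, φ w = g w - g 0 := fun w => by
    have := hφ w 0
    rw [add_zero] at this
    rw [this]; simp
  let ψ : ZMod p × ZMod q →+ ZMod p × ZMod q :=
    { toFun := φ
      map_zero' := by simp [hφ0]
      map_add' := fun v w => by
        rw [hφ0, hφ v w, hφ0 w]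
        abel }
  have hψ : ∀ v, ψ v = g v - g 0 := hφ0
  have hinj : Function.Injective ψ := fun v w hvw => by
    rw [hψ, hψ, sub_left_inj] at hvw
    exact g.injective hvw
  have hup : IsUnit (p : ZMod q) := (ZMod.isUnit_iff_coprime p q).2 h
  have huq : IsUnit (q : ZMod p) := (ZMod.isUnit_iff_coprime q p).2 h.symm
  -- `p` kills `(1, 0)` but is invertible modulo `q`, so the additive map `ψ` has no mixed
  -- components.
  have h1 : (ψ (1, 0)).2 = 0 := by
    have : p • ψ (1, 0) = 0 := by
      rw [← map_nsmul]
      convert map_zero ψ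
      ext <;> simp
    have h2 := congrArg Prod.snd this
    simp only [nsmul_eq_mul, Prod.snd_zero] at h2
    exact (hup.mul_right_eq_zero).1 h2
  have h2 : (ψ (0, 1)).1 = 0 := by
    have : q • ψ (0, 1) = 0 := by
      rw [← map_nsmul]
      convert map_zero ψ
      ext <;> simp
    have h2 := congrArg Prod.fst this
    simp only [nsmul_eq_mul, Prod.fst_zero] at h2
    exact (huq.mul_right_eq_zero).1 h2
  have hlin : ∀ v : ZMod p × ZMod q, ψ v = ((ψ (1, 0)).1 * v.1, (ψ (0, 1)).2 * v.2) := by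
    intro v
    have hv : v = v.1.val • ((1, 0) : ZMod p × ZMod q) + v.2.val • ((0, 1) : ZMod p × ZMod q) := by
      ext <;> simp
    conv_lhs => rw [hv, map_add, map_nsmul, map_nsmul]
    ext
    · simp [h2, mul_comm]
    · simp [h1, mul_comm]
  have hsurj : Function.Surjective ψ := Finite.surjective_of_injective hinj
  -- The coordinates of a preimage of `(1, 1)` are the inverses of the two scaling factors.
  obtain ⟨w, hw⟩ := hsurj (1, 1)
  rw [hlin] at hw
  have ha := congrArg Prod.fst hw
  have hc := congrArg Prod.snd hw
  refine ⟨Units.mkOfMulEqOne _ _ ha, (g 0).1, Units.mkOfMulEqOne _ _ hc, (g 0).2, ?_⟩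
  ext1 v
  have := hψ v
  rw [hlin, eq_sub_iff_add_eq] at this
  rw [← this]
  rfl

end Affine

/-! ### Transitive groups of affine permutations -/

section Classification

variable {p q : ℕ}

/-- A group of permutations is transitive. -/
def IsTransSubgroup {X : Type*} (G : Subgroup (Equiv.Perm X)) : Prop :=
  ∀ x y : X, ∃ g ∈ G, g x = y

theorem IsRegularSubgroup.isTrans {X : Type*} {N : Subgroup (Equiv.Perm X)}
    (hN : IsRegularSubgroup N) : IsTransSubgroup N := fun x y => by
  obtain ⟨n, hn, -⟩ := hN x y
  exact ⟨n.1, n.2, hn⟩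

theorem IsTransSubgroup.mono {X : Type*} {G H : Subgroup (Equiv.Perm X)}
    (hG : IsTransSubgroup G) (hle : G ≤ H) : IsTransSubgroup H := fun x y => by
  obtain ⟨g, hg, h⟩ := hG x y
  exact ⟨g, hle hg, h⟩

theorem IsTransSubgroup.card_dvd {X : Type*} [Finite X] [Nonempty X]
    {G : Subgroup (Equiv.Perm X)} (hG : IsTransSubgroup G) : Nat.card X ∣ Nat.card G := by
  obtain ⟨x⟩ := ‹Nonempty X›
  have : MulAction.IsPretransitive G X := ⟨fun x y => by
    obtain ⟨g, hg, h⟩ := hG x y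
    exact ⟨⟨g, hg⟩, h⟩⟩
  rw [← MulAction.index_stabilizer_of_transitive G x]
  exact Subgroup.index_dvd_card _

theorem eq_one_of_pow_eq_one_of_coprime {M : Type*} [Group M] {x : M} {m n : ℕ}
    (hm : x ^ m = 1) (hn : x ^ n = 1) (h : m.Coprime n) : x = 1 := by
  have := pow_gcd_eq_one.2 ⟨hm, hn⟩
  rwa [h.gcd_eq_one, pow_one] at this

theorem eq_of_le_of_isRegularSubgroup {X : Type*} [Nonempty X] {N M : Subgroup (Equiv.Perm X)}
    (hN : IsTransSubgroup N) (hM : IsRegularSubgroup M) (hle : N ≤ M) : N = M := by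
  obtain ⟨x⟩ := ‹Nonempty X›
  refine le_antisymm hle fun m hm => ?_
  obtain ⟨n, hn, h⟩ := hN x (m x)
  have : (⟨n, hle hn⟩ : M) = ⟨m, hm⟩ := (hM x (m x)).unique h rfl
  have h' : n = m := congrArg Subtype.val this
  exact h' ▸ hn

theorem coprime_of_eq (hpq : p = 2 * q + 1) : p.Coprime q := by
  rw [hpq]
  simp

variable [Fact p.Prime] [Fact q.Prime]

theorem coprime_sub_one_of_eq (hpq : p = 2 * q + 1) : p.Coprime (q - 1) := by
  have hq := (Fact.out : q.Prime).two_le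
  rw [Nat.Prime.coprime_iff_not_dvd Fact.out]
  intro h
  have := Nat.le_of_dvd (by omega) h
  omega

theorem coprime_self_sub_one (n : ℕ) [hn : Fact n.Prime] : n.Coprime (n - 1) := by
  have := hn.out.two_le
  rw [Nat.Prime.coprime_iff_not_dvd hn.out]
  intro h
  have := Nat.le_of_dvd (by omega) h
  omega

/-- The orders of `a` and `c` divide `p - 1` and `q - 1`, both prime to `p`; and `p` is invertible
modulo `q`. -/
theorem aff_of_pow_eq_one (hpq : p = 2 * q + 1) {a : (ZMod p)ˣ} {b : ZMod p} {c : (ZMod q)ˣ}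
    {d : ZMod q} (h : aff a b c d ^ p = 1) : a = 1 ∧ c = 1 ∧ d = 0 := by
  obtain ⟨b', d', h'⟩ := aff_pow_exists a b c d p
  rw [h, ← aff_one, aff_inj] at h'
  have ha : a = 1 := eq_one_of_pow_eq_one_of_coprime h'.1.symm
    (ZMod.units_pow_card_sub_one_eq_one p a) (coprime_self_sub_one p)
  have hc : c = 1 := eq_one_of_pow_eq_one_of_coprime h'.2.2.1.symm
    (ZMod.units_pow_card_sub_one_eq_one q c) (coprime_sub_one_of_eq hpq)
  subst ha hc
  rw [transl_pow, ← aff_one, aff_inj] at h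
  refine ⟨rfl, rfl, ?_⟩
  have hu : IsUnit (p : ZMod q) := (ZMod.isUnit_iff_coprime p q).2 (coprime_of_eq hpq)
  exact hu.mul_right_eq_zero.1 h.2.2.2

/-- A transitive group of affine permutations contains the translations in the first coordinate. -/
theorem aff_fst_mem (hpq : p = 2 * q + 1) {G : Subgroup (Equiv.Perm (ZMod p × ZMod q))}
    (hG : G ≤ holGroup p q ⊤) (htr : IsTransSubgroup G) (b : ZMod p) : aff 1 b 1 0 ∈ G := by
  have hdvd : p ∣ Nat.card G := by
    refine dvd_trans ?_ htr.card_dvd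
    rw [Nat.card_prod, Nat.card_zmod]
    exact dvd_mul_right _ _
  obtain ⟨⟨g, hg⟩, hord⟩ := exists_prime_orderOf_dvd_card' p hdvd
  obtain ⟨a, b', c, d, -, rfl⟩ := hG hg
  have hpow : aff a b' c d ^ p = 1 := by
    have := pow_orderOf_eq_one (⟨aff a b' c d, hg⟩ : G)
    rw [hord] at this
    exact congrArg Subtype.val this
  obtain ⟨rfl, rfl, rfl⟩ := aff_of_pow_eq_one hpq hpow
  have hb' : b' ≠ 0 := by
    rintro rfl
    have h1 : (⟨aff 1 0 1 0, hg⟩ : G) = 1 := Subtype.ext aff_one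
    rw [h1, orderOf_one] at hord
    exact (Fact.out : p.Prime).one_lt.ne hord
  -- This multiple of the shift `b'` is the prescribed shift `b`.
  have := G.pow_mem hg (b * b'⁻¹).val
  rw [transl_pow, ZMod.natCast_val, ZMod.cast_id, mul_assoc, inv_mul_cancel₀ hb', mul_one,
    mul_zero] at this
  exact this

/-- A transitive group of affine permutations contains some `(x, y) ↦ (u x, y + 1)` with
`u ^ q = 1`. -/
theorem exists_aff_snd_mem (hq3 : 3 ≤ q) (hpq : p = 2 * q + 1)
    {G : Subgroup (Equiv.Perm (ZMod p × ZMod q))}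
    (hG : G ≤ holGroup p q ⊤) (htr : IsTransSubgroup G) :
    ∃ u : (ZMod p)ˣ, u ^ q = 1 ∧ aff u 0 1 1 ∈ G := by
  have hex : ∀ y : ZMod q, ∃ (a : (ZMod p)ˣ) (b : ZMod p) (c : (ZMod q)ˣ), aff a b c y ∈ G := by
    intro y
    obtain ⟨g, hg, h⟩ := htr (0, 0) (0, y)
    obtain ⟨a, b, c, d, -, rfl⟩ := hG hg
    simp only [aff_apply, mul_zero, zero_add, Prod.mk.injEq] at h
    rw [← h.2]
    exact ⟨a, b, c, hg⟩
  choose a b c habc using hex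
  -- There are `q` values of `y` but only `q - 1` units, so two of the elements share `c`. Their
  -- quotient has `c = 1` and still moves the second coordinate.
  have hni : ¬ Function.Injective c := by
    intro hinj
    have := Nat.card_le_card_of_injective c hinj
    rw [Nat.card_zmod, Nat.card_eq_fintype_card, ZMod.card_units] at this
    omega
  rw [Function.not_injective_iff] at hni
  obtain ⟨y, z, hyz, hne⟩ := hni
  have h1 : ∃ (a : (ZMod p)ˣ) (b : ZMod p) (d : ZMod q), d ≠ 0 ∧ aff a b 1 d ∈ G := by
    have := G.mul_mem (habc y) (G.inv_mem (habc z))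
    rw [aff_inv, aff_mul, hyz, mul_inv_cancel] at this
    refine ⟨_, _, _, ?_, this⟩
    rw [mul_neg, ← mul_assoc, ← Units.val_mul, mul_inv_cancel, Units.val_one, one_mul]
    intro h0
    exact hne (by linear_combination h0)
  obtain ⟨a, b, d, hd, hmem⟩ := h1
  have h2 : aff a 0 1 d ∈ G := by
    have := G.mul_mem (aff_fst_mem hpq hG htr (-b)) hmem
    rw [aff_mul] at this
    simpa using this
  have h2d : (2 * d : ZMod q) ≠ 0 := by
    refine mul_ne_zero ?_ hd
    have : ((2 : ℕ) : ZMod q) ≠ 0 := by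
      rw [Ne, ZMod.natCast_eq_zero_iff]
      intro h
      have := Nat.le_of_dvd (by norm_num) h
      omega
    simpa using this
  -- The exponent is inverse to `d` modulo `q`, so the shift becomes `1`; being even, it makes the
  -- multiplier a square, whose `q`-th power is `1` because `2 * q = p - 1`.
  have h3 := G.pow_mem h2 (2 * ((2 * d)⁻¹).val)
  rw [scale_pow] at h3
  push_cast at h3
  rw [ZMod.natCast_val, ZMod.cast_id, mul_right_comm, mul_inv_cancel₀ h2d] at h3
  refine ⟨_, ?_, h3⟩
  rw [← pow_mul, show 2 * ((2 * d)⁻¹).val * q = (p - 1) * ((2 * d)⁻¹).val by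
    rw [hpq, Nat.add_sub_cancel]; ring, pow_mul, ZMod.units_pow_card_sub_one_eq_one, one_pow]

theorem translGroup_le_of_forall_mem {G : Subgroup (Equiv.Perm (ZMod p × ZMod q))} {d : ZMod q}
    (hd : d ≠ 0) (hT : ∀ b, aff 1 b 1 0 ∈ G) (h : aff 1 0 1 d ∈ G) : translGroup p q ≤ G := by
  rintro _ ⟨b, d', rfl⟩
  have := G.mul_mem (hT b) (G.pow_mem h (d' * d⁻¹).val)
  rw [transl_pow, mul_zero, ZMod.natCast_val, ZMod.cast_id, mul_assoc, inv_mul_cancel₀ hd, mul_one,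
    aff_mul] at this
  simpa using this

theorem translGroup_le_of_mem (hpq : p = 2 * q + 1)
    {G : Subgroup (Equiv.Perm (ZMod p × ZMod q))}
    (hG : G ≤ holGroup p q ⊤) (htr : IsTransSubgroup G) {d : ZMod q} (hd : d ≠ 0)
    (h : aff 1 0 1 d ∈ G) : translGroup p q ≤ G :=
  translGroup_le_of_forall_mem hd (aff_fst_mem hpq hG htr) h

/-- Modulo translations an affine map is its linear part, so the group is the full preimage of its
group of linear parts. -/
theorem exists_eq_holGroup_of_translGroup_le
    {G : Subgroup (Equiv.Perm (ZMod p × ZMod q))}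
    (hG : G ≤ holGroup p q ⊤) (h : translGroup p q ≤ G) :
    ∃ A, G = holGroup p q A := by
  have key : ∀ a b c d, aff a b c d ∈ G ↔ aff a 0 c 0 ∈ G := by
    intro a b c d
    have h1 : aff a b c d = aff 1 b 1 d * aff a 0 c 0 := by rw [aff_mul]; simp
    rw [h1]
    exact G.mul_mem_cancel_left (h ⟨b, d, rfl⟩)
  refine ⟨{ carrier := {x | aff x.1 0 x.2 0 ∈ G}
            mul_mem' := fun {x y} hx hy => ?_
            one_mem' := by simp
            inv_mem' := fun {x} hx => ?_ }, ?_⟩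
  · have := G.mul_mem hx hy
    rw [aff_mul, mul_zero, zero_add, mul_zero, zero_add] at this
    exact this
  · have := G.inv_mem hx
    rw [aff_inv, mul_zero, neg_zero, mul_zero, neg_zero] at this
    exact this
  · ext g
    constructor
    · intro hg
      obtain ⟨a, b, c, d, -, rfl⟩ := hG hg
      exact ⟨a, b, c, d, (key _ _ _ _).1 hg, rfl⟩
    · rintro ⟨a, b, c, d, hac, rfl⟩
      exact (key _ _ _ _).2 hac

/-- A regular cyclic group of affine permutations consists of the translations. -/
theorem eq_translGroup_of_le (hpq : p = 2 * q + 1)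
    {N : Subgroup (Equiv.Perm (ZMod p × ZMod q))} (hle : N ≤ holGroup p q ⊤)
    (hN : IsRegularSubgroup N) (e : N ≃* Cyc (p * q)) : N = translGroup p q := by
  refine eq_of_le_of_isRegularSubgroup hN.isTrans isRegularSubgroup_translGroup ?_
  intro g hg
  obtain ⟨a, b, c, d, -, rfl⟩ := hle hg
  have hcomm : ∀ x ∈ N, ∀ y ∈ N, x * y = y * x := by
    intro x hx y hy
    have : (⟨x, hx⟩ : N) * ⟨y, hy⟩ = ⟨y, hy⟩ * ⟨x, hx⟩ := e.injective (by
      rw [map_mul, map_mul, mul_comm (e _) (e _)])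
    exact congrArg Subtype.val this
  -- Commuting with `x ↦ x + 1` forces `a = 1`.
  have h1 := hcomm _ hg _ (aff_fst_mem hpq hle hN.isTrans 1)
  rw [aff_mul, aff_mul, aff_inj] at h1
  have ha : a = 1 := by
    ext
    have := h1.2.1
    simp only [mul_one, Units.val_one, one_mul] at this
    rw [Units.val_one]
    linear_combination this
  -- The order of `c` divides `p * q` as well as `q - 1`, and these are coprime.
  have hpow : aff a b c d ^ (p * q) = 1 := by
    have : (⟨aff a b c d, hg⟩ : N) ^ (p * q) = 1 := e.injective (by
      have := pow_card_eq_one' (x := e ⟨aff a b c d, hg⟩)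
      rw [card_cyc] at this
      rw [map_pow, map_one, this])
    exact congrArg Subtype.val this
  obtain ⟨b', d', h'⟩ := aff_pow_exists a b c d (p * q)
  rw [hpow, ← aff_one, aff_inj] at h'
  have hc : c = 1 := eq_one_of_pow_eq_one_of_coprime h'.2.2.1.symm
    (ZMod.units_pow_card_sub_one_eq_one q c)
    (Nat.Coprime.mul_left (coprime_sub_one_of_eq hpq) (coprime_self_sub_one q))
  subst ha hc
  exact ⟨b, d, rfl⟩

end Classification

/-! ### Transitive groups of affine permutations not containing the translations -/

section Exceptional

variable {p q : ℕ}

/-- The group of all permutations `(x, y) ↦ (a χ(d) x + b, y + d)` with `a ∈ A`. -/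
def excGroup (χ : Multiplicative (ZMod q) →* (ZMod p)ˣ) (A : Subgroup (ZMod p)ˣ) :
    Subgroup (Equiv.Perm (ZMod p × ZMod q)) where
  carrier := {g | ∃ a b d, a ∈ A ∧ g = aff (a * χ (.ofAdd d)) b 1 d}
  mul_mem' := by
    rintro _ _ ⟨a, b, d, h, rfl⟩ ⟨a', b', d', h', rfl⟩
    refine ⟨a * a', ↑(a * χ (.ofAdd d)) * b' + b, d' + d, A.mul_mem h h', ?_⟩
    rw [aff_mul, aff_inj]
    refine ⟨?_, rfl, by simp, by simp⟩
    rw [ofAdd_add, map_mul, mul_mul_mul_comm, mul_comm (χ (.ofAdd d'))]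
  one_mem' := ⟨1, 0, 0, A.one_mem, by simp⟩
  inv_mem' := by
    rintro _ ⟨a, b, d, h, rfl⟩
    refine ⟨a⁻¹, -(((a * χ (.ofAdd d))⁻¹ : (ZMod p)ˣ) * b), -d, A.inv_mem h, ?_⟩
    rw [aff_inv, aff_inj]
    refine ⟨?_, rfl, by simp, by simp⟩
    rw [ofAdd_neg, map_inv, mul_inv]

theorem aff_mem_excGroup {χ : Multiplicative (ZMod q) →* (ZMod p)ˣ} {A : Subgroup (ZMod p)ˣ}
    {a : (ZMod p)ˣ} {b : ZMod p} {c : (ZMod q)ˣ} {d : ZMod q} :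
    aff a b c d ∈ excGroup χ A ↔ c = 1 ∧ a * (χ (.ofAdd d))⁻¹ ∈ A := by
  constructor
  · rintro ⟨a', b', d', h, h'⟩
    obtain ⟨rfl, -, rfl, rfl⟩ := aff_inj.1 h'
    exact ⟨rfl, by rwa [mul_inv_cancel_right]⟩
  · rintro ⟨rfl, h⟩
    exact ⟨_, b, d, h, by rw [inv_mul_cancel_right]⟩

theorem excGroup_le_holGroup (χ : Multiplicative (ZMod q) →* (ZMod p)ˣ) (A : Subgroup (ZMod p)ˣ) :
    excGroup χ A ≤ holGroup p q ⊤ := by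
  rintro _ ⟨a, b, d, h, rfl⟩
  exact aff_mem_holGroup.2 trivial

theorem excGroup_mono (χ : Multiplicative (ZMod q) →* (ZMod p)ˣ) {A B : Subgroup (ZMod p)ˣ}
    (h : A ≤ B) : excGroup χ A ≤ excGroup χ B := by
  rintro _ ⟨a, b, d, ha, rfl⟩
  exact ⟨a, b, d, h ha, rfl⟩

theorem isRegularSubgroup_excGroup_bot (χ : Multiplicative (ZMod q) →* (ZMod p)ˣ) :
    IsRegularSubgroup (excGroup χ ⊥) := by
  intro x y
  refine ⟨⟨aff (χ (.ofAdd (y.2 - x.2))) (y.1 - χ (.ofAdd (y.2 - x.2)) * x.1) 1 (y.2 - x.2),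
    aff_mem_excGroup.2 ⟨rfl, by simp⟩⟩, by simp, ?_⟩
  rintro ⟨_, a, b, d, ha, rfl⟩ h
  rw [Subgroup.mem_bot] at ha
  subst ha
  apply Subtype.ext
  change aff _ b 1 d = _
  rw [aff_inj]
  simp only [aff_apply, Units.val_one, one_mul] at h
  rw [← h]
  simp

theorem conj_mem_excGroup_bot {χ : Multiplicative (ZMod q) →* (ZMod p)ˣ} {A : Subgroup (ZMod p)ˣ}
    {g n : Equiv.Perm (ZMod p × ZMod q)} (hg : g ∈ excGroup χ A) (hn : n ∈ excGroup χ ⊥) :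
    g * n * g⁻¹ ∈ excGroup χ ⊥ := by
  obtain ⟨a, b, d, -, rfl⟩ := hg
  obtain ⟨a', b', d', ha', rfl⟩ := hn
  rw [Subgroup.mem_bot] at ha'
  subst ha'
  rw [aff_inv, aff_mul, aff_mul, aff_mem_excGroup]
  refine ⟨by simp, ?_⟩
  have h : (((1 : (ZMod q)ˣ) * 1 : (ZMod q)ˣ) : ZMod q) * -((1⁻¹ : (ZMod q)ˣ).1 * d) +
    ((1 : (ZMod q)ˣ).1 * d' + d) = d' := by simp
  rw [h, Subgroup.mem_bot, one_mul, mul_right_comm, mul_inv_cancel_right, mul_inv_cancel]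

theorem eq_bot_of_isRegularSubgroup_excGroup {χ : Multiplicative (ZMod q) →* (ZMod p)ˣ}
    {A : Subgroup (ZMod p)ˣ} (h : IsRegularSubgroup (excGroup χ A)) : A = ⊥ := by
  rw [eq_bot_iff]
  intro a ha
  have h1 : aff a 0 1 0 ∈ excGroup χ A := aff_mem_excGroup.2 ⟨rfl, by simpa using ha⟩
  have := (h 0 0).unique (y₁ := ⟨_, h1⟩) (y₂ := 1) (by simp) (by simp)
  have := congrArg Subtype.val this
  change aff a 0 1 0 = 1 at this
  rw [← aff_one, aff_inj] at this
  exact this.1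

theorem holGroup_bot : holGroup p q ⊥ = translGroup p q := by
  ext g
  constructor
  · rintro ⟨a, b, c, d, h, rfl⟩
    obtain ⟨rfl, rfl⟩ := Prod.mk.inj (Subgroup.mem_bot.1 h)
    exact ⟨b, d, rfl⟩
  · exact fun h => translGroup_le_holGroup _ h

theorem eq_bot_of_isRegularSubgroup_holGroup {A : Subgroup ((ZMod p)ˣ × (ZMod q)ˣ)}
    (h : IsRegularSubgroup (holGroup p q A)) : A = ⊥ := by
  rw [eq_bot_iff]
  rintro ⟨a, c⟩ ha
  have := (h 0 0).unique (y₁ := ⟨aff a 0 c 0, aff_mem_holGroup.2 ha⟩) (y₂ := 1)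
    (by simp) (by simp)
  have := congrArg Subtype.val this
  change aff a 0 c 0 = 1 at this
  rw [← aff_one, aff_inj] at this
  rw [Subgroup.mem_bot, this.1, this.2.2.1]
  rfl

theorem char_apply_eq_pow {M : Type*} [Group M] {n : ℕ} [NeZero n]
    (χ : Multiplicative (ZMod n) →* M) (d : ZMod n) :
    χ (.ofAdd d) = χ (.ofAdd 1) ^ d.val := by
  rw [← map_pow, ← ofAdd_nsmul]
  simp

theorem char_ne_one {M : Type*} [Group M] {n : ℕ} [Fact n.Prime]
    {χ : Multiplicative (ZMod n) →* M} (hχ : χ ≠ 1)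
    {d : ZMod n} (hd : d ≠ 0) : χ (.ofAdd d) ≠ 1 := by
  intro h
  apply hχ
  refine MonoidHom.ext fun x => ?_
  have : x = (Multiplicative.ofAdd d) ^ (x.toAdd * d⁻¹).val := by
    rw [← ofAdd_nsmul]
    simp [hd]
  rw [this, map_pow, h, one_pow, MonoidHom.one_apply]

theorem char_pow_eq_one {M : Type*} [Group M] {n : ℕ} (χ : Multiplicative (ZMod n) →* M)
    (x : Multiplicative (ZMod n)) : χ x ^ n = 1 := by
  rw [← map_pow]
  have : x ^ n = 1 := by
    have := pow_card_eq_one' (x := x)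
    rwa [card_cyc] at this
  rw [this, map_one]

theorem exists_zmod_hom {M : Type*} [Group M] {n : ℕ} {u : M} (hu : u ^ n = 1) :
    ∃ χ : Multiplicative (ZMod n) →* M, χ (.ofAdd 1) = u := by
  let f : ZMod n →+ Additive M :=
    ZMod.lift n ⟨zmultiplesHom _ (Additive.ofMul u), by simp [← ofMul_pow, hu]⟩
  refine ⟨AddMonoidHom.toMultiplicativeLeft f, ?_⟩
  have : f ((1 : ℤ) : ZMod n) = Additive.ofMul u := by
    rw [ZMod.lift_coe]
    simp
  rw [Int.cast_one] at this
  change (f 1).toMul = u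
  rw [this]
  rfl

variable [Fact p.Prime] [Fact q.Prime]

/-- In a field an element of order `q` is a primitive root of unity, so its powers exhaust the
`q`-th roots of unity. -/
theorem exists_pow_eq_of_pow_eq_one {u v : (ZMod p)ˣ} (hu : u ^ q = 1) (hu1 : u ≠ 1)
    (hv : v ^ q = 1) : ∃ k : ℕ, u ^ k = v := by
  have hord : orderOf u = q := orderOf_eq_prime hu hu1
  have hprim : IsPrimitiveRoot (u : ZMod p) q := by
    rw [IsPrimitiveRoot.coe_units_iff, ← hord]
    exact IsPrimitiveRoot.orderOf u
  obtain ⟨i, -, hi⟩ := hprim.eq_pow_of_pow_eq_one (ξ := (v : ZMod p))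
    (by rw [← Units.val_pow_eq_pow_val, hv, Units.val_one])
  exact ⟨i, Units.ext (by rw [← hi, Units.val_pow_eq_pow_val])⟩

/-- The translation of `y` by `1` would put `χ(1)⁻¹` into `A`, so the order of `χ(1)` would divide
both `2` and the odd number `q`. -/
theorem not_translGroup_le_excGroup (hq3 : 3 ≤ q)
    {χ : Multiplicative (ZMod q) →* (ZMod p)ˣ} (hχ : χ ≠ 1)
    {A : Subgroup (ZMod p)ˣ} (hA : ∀ a ∈ A, a ^ 2 = 1) : ¬ translGroup p q ≤ excGroup χ A := by
  intro h
  have h1 := aff_mem_excGroup.1 (h ⟨0, 1, rfl⟩)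
  have h2 := hA _ (A.inv_mem h1.2)
  rw [one_mul, inv_inv] at h2
  refine char_ne_one hχ one_ne_zero
    (eq_one_of_pow_eq_one_of_coprime h2 (char_pow_eq_one χ _) ?_)
  rw [Nat.coprime_primes Nat.prime_two Fact.out]
  omega

/-- A transitive group of affine permutations which does not contain the translations. -/
theorem exists_eq_excGroup (hq3 : 3 ≤ q) (hpq : p = 2 * q + 1)
    {G : Subgroup (Equiv.Perm (ZMod p × ZMod q))}
    (hG : G ≤ holGroup p q ⊤) (htr : IsTransSubgroup G) (hnot : ¬ translGroup p q ≤ G) :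
    ∃ (χ : Multiplicative (ZMod q) →* (ZMod p)ˣ) (A : Subgroup (ZMod p)ˣ), χ ≠ 1 ∧
      (∀ a ∈ A, a ^ 2 = 1) ∧ G = excGroup χ A := by
  obtain ⟨u, hu, hmem⟩ := exists_aff_snd_mem hq3 hpq hG htr
  obtain ⟨χ, rfl⟩ := exists_zmod_hom hu
  have hT := aff_fst_mem hpq hG htr
  have hχmem : ∀ d, aff (χ (.ofAdd d)) 0 1 d ∈ G := by
    intro d
    have := G.pow_mem hmem d.val
    rwa [scale_pow, ← char_apply_eq_pow, mul_one, ZMod.natCast_val, ZMod.cast_id] at this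
  have hT0 : ∀ a b c d, aff a b c d ∈ G → aff a 0 c d ∈ G := by
    intro a b c d h
    have := G.mul_mem (hT (-b)) h
    rw [aff_mul] at this
    simpa using this
  have hc : ∀ a b c d, aff a b c d ∈ G → c = 1 := by
    intro a b c d h
    by_contra hc
    -- In the commutator with `(x, y) ↦ (u x, y + 1)` the linear parts cancel. What is left moves
    -- `y` by `c - 1`, and if `c ≠ 1` all translations follow.
    have h1 := G.mul_mem (G.mul_mem h hmem) (G.mul_mem (G.inv_mem h) (G.inv_mem hmem))
    rw [aff_inv, aff_inv, aff_mul, aff_mul, aff_mul] at h1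
    have h2 := hT0 _ _ _ _ h1
    refine hnot (translGroup_le_of_mem hpq hG htr (d := c.1 - 1) ?_ ?_)
    · intro h0
      exact hc (Units.ext (by rw [Units.val_one]; linear_combination h0))
    · refine (congrArg (· ∈ G) ?_).mp h2
      rw [aff_inj]
      refine ⟨?_, ?_, ?_, ?_⟩
      · rw [mul_mul_mul_comm, mul_inv_cancel, mul_inv_cancel, one_mul]
      · rfl
      · simp
      · have hcc : c.1 * c⁻¹.1 = 1 := c.mul_inv
        rw [mul_one c, inv_one, Units.val_one]
        linear_combination (-1 - d) * hcc
  have hχ : χ ≠ 1 := by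
    rintro rfl
    exact hnot (translGroup_le_of_mem hpq hG htr one_ne_zero hmem)
  let A : Subgroup (ZMod p)ˣ :=
    { carrier := {a | aff a 0 1 0 ∈ G}
      mul_mem' := fun {x y} hx hy => by
        have := G.mul_mem hx hy
        rw [aff_mul, mul_zero, zero_add, mul_zero, zero_add, one_mul] at this
        exact this
      one_mem' := by simp
      inv_mem' := fun {x} hx => by
        have := G.inv_mem hx
        rw [aff_inv, mul_zero, neg_zero, mul_zero, neg_zero, inv_one] at this
        exact this }
  refine ⟨χ, A, hχ, fun a ha => ?_, ?_⟩
  · by_contra ha2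
    -- If `a ^ 2 ≠ 1` then its powers include `χ(1)`, so `χ(1)` lies in `A`; dividing it out leaves
    -- `y ↦ y + 1` in the group.
    have haq : (a ^ 2) ^ q = 1 := by
      rw [← pow_mul, show 2 * q = p - 1 by omega, ZMod.units_pow_card_sub_one_eq_one]
    obtain ⟨k, hk⟩ := exists_pow_eq_of_pow_eq_one haq ha2 hu
    have h1 : χ (.ofAdd 1) ∈ A := hk ▸ A.pow_mem (A.pow_mem ha 2) k
    have h2 := G.mul_mem (A.inv_mem h1 : aff _ 0 1 0 ∈ G) hmem
    rw [aff_mul, inv_mul_cancel, mul_zero, zero_add, one_mul, mul_one, Units.val_one,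
      add_zero] at h2
    exact hnot (translGroup_le_of_mem hpq hG htr one_ne_zero h2)
  · have key : ∀ a b d, aff (a * χ (.ofAdd d)) b 1 d ∈ G ↔ a ∈ A := by
      intro a b d
      have h1 : aff (a * χ (.ofAdd d)) b 1 d =
          aff 1 b 1 0 * (aff a 0 1 0 * aff (χ (.ofAdd d)) 0 1 d) := by
        rw [aff_mul, aff_mul]; simp
      rw [h1, G.mul_mem_cancel_left (hT b), G.mul_mem_cancel_right (hχmem d)]
      rfl
    ext g
    constructor
    · intro hg
      obtain ⟨a, b, c, d, -, rfl⟩ := hG hg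
      obtain rfl := hc _ _ _ _ hg
      refine aff_mem_excGroup.2 ⟨rfl, (key _ b d).1 ?_⟩
      rwa [inv_mul_cancel_right]
    · rintro ⟨a, b, d, ha, rfl⟩
      exact (key _ _ _).2 ha

/-- Both `χ(1)` and `χ'(1)` have order `q`, so `χ(1) = χ'(1) ^ k` with `k` prime to `q`; multiplying
`y` by `k` exchanges the characters. -/
theorem exists_map_excGroup_eq {χ χ' : Multiplicative (ZMod q) →* (ZMod p)ˣ} (hχ : χ ≠ 1)
    (hχ' : χ' ≠ 1) (A : Subgroup (ZMod p)ˣ) :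
    ∃ f : (ZMod p × ZMod q) ≃ (ZMod p × ZMod q),
      (excGroup χ A).map f.permCongrHom.toMonoidHom = excGroup χ' A := by
  obtain ⟨k, hk⟩ := exists_pow_eq_of_pow_eq_one (char_pow_eq_one χ' _)
    (char_ne_one hχ' one_ne_zero) (char_pow_eq_one χ (.ofAdd 1))
  have hk0 : (k : ZMod q) ≠ 0 := by
    intro h0
    rw [ZMod.natCast_eq_zero_iff] at h0
    obtain ⟨m, rfl⟩ := h0
    rw [pow_mul, char_pow_eq_one, one_pow] at hk
    exact char_ne_one hχ one_ne_zero hk.symm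
  let c : (ZMod q)ˣ := Units.mk0 _ hk0
  have hcχ : ∀ d, χ' (.ofAdd (c.1 * d)) = χ (.ofAdd d) := by
    intro d
    have : c.1 * d = (k * d.val) • (1 : ZMod q) := by
      simp [c]
    rw [this, ofAdd_nsmul, map_pow, pow_mul, hk, ← char_apply_eq_pow]
  have hconj : ∀ (a : (ZMod p)ˣ) (b : ZMod p) (d : ZMod q),
      (aff (p := p) 1 0 c 0).permCongrHom (aff a b 1 d) = aff a b 1 (c.1 * d) := by
    intro a b d
    change (aff 1 0 c 0) * (aff a b 1 d) * (aff 1 0 c 0)⁻¹ = _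
    rw [aff_inv, aff_mul, aff_mul, aff_inj]
    refine ⟨by rw [one_mul, inv_one, mul_one], ?_, by rw [mul_one, mul_inv_cancel], ?_⟩
    · rw [mul_zero, neg_zero, mul_zero, zero_add, Units.val_one, one_mul, add_zero]
    · rw [mul_zero, neg_zero, mul_zero, zero_add, add_zero]
  refine ⟨aff 1 0 c 0, ?_⟩
  ext g
  constructor
  · rintro ⟨_, ⟨a, b, d, ha, rfl⟩, rfl⟩
    exact ⟨a, b, c.1 * d, ha, by rw [hcχ]; exact hconj _ _ _⟩
  · rintro ⟨a, b, d, ha, rfl⟩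
    refine ⟨_, ⟨a, b, c⁻¹.1 * d, ha, rfl⟩, (hconj _ _ _).trans ?_⟩
    rw [← hcχ, ← mul_assoc, ← Units.val_mul, mul_inv_cancel, Units.val_one, one_mul]

end Exceptional

/-! ### Regular cyclic groups normalised by a transitive group -/

section RegularCyclic

variable {p q : ℕ}

theorem translGroup_mem_regularSet (h : p.Coprime q)
    {G : Subgroup (Equiv.Perm (ZMod p × ZMod q))} (hG : G ≤ holGroup p q ⊤) :
    translGroup p q ∈ regularSet G (Cyc (p * q)) := by
  refine ⟨isRegularSubgroup_translGroup, nonempty_translGroup_mulEquiv h, fun g hg n hn => ?_⟩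
  obtain ⟨a, b, c, d, -, rfl⟩ := hG hg
  exact conj_mem_translGroup a b c d hn

theorem exists_equiv_map_le_holGroup [NeZero p] [NeZero q] (h : p.Coprime q) {X : Type*}
    [Nonempty X] {G N : Subgroup (Equiv.Perm X)} (hN : N ∈ regularSet G (Cyc (p * q))) :
    ∃ f : X ≃ ZMod p × ZMod q, N.map f.permCongrHom.toMonoidHom = translGroup p q ∧
      G.map f.permCongrHom.toMonoidHom ≤ holGroup p q ⊤ := by
  obtain ⟨f, hf⟩ := exists_equiv_map_eq_translGroup h hN.1 hN.2.1.some
  refine ⟨f, hf, fun g hg => ?_⟩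
  have h3 := (map_mem_regularSet f hN).2.2 g hg
  rw [hf] at h3
  obtain ⟨a, b, c, d, rfl⟩ := exists_eq_aff_of_normalises h h3
  exact aff_mem_holGroup.2 trivial

/-- The permutation `(x, y) ↦ (x + h χ(y), y)`. -/
def shear (χ : Multiplicative (ZMod q) →* (ZMod p)ˣ) (h : ZMod p) :
    Equiv.Perm (ZMod p × ZMod q) where
  toFun v := (v.1 + h * χ (.ofAdd v.2), v.2)
  invFun v := (v.1 - h * χ (.ofAdd v.2), v.2)
  left_inv v := by simp
  right_inv v := by simp

theorem shear_conj_aff (χ : Multiplicative (ZMod q) →* (ZMod p)ˣ) (h b : ZMod p) (d : ZMod q)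
    (v : ZMod p × ZMod q) :
    (shear χ h).permCongrHom (aff 1 b 1 d) v =
      (v.1 + b + h * (χ (.ofAdd d) - 1) * χ (.ofAdd v.2), v.2 + d) := by
  change shear χ h (aff 1 b 1 d ((shear χ h).symm v)) = _
  simp only [shear, Equiv.coe_fn_mk, Equiv.coe_fn_symm_mk, aff_apply, Units.val_one, one_mul,
    ofAdd_add, map_mul, Units.val_mul]
  ext1
  · simp only
    ring
  · rfl

/-- Shears centralise `excGroup χ ⊥`, because `χ(y + d) = χ(d) χ(y)`. Hence they permute the regular
cyclic groups that it normalises. -/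
theorem excGroup_bot_map_shear (χ : Multiplicative (ZMod q) →* (ZMod p)ˣ) (h : ZMod p) :
    (excGroup χ ⊥).map (shear χ h).permCongrHom.toMonoidHom = excGroup χ ⊥ := by
  have key : ∀ g ∈ excGroup χ ⊥, (shear χ h).permCongrHom g = g := by
    rintro _ ⟨a, b, d, ha, rfl⟩
    obtain rfl := Subgroup.mem_bot.1 ha
    ext1 v
    change shear χ h (aff _ b 1 d ((shear χ h).symm v)) = _
    simp only [shear, Equiv.coe_fn_mk, Equiv.coe_fn_symm_mk, aff_apply, Units.val_one, one_mul,
      ofAdd_add, map_mul, Units.val_mul]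
    ext1
    · simp only
      ring
    · rfl
  ext g
  constructor
  · rintro ⟨g, hg, rfl⟩
    change (shear χ h).permCongrHom g ∈ _
    rwa [key g hg]
  · exact fun hg => ⟨g, hg, key g hg⟩

variable [Fact p.Prime] [Fact q.Prime]

/-- In coordinates where `N'` is the translation group, `N` is a regular cyclic group of affine
maps, hence also the translation group. -/
theorem eq_of_mem_regularSet_of_le (hpq : p = 2 * q + 1) {X : Type*}
    [Nonempty X] {G N N' : Subgroup (Equiv.Perm X)} (hN : N ∈ regularSet G (Cyc (p * q)))
    (hle : N ≤ G) (hN' : N' ∈ regularSet G (Cyc (p * q))) : N' = N := by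
  obtain ⟨f, hf, hG⟩ := exists_equiv_map_le_holGroup (coprime_of_eq hpq) hN'
  have h1 := map_mem_regularSet f hN
  have h2 := eq_translGroup_of_le hpq ((Subgroup.map_mono hle).trans hG) h1.1 h1.2.1.some
  exact Subgroup.map_injective f.permCongrHom.injective (hf.trans h2.symm)

theorem regularSet_holGroup (hpq : p = 2 * q + 1) (A : Subgroup ((ZMod p)ˣ × (ZMod q)ˣ)) :
    regularSet (holGroup p q A) (Cyc (p * q)) = {translGroup p q} := by
  have hle : holGroup p q A ≤ holGroup p q ⊤ := by
    rintro _ ⟨a, b, c, d, -, rfl⟩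
    exact aff_mem_holGroup.2 trivial
  have hmem := translGroup_mem_regularSet (coprime_of_eq hpq) hle
  exact Set.eq_singleton_iff_unique_mem.2 ⟨hmem, fun N hN =>
    eq_of_mem_regularSet_of_le hpq hmem (translGroup_le_holGroup A) hN⟩

/-- Comparing the conjugates of `y ↦ y + 1` at `(0, 0)` and `(0, 1)` gives `(h - h') (χ(1) - 1) ^ 2
= 0`. -/
theorem shear_map_injective {χ : Multiplicative (ZMod q) →* (ZMod p)ˣ} (hχ : χ ≠ 1) :
    Function.Injective fun h : ZMod p =>
      (translGroup p q).map (shear χ h).permCongrHom.toMonoidHom := by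
  intro h h' hh
  have hmem : (shear χ h).permCongrHom (aff 1 0 1 1) ∈
      (translGroup p q).map (shear χ h').permCongrHom.toMonoidHom := by
    exact hh.le ⟨_, ⟨0, 1, rfl⟩, rfl⟩
  obtain ⟨_, ⟨b, d, rfl⟩, hbd⟩ := hmem
  have h0 := Equiv.congr_fun hbd (0, 0)
  have h1 := Equiv.congr_fun hbd (0, 1)
  change (shear χ h').permCongrHom (aff 1 b 1 d) _ = _ at h0 h1
  rw [shear_conj_aff, shear_conj_aff] at h0 h1
  simp only [zero_add, Prod.mk.injEq, add_zero, ofAdd_zero, map_one, Units.val_one,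
    mul_one] at h0 h1
  obtain ⟨h0, rfl⟩ := h0
  have hu : (χ (.ofAdd 1) : ZMod p) - 1 ≠ 0 := by
    intro h2
    refine char_ne_one hχ one_ne_zero (Units.ext ?_)
    rw [Units.val_one]
    linear_combination h2
  have h2 : (h - h') * ((χ (.ofAdd 1) : ZMod p) - 1) * ((χ (.ofAdd 1) : ZMod p) - 1) = 0 := by
    linear_combination h0 - h1.1
  have h3 := (mul_eq_zero.1 ((mul_eq_zero.1 h2).resolve_right hu)).resolve_right hu
  exact sub_eq_zero.1 h3

/-- The regular cyclic groups normalised by `excGroup χ A`. -/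
theorem exists_eq_map_shear (hq3 : 3 ≤ q) (hpq : p = 2 * q + 1)
    {χ : Multiplicative (ZMod q) →* (ZMod p)ˣ} (hχ : χ ≠ 1)
    {A : Subgroup (ZMod p)ˣ} (hA : ∀ a ∈ A, a ^ 2 = 1)
    {N : Subgroup (Equiv.Perm (ZMod p × ZMod q))}
    (hN : N ∈ regularSet (excGroup χ A) (Cyc (p * q))) :
    ∃ h : ZMod p, N = (translGroup p q).map (shear χ h).permCongrHom.toMonoidHom ∧
      (A ≠ ⊥ → h = 0) := by
  obtain ⟨f, hf, hG⟩ := exists_equiv_map_le_holGroup (coprime_of_eq hpq) hN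
  -- Otherwise `N` would lie in `excGroup χ A` and so be its translation group. Thus the group is
  -- also exceptional in the coordinates adapted to `N`.
  have hnot : ¬ translGroup p q ≤ (excGroup χ A).map f.permCongrHom.toMonoidHom := by
    rw [← hf, Subgroup.map_le_map_iff_of_injective f.permCongrHom.injective]
    intro hle
    have := eq_translGroup_of_le hpq (hle.trans (excGroup_le_holGroup χ A)) hN.1 hN.2.1.some
    exact not_translGroup_le_excGroup hq3 hχ hA (this ▸ hle)
  have htr : IsTransSubgroup ((excGroup χ A).map f.permCongrHom.toMonoidHom) :=
    (isRegularSubgroup_map f (isRegularSubgroup_excGroup_bot χ)).isTrans.mono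
      (Subgroup.map_mono (excGroup_mono χ bot_le))
  obtain ⟨χ', A', -, -, heq⟩ := exists_eq_excGroup hq3 hpq hG htr hnot
  have hmemN : ∀ g, f.permCongrHom g ∈ translGroup p q → g ∈ N := by
    intro g hg
    rw [← hf] at hg
    obtain ⟨n, hn, h⟩ := hg
    exact f.permCongrHom.injective h ▸ hn
  -- The `p`-th power is trivial, so in the adapted coordinates too this is a translation of the
  -- first coordinate.
  have hT : ∀ b, aff 1 b 1 0 ∈ N := by
    intro b
    have h1 : aff 1 b 1 0 ∈ excGroup χ A := aff_mem_excGroup.2 ⟨rfl, by simp⟩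
    obtain ⟨a', b', c', d', -, h2⟩ := hG ⟨_, h1, rfl⟩
    change f.permCongrHom (aff 1 b 1 0) = _ at h2
    have h3 : aff a' b' c' d' ^ p = 1 := by
      rw [← h2, ← map_pow, transl_pow]
      simp
    obtain ⟨rfl, rfl, rfl⟩ := aff_of_pow_eq_one hpq h3
    exact hmemN _ ⟨b', 0, h2⟩
  -- In the adapted coordinates `κ` is `y ↦ y + 1`, which commutes with every element of an
  -- exceptional group, since these have `c = 1`.
  obtain ⟨κ, hκ⟩ := f.permCongrHom.surjective (aff 1 0 1 1)
  have hκN : κ ∈ N := hmemN κ ⟨0, 1, hκ⟩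
  have hcomm : ∀ g ∈ excGroup χ A, κ * g = g * κ := by
    intro g hg
    have h1 : f.permCongrHom g ∈ excGroup χ' A' := heq ▸ ⟨g, hg, rfl⟩
    obtain ⟨a, b, d, -, h2⟩ := h1
    apply f.permCongrHom.injective
    rw [map_mul, map_mul, hκ, h2, aff_mul, aff_mul, aff_inj]
    simp [add_comm]
  obtain ⟨h₀, d₀, hκ0⟩ : ∃ h₀ d₀, κ (0, 0) = (h₀, d₀) := ⟨_, _, rfl⟩
  -- A permutation commuting with a transitive group is determined by one value; here the element of
  -- `excGroup χ ⊥` moving the origin to `v` is used.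
  have hκv : ∀ v : ZMod p × ZMod q, κ v = (χ (.ofAdd v.2) * h₀ + v.1, v.2 + d₀) := by
    intro v
    have h1 : aff (χ (.ofAdd v.2)) v.1 1 v.2 ∈ excGroup χ A :=
      aff_mem_excGroup.2 ⟨rfl, by simp⟩
    have h2 := Equiv.congr_fun (hcomm _ h1) (0, 0)
    rw [Equiv.Perm.mul_apply, Equiv.Perm.mul_apply, hκ0] at h2
    simpa [add_comm d₀] using h2
  -- If `d₀ = 0`, powers of `κ` move the origin by multiples of `h₀`; then `κ ^ q = 1` forces `h₀ =
  -- 0` and `κ = 1`.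
  have hd₀ : d₀ ≠ 0 := by
    rintro rfl
    have h1 : ∀ k : ℕ, (κ ^ k) (0, 0) = (k * h₀, 0) := by
      intro k
      induction k with
      | zero => simp
      | succ k ih =>
        rw [pow_succ', Equiv.Perm.mul_apply, ih, hκv]
        ext1
        · simp
          ring
        · simp
    have h2 : κ ^ q = 1 := by
      apply f.permCongrHom.injective
      rw [map_pow, hκ, transl_pow]
      simp
    have h3 := h1 q
    rw [h2, Equiv.Perm.one_apply] at h3
    have hu : IsUnit (q : ZMod p) := (ZMod.isUnit_iff_coprime q p).2 (coprime_of_eq hpq).symm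
    have h4 : h₀ = 0 := hu.mul_right_eq_zero.1 (congrArg Prod.fst h3).symm
    have h5 : κ = 1 := by
      ext1 v
      rw [hκv, h4]
      simp
    rw [h5, map_one, ← aff_one, aff_inj] at hκ
    exact zero_ne_one hκ.2.2.2
  have hu : (χ (.ofAdd d₀) : ZMod p) - 1 ≠ 0 := by
    intro h2
    refine char_ne_one hχ hd₀ (Units.ext ?_)
    rw [Units.val_one]
    linear_combination h2
  -- With this parameter the shear conjugates `y ↦ y + d₀` into `κ`.
  refine ⟨h₀ * ((χ (.ofAdd d₀) : ZMod p) - 1)⁻¹, ?_, ?_⟩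
  · symm
    refine eq_of_le_of_isRegularSubgroup
      (isRegularSubgroup_map _ isRegularSubgroup_translGroup).isTrans hN.1 ?_
    rw [Subgroup.map_le_iff_le_comap]
    refine translGroup_le_of_forall_mem hd₀ (fun b => ?_) ?_
    · have : (shear χ (h₀ * ((χ (.ofAdd d₀) : ZMod p) - 1)⁻¹)).permCongrHom (aff 1 b 1 0) =
          aff 1 b 1 0 := by
        ext1 v
        rw [shear_conj_aff]
        simp
      change Equiv.permCongrHom _ _ ∈ N
      rw [this]
      exact hT b
    · have : (shear χ (h₀ * ((χ (.ofAdd d₀) : ZMod p) - 1)⁻¹)).permCongrHom (aff 1 0 1 d₀) =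
          κ := by
        ext1 v
        rw [shear_conj_aff, hκv, mul_assoc h₀, inv_mul_cancel₀ hu]
        ext1
        · simp only
          ring
        · rfl
      change Equiv.permCongrHom _ _ ∈ N
      rw [this]
      exact hκN
  -- The map `x ↦ a x` fixes the origin and commutes with `κ`, so it fixes the image of the origin:
  -- `(a - 1) h₀ = 0`.
  · intro hne
    obtain ⟨a, ha1⟩ := Subgroup.ne_bot_iff_exists_ne_one.1 hne
    have h1 : aff a.1 0 1 0 ∈ excGroup χ A := aff_mem_excGroup.2 ⟨rfl, by simp⟩
    have h2 := Equiv.congr_fun (hcomm _ h1) (0, 0)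
    rw [Equiv.Perm.mul_apply, Equiv.Perm.mul_apply, hκ0] at h2
    simp only [aff_apply, mul_zero, add_zero, hκ0, Prod.mk.injEq] at h2
    have h3 : (a.1.1 - 1) * h₀ = 0 := by linear_combination -h2.1
    have h4 : (a.1.1 - 1 : ZMod p) ≠ 0 := fun h =>
      ha1 (Subtype.ext (Units.ext (sub_eq_zero.1 h)))
    rw [(mul_eq_zero.1 h3).resolve_left h4, zero_mul]

theorem ncard_regularSet_excGroup_bot (hq3 : 3 ≤ q) (hpq : p = 2 * q + 1)
    {χ : Multiplicative (ZMod q) →* (ZMod p)ˣ} (hχ : χ ≠ 1) :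
    (regularSet (excGroup χ ⊥) (Cyc (p * q))).ncard = p := by
  have : regularSet (excGroup χ ⊥) (Cyc (p * q)) = Set.range fun h : ZMod p =>
      (translGroup p q).map (shear χ h).permCongrHom.toMonoidHom := by
    ext N
    constructor
    · intro hN
      obtain ⟨h, rfl, -⟩ := exists_eq_map_shear hq3 hpq hχ (by simp) hN
      exact ⟨h, rfl⟩
    · rintro ⟨h, rfl⟩
      have := map_mem_regularSet (shear χ h) (translGroup_mem_regularSet (coprime_of_eq hpq)
        (excGroup_le_holGroup χ ⊥))
      rwa [excGroup_bot_map_shear] at this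
  rw [this, ← Set.image_univ, Set.ncard_image_of_injective _ (shear_map_injective hχ),
    Set.ncard_univ, Nat.card_zmod]

theorem ncard_regularSet_excGroup (hq3 : 3 ≤ q) (hpq : p = 2 * q + 1)
    {χ : Multiplicative (ZMod q) →* (ZMod p)ˣ} (hχ : χ ≠ 1)
    {A : Subgroup (ZMod p)ˣ} (hA : ∀ a ∈ A, a ^ 2 = 1) (hne : A ≠ ⊥) :
    (regularSet (excGroup χ A) (Cyc (p * q))).ncard = 1 := by
  rw [Set.ncard_eq_one]
  have hmem := translGroup_mem_regularSet (coprime_of_eq hpq) (excGroup_le_holGroup χ A)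
  have key : ∀ N ∈ regularSet (excGroup χ A) (Cyc (p * q)),
      N = (translGroup p q).map (shear χ 0).permCongrHom.toMonoidHom := by
    intro N hN
    obtain ⟨h, hh, h0⟩ := exists_eq_map_shear hq3 hpq hχ hA hN
    rwa [h0 hne] at hh
  exact ⟨_, Set.eq_singleton_iff_unique_mem.2 ⟨hmem, fun N hN =>
    (key N hN).trans (key _ hmem).symm⟩⟩

end RegularCyclic

/-! ### Isomorphism types of permutation groups -/

section Types

theorem map_permCongrHom_trans {X Y Z : Type*} (e : X ≃ Y) (f : Y ≃ Z)
    (G : Subgroup (Equiv.Perm X)) :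
    G.map (e.trans f).permCongrHom.toMonoidHom =
      (G.map e.permCongrHom.toMonoidHom).map f.permCongrHom.toMonoidHom := by
  rw [Subgroup.map_map]
  rfl

theorem IsTransSubgroup.map {X Y : Type*} (e : X ≃ Y) {G : Subgroup (Equiv.Perm X)}
    (hG : IsTransSubgroup G) : IsTransSubgroup (G.map e.permCongrHom.toMonoidHom) := by
  intro x y
  obtain ⟨g, hg, h⟩ := hG (e.symm x) (e.symm y)
  refine ⟨_, ⟨g, hg, rfl⟩, ?_⟩
  change e (g (e.symm x)) = y
  rw [h, e.apply_symm_apply]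

theorem TransPermGroup.isTransSubgroup {n : ℕ} (G : TransPermGroup n) : IsTransSubgroup G.1 := by
  intro x y
  obtain ⟨g, hg⟩ := G.2.exists_smul_eq x y
  exact ⟨g.1, g.2, hg⟩

/-- The transitive group on `n` letters given by a transitive group on a set of `n` elements. -/
def TransPermGroup.ofSubgroup {n : ℕ} {X : Type*} (e : X ≃ Fin n) (G : Subgroup (Equiv.Perm X))
    (hG : IsTransSubgroup G) : TransPermGroup n :=
  ⟨G.map e.permCongrHom.toMonoidHom, ⟨fun x y => by
    obtain ⟨g, hg, h⟩ := hG.map e x y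
    exact ⟨⟨g, hg⟩, h⟩⟩⟩

theorem TransPermGroup.isom_iff {n : ℕ} {G H : TransPermGroup n} :
    G.Isom H ↔ ∃ f : Fin n ≃ Fin n, G.1.map f.permCongrHom.toMonoidHom = H.1 := by
  constructor
  · rintro ⟨θ, f, h⟩
    have key : ∀ g : G.1, f.permCongrHom g.1 = (θ g).1 := by
      intro g
      ext1 x
      change f (g.1 (f.symm x)) = _
      refine (h g (f.symm x)).trans ?_
      rw [f.apply_symm_apply]
      rfl
    refine ⟨f, ?_⟩
    ext g
    constructor
    · rintro ⟨g, hg, rfl⟩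
      have := key ⟨g, hg⟩
      change f.permCongrHom g ∈ _
      rw [this]
      exact (θ _).2
    · intro hg
      refine ⟨(θ.symm ⟨g, hg⟩).1, (θ.symm ⟨g, hg⟩).2, (key _).trans ?_⟩
      rw [θ.apply_symm_apply]
  · rintro ⟨f, hf⟩
    refine ⟨(G.1.equivMapOfInjective f.permCongrHom.toMonoidHom
      f.permCongrHom.injective).trans (MulEquiv.subgroupCongr hf), f, fun g x => ?_⟩
    change f (g.1 x) = f (g.1 (f.symm (f x)))
    rw [f.symm_apply_apply]

variable {p q : ℕ}

/-- The transitive groups of affine permutations of `ZMod p × ZMod q`, up to isomorphism. -/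
def modelGroup (χ : Multiplicative (ZMod q) →* (ZMod p)ˣ) :
    Subgroup ((ZMod p)ˣ × (ZMod q)ˣ) ⊕ Bool → Subgroup (Equiv.Perm (ZMod p × ZMod q))
  | .inl A => holGroup p q A
  | .inr false => excGroup χ ⊥
  | .inr true => excGroup χ (Subgroup.zpowers (-1))

theorem modelGroup_le (χ : Multiplicative (ZMod q) →* (ZMod p)ˣ)
    (m : Subgroup ((ZMod p)ˣ × (ZMod q)ˣ) ⊕ Bool) : modelGroup χ m ≤ holGroup p q ⊤ := by
  rcases m with A | _ | _
  · rintro _ ⟨a, b, c, d, -, rfl⟩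
    exact aff_mem_holGroup.2 trivial
  · exact excGroup_le_holGroup χ _
  · exact excGroup_le_holGroup χ _

theorem isTransSubgroup_modelGroup (χ : Multiplicative (ZMod q) →* (ZMod p)ˣ)
    (m : Subgroup ((ZMod p)ˣ × (ZMod q)ˣ) ⊕ Bool) : IsTransSubgroup (modelGroup χ m) := by
  rcases m with A | _ | _
  · exact isRegularSubgroup_translGroup.isTrans.mono (translGroup_le_holGroup A)
  · exact (isRegularSubgroup_excGroup_bot χ).isTrans
  · exact (isRegularSubgroup_excGroup_bot χ).isTrans.mono (excGroup_mono χ bot_le)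

/-- Each of the groups contains a regular normal subgroup. -/
theorem exists_normal_modelGroup (χ : Multiplicative (ZMod q) →* (ZMod p)ˣ)
    (m : Subgroup ((ZMod p)ˣ × (ZMod q)ˣ) ⊕ Bool) : ∃ C ≤ modelGroup χ m, IsRegularSubgroup C ∧
      ∀ g ∈ modelGroup χ m, ∀ c ∈ C, g * c * g⁻¹ ∈ C := by
  rcases m with A | _ | _
  · refine ⟨translGroup p q, translGroup_le_holGroup A, isRegularSubgroup_translGroup, ?_⟩
    rintro _ ⟨a, b, c, d, -, rfl⟩ n hn
    exact conj_mem_translGroup a b c d hn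
  · exact ⟨_, le_rfl, isRegularSubgroup_excGroup_bot χ, fun g hg c hc =>
      conj_mem_excGroup_bot hg hc⟩
  · exact ⟨_, excGroup_mono χ bot_le, isRegularSubgroup_excGroup_bot χ, fun g hg c hc =>
      conj_mem_excGroup_bot hg hc⟩

variable [Fact p.Prime] [Fact q.Prime]

theorem zpowers_neg_one_ne_bot (hp : 3 ≤ p) : Subgroup.zpowers (-1 : (ZMod p)ˣ) ≠ ⊥ := by
  rw [Ne, Subgroup.zpowers_eq_bot]
  intro h
  have : Fact (2 < p) := ⟨hp⟩
  exact ZMod.neg_one_ne_one (congrArg Units.val h)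

theorem sq_eq_one_of_mem_zpowers_neg_one {a : (ZMod p)ˣ}
    (ha : a ∈ Subgroup.zpowers (-1 : (ZMod p)ˣ)) : a ^ 2 = 1 := by
  obtain ⟨k, rfl⟩ := ha
  change ((-1 : (ZMod p)ˣ) ^ k) ^ 2 = 1
  rw [← zpow_natCast, zpow_comm]
  simp

theorem eq_bot_or_eq_zpowers_neg_one {A : Subgroup (ZMod p)ˣ} (hA : ∀ a ∈ A, a ^ 2 = 1) :
    A = ⊥ ∨ A = Subgroup.zpowers (-1) := by
  have key : ∀ a ∈ A, a = 1 ∨ a = -1 := by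
    intro a ha
    have := congrArg Units.val (hA a ha)
    rw [Units.val_pow_eq_pow_val, Units.val_one, sq_eq_one_iff] at this
    exact this.imp (fun h => Units.ext h) (fun h => Units.ext h)
  by_cases h : -1 ∈ A
  · right
    refine le_antisymm (fun a ha => ?_) (by simpa using h)
    rcases key a ha with rfl | rfl
    · exact one_mem _
    · exact Subgroup.mem_zpowers _
  · left
    rw [eq_bot_iff]
    intro a ha
    rcases key a ha with rfl | rfl
    · exact one_mem _
    · exact absurd ha h

theorem exists_map_eq_modelGroup_of_le (hq3 : 3 ≤ q) (hpq : p = 2 * q + 1)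
    {χ : Multiplicative (ZMod q) →* (ZMod p)ˣ} (hχ : χ ≠ 1)
    {G : Subgroup (Equiv.Perm (ZMod p × ZMod q))} (hG : IsTransSubgroup G)
    (hle : G ≤ holGroup p q ⊤) :
    ∃ (f : (ZMod p × ZMod q) ≃ (ZMod p × ZMod q)) (m : _),
      G.map f.permCongrHom.toMonoidHom = modelGroup χ m := by
  by_cases h : translGroup p q ≤ G
  · obtain ⟨A, hA⟩ := exists_eq_holGroup_of_translGroup_le hle h
    refine ⟨Equiv.refl _, .inl A, ?_⟩
    rw [hA]
    exact Subgroup.map_id _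
  · obtain ⟨χ', A, hχ', hA, rfl⟩ := exists_eq_excGroup hq3 hpq hle hG h
    obtain ⟨f, hf⟩ := exists_map_excGroup_eq hχ' hχ A
    rcases eq_bot_or_eq_zpowers_neg_one hA with rfl | rfl
    · exact ⟨f, .inr false, hf⟩
    · exact ⟨f, .inr true, hf⟩

/-- A transitive group which normalises a regular cyclic group is isomorphic to one of the
groups `modelGroup χ m`. -/
theorem exists_map_eq_modelGroup (hq3 : 3 ≤ q) (hpq : p = 2 * q + 1)
    {χ : Multiplicative (ZMod q) →* (ZMod p)ˣ} (hχ : χ ≠ 1) {X : Type*} [Nonempty X]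
    {G : Subgroup (Equiv.Perm X)} (hG : IsTransSubgroup G)
    (hne : (regularSet G (Cyc (p * q))).Nonempty) :
    ∃ (f : X ≃ (ZMod p × ZMod q)) (m : _),
      G.map f.permCongrHom.toMonoidHom = modelGroup χ m := by
  obtain ⟨N, hN⟩ := hne
  obtain ⟨f, -, hle⟩ := exists_equiv_map_le_holGroup (coprime_of_eq hpq) hN
  obtain ⟨f', m, h⟩ := exists_map_eq_modelGroup_of_le hq3 hpq hχ (hG.map f) hle
  exact ⟨f.trans f', m, by rw [map_permCongrHom_trans, h]⟩

/-- The translation group is the only regular cyclic group normalised on either side, so `f`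
normalises it and is affine. Conjugation by an affine map keeps linear parts because the units
commute. -/
theorem holGroup_eq_of_map_eq (hpq : p = 2 * q + 1) {A A' : Subgroup ((ZMod p)ˣ × (ZMod q)ˣ)}
    {f : (ZMod p × ZMod q) ≃ (ZMod p × ZMod q)}
    (h : (holGroup p q A).map f.permCongrHom.toMonoidHom = holGroup p q A') : A = A' := by
  have h1 : (translGroup p q).map f.permCongrHom.toMonoidHom = translGroup p q := by
    have := map_mem_regularSet f (N := translGroup p q)
      (P := holGroup p q A) (N₀ := Cyc (p * q)) (by rw [regularSet_holGroup hpq]; rfl)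
    rw [h, regularSet_holGroup hpq] at this
    exact this
  obtain ⟨a, b, c, d, rfl⟩ := exists_eq_aff_of_normalises (coprime_of_eq hpq) (g := f)
    (fun n hn => h1.le ⟨n, hn, rfl⟩)
  have key : ∀ a' c', ∃ b' d',
      (aff a b c d).permCongrHom (aff a' 0 c' 0) = aff a' b' c' d' := by
    intro a' c'
    have : (aff a b c d).permCongrHom (aff a' 0 c' 0) =
      aff a b c d * aff a' 0 c' 0 * (aff a b c d)⁻¹ := rfl
    rw [this, aff_inv, aff_mul, aff_mul, mul_comm a a', mul_inv_cancel_right, mul_comm c c',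
      mul_inv_cancel_right]
    exact ⟨_, _, rfl⟩
  ext ⟨a', c'⟩
  obtain ⟨b', d', h2⟩ := key a' c'
  rw [← aff_mem_holGroup (b := 0) (d := 0), ← aff_mem_holGroup (A := A') (b := b') (d := d'), ← h2,
    ← h]
  exact (Subgroup.mem_map_iff_mem (aff a b c d).permCongrHom.injective).symm

/-- The image of the translations would be a regular cyclic group of affine maps inside `excGroup χ
B`, hence the translation group, which is not contained there. -/
theorem map_holGroup_ne_excGroup (hq3 : 3 ≤ q) (hpq : p = 2 * q + 1)
    {χ : Multiplicative (ZMod q) →* (ZMod p)ˣ} (hχ : χ ≠ 1)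
    {A : Subgroup ((ZMod p)ˣ × (ZMod q)ˣ)} {B : Subgroup (ZMod p)ˣ} (hB : ∀ a ∈ B, a ^ 2 = 1)
    (f : (ZMod p × ZMod q) ≃ (ZMod p × ZMod q)) :
    (holGroup p q A).map f.permCongrHom.toMonoidHom ≠ excGroup χ B := by
  intro h
  have hle : (translGroup p q).map f.permCongrHom.toMonoidHom ≤ excGroup χ B :=
    h ▸ Subgroup.map_mono (translGroup_le_holGroup A)
  have h1 := map_mem_regularSet f
    (translGroup_mem_regularSet (coprime_of_eq hpq) (translGroup_le_holGroup (p := p) (q := q) ⊤))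
  have := eq_translGroup_of_le hpq (hle.trans (excGroup_le_holGroup χ B)) h1.1 h1.2.1.some
  exact not_translGroup_le_excGroup hq3 hχ hB (this ▸ hle)

theorem isRegularSubgroup_modelGroup_iff (hp : 3 ≤ p) {χ : Multiplicative (ZMod q) →* (ZMod p)ˣ}
    {m : Subgroup ((ZMod p)ˣ × (ZMod q)ˣ) ⊕ Bool} :
    IsRegularSubgroup (modelGroup χ m) ↔ m = .inl ⊥ ∨ m = .inr false := by
  constructor
  · intro h
    rcases m with A | _ | _
    · exact Or.inl (by rw [eq_bot_of_isRegularSubgroup_holGroup h])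
    · exact Or.inr rfl
    · exact absurd (eq_bot_of_isRegularSubgroup_excGroup h) (zpowers_neg_one_ne_bot hp)
  · rintro (rfl | rfl)
    · change IsRegularSubgroup (holGroup p q ⊥)
      rw [holGroup_bot]
      exact isRegularSubgroup_translGroup
    · exact isRegularSubgroup_excGroup_bot χ

/-- Containing a regular cyclic group separates the two families, and regularity separates the two
exceptional groups. -/
theorem modelGroup_eq_of_map_eq (hq3 : 3 ≤ q) (hpq : p = 2 * q + 1)
    {χ : Multiplicative (ZMod q) →* (ZMod p)ˣ} (hχ : χ ≠ 1)
    {m m' : Subgroup ((ZMod p)ˣ × (ZMod q)ˣ) ⊕ Bool}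
    {f : (ZMod p × ZMod q) ≃ (ZMod p × ZMod q)}
    (h : (modelGroup χ m).map f.permCongrHom.toMonoidHom = modelGroup χ m') : m = m' := by
  have hbot : ∀ a ∈ (⊥ : Subgroup (ZMod p)ˣ), a ^ 2 = 1 := by simp
  have hpm : ∀ a ∈ Subgroup.zpowers (-1 : (ZMod p)ˣ), a ^ 2 = 1 :=
    fun _ => sq_eq_one_of_mem_zpowers_neg_one
  have hexc : ∀ (A : _) (B : Subgroup (ZMod p)ˣ), (∀ a ∈ B, a ^ 2 = 1) →
      (excGroup χ B).map f.permCongrHom.toMonoidHom ≠ holGroup p q A := by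
    intro A B hB hBA
    refine map_holGroup_ne_excGroup hq3 hpq hχ hB f.symm (A := A) ?_
    rw [← hBA, map_permCongrHom_symm]
  have hreg := fun m => isRegularSubgroup_modelGroup_iff (p := p) (q := q) (χ := χ) (m := m)
    (by omega)
  have hfalse : IsRegularSubgroup (modelGroup χ (.inr false)) := (hreg _).2 (Or.inr rfl)
  have htrue : ¬ IsRegularSubgroup (modelGroup χ (.inr true)) := by
    rw [hreg]
    simp
  rcases m with A | _ | _ <;> rcases m' with A' | _ | _
  · rw [holGroup_eq_of_map_eq hpq h]
  · exact absurd h (map_holGroup_ne_excGroup hq3 hpq hχ hbot f)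
  · exact absurd h (map_holGroup_ne_excGroup hq3 hpq hχ hpm f)
  · exact absurd h (hexc _ _ hbot)
  · rfl
  · exact absurd (h ▸ isRegularSubgroup_map f hfalse) htrue
  · exact absurd h (hexc _ _ hpm)
  · refine absurd ?_ htrue
    have := isRegularSubgroup_map f.symm hfalse
    rwa [← h, map_permCongrHom_symm] at this
  · rfl

theorem exists_char_ne_one (hpq : p = 2 * q + 1) :
    ∃ χ : Multiplicative (ZMod q) →* (ZMod p)ˣ, χ ≠ 1 := by
  have hdvd : q ∣ Nat.card (ZMod p)ˣ := by
    rw [Nat.card_eq_fintype_card, ZMod.card_units, hpq, Nat.add_sub_cancel]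
    exact dvd_mul_left _ _
  obtain ⟨u, hu⟩ := exists_prime_orderOf_dvd_card' q hdvd
  obtain ⟨χ, hχ⟩ := exists_zmod_hom (orderOf_dvd_iff_pow_eq_one.1 hu.dvd)
  refine ⟨χ, ?_⟩
  rintro rfl
  rw [MonoidHom.one_apply] at hχ
  rw [← hχ, orderOf_one] at hu
  exact (Fact.out : q.Prime).one_lt.ne hu

end Types

/-! ### Regular groups of degree `p q` -/

section RegularDegree

variable {p q : ℕ} [Fact p.Prime] [Fact q.Prime]

/-- In suitable coordinates, a regular group of degree `p q` consists of affine permutations. -/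
theorem exists_map_le_holGroup_of_isRegularSubgroup (hpq : p = 2 * q + 1) {X : Type*}
    (hX : Nat.card X = p * q) {G : Subgroup (Equiv.Perm X)} (hG : IsRegularSubgroup G) :
    ∃ f : X ≃ ZMod p × ZMod q, G.map f.permCongrHom.toMonoidHom ≤ holGroup p q ⊤ := by
  have hp : p.Prime := Fact.out
  have hq : q.Prime := Fact.out
  have hpos : 0 < Nat.card X := hX ▸ Nat.mul_pos hp.pos hq.pos
  have : Nonempty X := (Nat.card_pos_iff.1 hpos).1
  have : Finite X := (Nat.card_pos_iff.1 hpos).2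
  obtain ⟨x₀⟩ := ‹Nonempty X›
  have hcard : Nat.card G = p * q := by
    rw [← hX]
    refine Nat.card_eq_of_bijective (fun g : G => g.1 x₀) ⟨fun g g' h => ?_, fun y => ?_⟩
    · exact (hG x₀ (g'.1 x₀)).unique h rfl
    · obtain ⟨g, hg, -⟩ := hG x₀ y
      exact ⟨g, hg⟩
  obtain ⟨σ, hσ⟩ := exists_prime_orderOf_dvd_card' (G := G) p (hcard ▸ dvd_mul_right _ _)
  obtain ⟨t, ht⟩ := exists_prime_orderOf_dvd_card' (G := G) q (hcard ▸ dvd_mul_left _ _)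
  -- Its index is `q`, the smallest prime factor of the group order.
  have hnormal : (Subgroup.zpowers σ).Normal := by
    apply Subgroup.normal_of_index_eq_minFac_card
    have hidx := (Subgroup.zpowers σ).card_mul_index
    rw [Nat.card_zpowers, hσ, hcard] at hidx
    rw [Nat.eq_of_mul_eq_mul_left hp.pos hidx, hcard]
    have hprime : (p * q).minFac.Prime := Nat.minFac_prime
      (Nat.one_lt_mul_iff.2 ⟨hp.pos, hq.pos, Or.inl hp.one_lt⟩).ne'
    have hle : (p * q).minFac ≤ q := Nat.minFac_le_of_dvd hq.two_le (dvd_mul_left _ _)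
    rcases hprime.dvd_mul.1 (Nat.minFac_dvd (p * q)) with h | h
    · have := (Nat.prime_dvd_prime_iff_eq hprime hp).1 h
      omega
    · exact ((Nat.prime_dvd_prime_iff_eq hprime hq).1 h).symm
  obtain ⟨S, hS⟩ := exists_zmod_hom (orderOf_dvd_iff_pow_eq_one.1 hσ.dvd)
  obtain ⟨T, hT⟩ := exists_zmod_hom (orderOf_dvd_iff_pow_eq_one.1 ht.dvd)
  have hS1 : S ≠ 1 := by
    rintro rfl
    rw [MonoidHom.one_apply] at hS
    rw [← hS, orderOf_one] at hσ
    exact hp.one_lt.ne hσ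
  have hT1 : T ≠ 1 := by
    rintro rfl
    rw [MonoidHom.one_apply] at hT
    rw [← hT, orderOf_one] at ht
    exact hq.one_lt.ne ht
  obtain ⟨k, hk⟩ : ∃ k : ZMod p, t * σ * t⁻¹ = S (.ofAdd k) := by
    obtain ⟨i, hi⟩ := hnormal.conj_mem σ (Subgroup.mem_zpowers σ) t
    refine ⟨i, hi.symm.trans ?_⟩
    change σ ^ i = _
    rw [← hS, ← map_zpow, ← ofAdd_zsmul]
    simp
  have hconj : ∀ x, t * S (.ofAdd x) = S (.ofAdd (k * x)) * t := by
    intro x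
    rw [← mul_inv_eq_iff_eq_mul, char_apply_eq_pow S x, ← conj_pow, hS, hk, ← map_pow,
      ← ofAdd_nsmul]
    simp [mul_comm]
  have hk0 : k ≠ 0 := by
    rintro rfl
    rw [ofAdd_zero, map_one, mul_inv_eq_one] at hk
    rw [mul_eq_left.1 hk, orderOf_one] at hσ
    exact hp.one_lt.ne hσ
  -- In the coordinates `σ ^ x * t ^ y`, left multiplication by `σ` is `x ↦ x + 1` and by `t` is
  -- `(x, y) ↦ (k x, y + 1)`.
  let g : ZMod p × ZMod q → X := fun v => (S (.ofAdd v.1) * T (.ofAdd v.2)).1 x₀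
  have hinj : Function.Injective g := by
    intro v w hvw
    have h1 : S (.ofAdd v.1) * T (.ofAdd v.2) = S (.ofAdd w.1) * T (.ofAdd w.2) :=
      (hG x₀ (g w)).unique hvw rfl
    -- This common element has order dividing both `p` and `q`, so it is trivial.
    have h2 : S (.ofAdd (v.1 - w.1)) = T (.ofAdd (w.2 - v.2)) := by
      rw [show v.1 - w.1 = -w.1 + v.1 by ring, sub_eq_add_neg, ofAdd_add, ofAdd_add, ofAdd_neg,
        ofAdd_neg, map_mul, map_mul, map_inv, map_inv, inv_mul_eq_iff_eq_mul, ← mul_assoc,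
        eq_mul_inv_iff_mul_eq]
      exact h1
    have h3 : S (.ofAdd (v.1 - w.1)) = 1 := eq_one_of_pow_eq_one_of_coprime
      (char_pow_eq_one S _) (h2 ▸ char_pow_eq_one T _) (coprime_of_eq hpq)
    have h4 : v.1 - w.1 = 0 := by
      by_contra h
      exact char_ne_one hS1 h h3
    have h5 : w.2 - v.2 = 0 := by
      by_contra h
      exact char_ne_one hT1 h (h2 ▸ h3)
    exact Prod.ext (sub_eq_zero.1 h4) (sub_eq_zero.1 h5).symm
  have hbij : Function.Bijective g := (Nat.bijective_iff_injective_and_card g).2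
    ⟨hinj, by rw [hX, Nat.card_prod, Nat.card_zmod, Nat.card_zmod]⟩
  let f := (Equiv.ofBijective g hbij).symm
  have hfg : ∀ v, f (g v) = v := fun v => (Equiv.ofBijective g hbij).symm_apply_apply v
  have hfS : ∀ b, f.permCongrHom (S (.ofAdd b)).1 = aff 1 b 1 0 := by
    intro b
    ext1 v
    change f ((S (.ofAdd b)).1 (g v)) = _
    have : (S (.ofAdd b)).1 (g v) = g (v.1 + b, v.2) := by
      simp only [g]
      rw [← Equiv.Perm.mul_apply, ← Subgroup.coe_mul, ← mul_assoc, ← map_mul, ← ofAdd_add,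
        add_comm]
    rw [this, hfg]
    simp
  have hft : f.permCongrHom t.1 = aff (Units.mk0 k hk0) 0 1 1 := by
    ext1 v
    change f (t.1 (g v)) = _
    have : t.1 (g v) = g (k * v.1, v.2 + 1) := by
      simp only [g]
      rw [← Equiv.Perm.mul_apply, ← Subgroup.coe_mul, ← mul_assoc, hconj, mul_assoc]
      nth_rw 1 [← hT]
      rw [← map_mul, ← ofAdd_add, add_comm]
    rw [this, hfg]
    simp
  refine ⟨f, ?_⟩
  rintro _ ⟨h, hh, rfl⟩
  obtain ⟨v, hv⟩ := hbij.2 (h x₀)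
  have h1 : (⟨h, hh⟩ : G) = S (.ofAdd v.1) * t ^ v.2.val := by
    rw [← hT, ← char_apply_eq_pow]
    exact (hG x₀ (h x₀)).unique rfl hv
  have h2 : h = (S (.ofAdd v.1)).1 * t.1 ^ v.2.val := congrArg Subtype.val h1
  change f.permCongrHom h ∈ _
  rw [h2, map_mul, map_pow, hfS, hft]
  exact mul_mem (aff_mem_holGroup.2 (Subgroup.mem_top _))
    (pow_mem (aff_mem_holGroup.2 (Subgroup.mem_top _)) _)

theorem not_commute_excGroup_bot {χ : Multiplicative (ZMod q) →* (ZMod p)ˣ} (hχ : χ ≠ 1) :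
    ∃ g ∈ excGroup χ ⊥, ∃ h ∈ excGroup χ ⊥, g * h ≠ h * g := by
  refine ⟨aff (χ (.ofAdd 1)) 0 1 1, aff_mem_excGroup.2 ⟨rfl, by simp⟩, aff 1 1 1 0,
    aff_mem_excGroup.2 ⟨rfl, by simp⟩, fun h => ?_⟩
  rw [aff_mul, aff_mul, aff_inj] at h
  refine char_ne_one hχ one_ne_zero (Units.ext ?_)
  simpa using h.2.1

end RegularDegree

/-! ### Counting subgroups -/

section SubgroupCount

theorem card_subgroup_congr {G G' : Type*} [Group G] [Group G'] (e : G ≃* G') :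
    Nat.card (Subgroup G) = Nat.card (Subgroup G') :=
  Nat.card_congr e.mapSubgroup.toEquiv

/-- A subgroup of a product of groups of coprime orders is a product of subgroups. -/
theorem card_subgroup_prod_of_coprime {G G' : Type*} [Group G] [Group G'] [Finite G] [Finite G']
    (h : (Nat.card G).Coprime (Nat.card G')) :
    Nat.card (Subgroup (G × G')) = Nat.card (Subgroup G) * Nat.card (Subgroup G') := by
  rw [← Nat.card_prod]
  symm
  refine Nat.card_eq_of_bijective (fun x => x.1.prod x.2) ⟨fun x y hxy => ?_, fun H => ?_⟩
  · have hxy' : x.1.prod x.2 = y.1.prod y.2 := hxy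
    ext a
    · have := SetLike.ext_iff.1 hxy' (a, 1)
      simpa [Subgroup.mem_prod] using this
    · have := SetLike.ext_iff.1 hxy' (1, a)
      simpa [Subgroup.mem_prod] using this
  -- The `k`-th and `l`-th powers are the projections to the two factors, so a subgroup contains the
  -- components of its elements.
  · obtain ⟨k, hk, hk'⟩ := Nat.chineseRemainder h 1 0
    obtain ⟨l, hl, hl'⟩ := Nat.chineseRemainder h 0 1
    refine ⟨(H.map (MonoidHom.fst G G'), H.map (MonoidHom.snd G G')), ?_⟩
    ext ⟨a, b⟩
    constructor
    · rintro ⟨⟨⟨a, b'⟩, hb', rfl⟩, ⟨⟨a', b⟩, ha', rfl⟩⟩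
      have h1 := H.mul_mem (H.pow_mem hb' k) (H.pow_mem ha' l)
      have ha1 : a ^ k = a := by
        have := pow_eq_pow_iff_modEq.2 (hk.of_dvd (orderOf_dvd_natCard a))
        rwa [pow_one] at this
      have hb1 : b' ^ k = 1 := by
        have := pow_eq_pow_iff_modEq.2 (hk'.of_dvd (orderOf_dvd_natCard b'))
        rwa [pow_zero] at this
      have ha2 : a' ^ l = 1 := by
        have := pow_eq_pow_iff_modEq.2 (hl.of_dvd (orderOf_dvd_natCard a'))
        rwa [pow_zero] at this
      have hb2 : b ^ l = b := by
        have := pow_eq_pow_iff_modEq.2 (hl'.of_dvd (orderOf_dvd_natCard b))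
        rwa [pow_one] at this
      rw [Prod.pow_mk, Prod.pow_mk, Prod.mk_mul_mk, ha1, hb1, ha2, hb2, mul_one, one_mul] at h1
      exact h1
    · exact fun hab => ⟨⟨_, hab, rfl⟩, ⟨_, hab, rfl⟩⟩

/-- A subgroup of order `m` lies in the solution set of `a ^ m = 1`, which has at most `m` elements
in a cyclic group, so it is that set. -/
theorem eq_of_card_eq_of_isCyclic {G : Type*} [Group G] [Finite G] [IsCyclic G]
    {H H' : Subgroup G} (h : Nat.card H = Nat.card H') : H = H' := by
  classical
  have := Fintype.ofFinite G
  have key : ∀ K : Subgroup G,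
      (K : Set G) = ((Finset.univ.filter fun a : G => a ^ Nat.card K = 1 : Finset G) : Set G) := by
    intro K
    refine Set.eq_of_subset_of_ncard_le (fun x hx => ?_) ?_
    · have := pow_card_eq_one' (x := (⟨x, hx⟩ : K))
      rw [Finset.coe_filter]
      exact ⟨Finset.mem_univ _, congrArg Subtype.val this⟩
    · rw [Set.ncard_coe_finset]
      exact IsCyclic.card_pow_eq_one_le Nat.card_pos
  apply SetLike.coe_injective
  rw [key H, key H', h]

theorem exists_subgroup_card_eq {G : Type*} [Group G] [Finite G] [IsCyclic G] {d : ℕ}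
    (hd : d ∣ Nat.card G) : ∃ H : Subgroup G, Nat.card H = d := by
  obtain ⟨g, hg⟩ := IsCyclic.exists_ofOrder_eq_natCard (α := G)
  obtain ⟨k, hk⟩ := hd
  have hpos : 0 < Nat.card G := Nat.card_pos
  have hk0 : k ≠ 0 := by
    rintro rfl
    omega
  refine ⟨Subgroup.zpowers (g ^ k), ?_⟩
  rw [Nat.card_zpowers, orderOf_pow_of_dvd hk0 (hg ▸ hk ▸ dvd_mul_left _ _), hg, hk,
    Nat.mul_div_cancel _ (Nat.pos_of_ne_zero hk0)]

theorem sum_subgroup_of_isCyclic {G : Type*} [Group G] [Finite G] [IsCyclic G]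
    [Fintype (Subgroup G)] (f : ℕ → ℕ) :
    ∑ H : Subgroup G, f (Nat.card H) = ∑ d ∈ (Nat.card G).divisors, f d := by
  refine Finset.sum_bij (fun H _ => Nat.card H) (fun H _ => ?_) (fun H _ H' _ h => ?_)
    (fun d hd => ?_) (fun _ _ => rfl)
  · exact Nat.mem_divisors.2 ⟨Subgroup.card_subgroup_dvd_card H, Nat.card_pos.ne'⟩
  · exact eq_of_card_eq_of_isCyclic h
  · obtain ⟨H, hH⟩ := exists_subgroup_card_eq (Nat.dvd_of_mem_divisors hd)
    exact ⟨H, Finset.mem_univ _, hH⟩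

theorem card_subgroup_of_isCyclic {G : Type*} [Group G] [Finite G] [IsCyclic G] :
    Nat.card (Subgroup G) = (Nat.card G).divisors.card := by
  have := Fintype.ofFinite (Subgroup G)
  have := sum_subgroup_of_isCyclic (G := G) fun _ => 1
  rwa [Finset.sum_const, Finset.sum_const, smul_eq_mul, smul_eq_mul, mul_one, mul_one,
    Finset.card_univ, ← Nat.card_eq_fintype_card] at this

variable {Z : Type*} [Group Z]

/-- A homomorphism is determined by its value at a generator, so there are at most two; a
non-trivial one exists when the order is even, and coprimality excludes it when the order is odd. -/
theorem card_monoidHom_of_card_eq_two (hZ : Nat.card Z = 2) {P : Type*} [Group P] [Finite P]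
    [hP : IsCyclic P] : Nat.card (P →* Z) = if Even (Nat.card P) then 2 else 1 := by
  have hfin : Finite Z := Nat.finite_of_card_ne_zero (by rw [hZ]; norm_num)
  have : Fact (Nat.Prime 2) := ⟨Nat.prime_two⟩
  have hZc : IsCyclic Z := isCyclic_of_prime_card hZ
  split_ifs with h
  · obtain ⟨g, hg⟩ := hP.exists_generator
    have hinj : Function.Injective fun φ : P →* Z => φ g := by
      intro φ ψ h
      refine MonoidHom.ext fun x => ?_
      obtain ⟨k, rfl⟩ := hg x
      change φ (g ^ k) = ψ (g ^ k)
      rw [map_zpow, map_zpow, show φ g = ψ g from h]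
    have hle := Nat.card_le_card_of_injective _ hinj
    rw [hZ] at hle
    have hfinHom : Finite (P →* Z) := Finite.of_injective _ hinj
    refine le_antisymm hle ?_
    obtain ⟨w, hw⟩ := IsCyclic.exists_ofOrder_eq_natCard (α := Z)
    rw [hZ] at hw
    obtain ⟨χ, hχ⟩ := exists_zmod_hom (M := Z) (u := w) (n := Nat.card P)
      (orderOf_dvd_iff_pow_eq_one.1 (hw ▸ h.two_dvd))
    let e := zmodCyclicMulEquiv hP
    have : Nontrivial (P →* Z) := by
      refine ⟨⟨χ.comp e.symm.toMonoidHom, 1, fun h => ?_⟩⟩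
      have := DFunLike.congr_fun h (e (.ofAdd 1))
      simp only [MonoidHom.comp_apply, MulEquiv.coe_toMonoidHom, MulEquiv.symm_apply_apply,
        MonoidHom.one_apply] at this
      rw [← hχ, this, orderOf_one] at hw
      omega
    exact Finite.one_lt_card
  · have : Unique (P →* Z) := ⟨⟨1⟩, fun φ => MonoidHom.ext fun x =>
      eq_one_of_pow_eq_one_of_coprime (m := 2) (n := Nat.card P)
        (by rw [← hZ]; exact pow_card_eq_one') (by rw [← map_pow, pow_card_eq_one', map_one])
        ((Nat.coprime_two_left).2 (Nat.not_even_iff_odd.1 h))⟩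
    exact Nat.card_unique

/-- The subgroups of `Z × B`, with `Z` of order `2`, are the products `Z × P` and the graphs of
homomorphisms `P → Z`, for the subgroups `P` of `B`. -/
theorem card_subgroup_prod_of_card_eq_two (hZ : Nat.card Z = 2) {B : Type*} [Group B] [Finite B] :
    Nat.card (Subgroup (Z × B)) = Nat.card (Subgroup B ⊕ Σ P : Subgroup B, (P →* Z)) := by
  have hfin : Finite Z := Nat.finite_of_card_ne_zero (by rw [hZ]; norm_num)
  obtain ⟨z, hz⟩ : ∃ z : Z, z ≠ 1 := by
    have : Nontrivial Z := Finite.one_lt_card_iff_nontrivial.1 (by rw [hZ]; norm_num)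
    exact exists_ne 1
  let F : (Subgroup B ⊕ Σ P : Subgroup B, (P →* Z)) → Subgroup (Z × B) :=
    Sum.elim (fun P => (⊤ : Subgroup Z).prod P) (fun x => (x.2.prod x.1.subtype).range)
  have hne : ∀ (P : Subgroup B) (x : Σ P : Subgroup B, (P →* Z)),
      (⊤ : Subgroup Z).prod P ≠ (x.2.prod x.1.subtype).range := by
    intro P x h
    have h1 : (z, (1 : B)) ∈ (⊤ : Subgroup Z).prod P :=
      Subgroup.mem_prod.2 ⟨Subgroup.mem_top _, P.one_mem⟩
    rw [h] at h1
    obtain ⟨y, hy⟩ := h1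
    obtain ⟨h2, h3⟩ := Prod.mk.inj hy
    rw [show y = 1 from Subtype.ext h3, map_one] at h2
    exact hz h2.symm
  symm
  refine Nat.card_eq_of_bijective F ⟨?_, fun H => ?_⟩
  · rintro (P | ⟨P, φ⟩) (P' | ⟨P', φ'⟩) h
    · have h' : (⊤ : Subgroup Z).prod P = (⊤ : Subgroup Z).prod P' := h
      congr 1
      ext b
      have := SetLike.ext_iff.1 h' (1, b)
      simpa [Subgroup.mem_prod] using this
    · exact absurd h (hne _ _)
    · exact absurd h.symm (hne _ _)
    · have h' : (φ.prod P.subtype).range = (φ'.prod P'.subtype).range := h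
      have hP : P = P' := by
        have := congrArg (Subgroup.map (MonoidHom.snd Z B)) h'
        rwa [MonoidHom.map_range, MonoidHom.map_range, MonoidHom.snd_comp_prod,
          MonoidHom.snd_comp_prod, Subgroup.range_subtype, Subgroup.range_subtype] at this
      subst hP
      congr 2
      refine MonoidHom.ext fun x => ?_
      obtain ⟨y, hy⟩ := h'.le ⟨x, rfl⟩
      obtain ⟨h1, h2⟩ := Prod.mk.inj hy
      rw [← h1, show y = x from Subtype.ext h2]
  -- As `Z` has prime order, `H` either contains all of `Z × 1`, and is a product, or meets it
  -- trivially, and is the graph of a map on its projection to `B`.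
  · by_cases hH : ∃ w : Z, w ≠ 1 ∧ (w, (1 : B)) ∈ H
    · obtain ⟨w, hw, hwH⟩ := hH
      have hall : ∀ v : Z, (v, (1 : B)) ∈ H := by
        intro v
        have h1 : Subgroup.zpowers w = ⊤ := by
          have : Fact (Nat.Prime 2) := ⟨Nat.prime_two⟩
          exact zpowers_eq_top_of_prime_card hZ hw
        obtain ⟨k, rfl⟩ := (h1 ▸ Subgroup.mem_top v : v ∈ Subgroup.zpowers w)
        have := H.zpow_mem hwH k
        rwa [Prod.pow_mk, one_zpow] at this
      refine ⟨.inl (H.map (MonoidHom.snd Z B)), ?_⟩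
      ext ⟨v, b⟩
      constructor
      · rintro ⟨-, ⟨v', b⟩, hb, rfl⟩
        have := H.mul_mem (hall (v * v'⁻¹)) hb
        rwa [Prod.mk_mul_mk, inv_mul_cancel_right, one_mul] at this
      · exact fun h => ⟨Subgroup.mem_top _, _, h, rfl⟩
    · push Not at hH
      let s := (MonoidHom.snd Z B).subgroupMap H
      have hs : Function.Bijective s := by
        refine ⟨(injective_iff_map_eq_one s).2 ?_, (MonoidHom.snd Z B).subgroupMap_surjective H⟩
        rintro ⟨⟨v, b⟩, hvb⟩ h
        have hb : b = 1 := congrArg Subtype.val h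
        subst hb
        by_cases hv : v = 1
        · subst hv
          rfl
        · exact absurd hvb (hH v hv)
      let e := MulEquiv.ofBijective s hs
      refine ⟨.inr ⟨H.map (MonoidHom.snd Z B),
        ((MonoidHom.fst Z B).comp H.subtype).comp e.symm.toMonoidHom⟩, ?_⟩
      have key : ∀ x : H, ((((MonoidHom.fst Z B).comp H.subtype).comp e.symm.toMonoidHom).prod
          (H.map (MonoidHom.snd Z B)).subtype) (e x) = x.1 := by
        intro x
        refine Prod.ext ?_ rfl
        change (e.symm (e x)).1.1 = x.1.1
        rw [e.symm_apply_apply]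
      ext v
      constructor
      · rintro ⟨y, rfl⟩
        obtain ⟨x, rfl⟩ := e.surjective y
        rw [key]
        exact x.2
      · exact fun hv => ⟨e ⟨v, hv⟩, key ⟨v, hv⟩⟩

/-- Even divisors count three times and odd ones twice. Of the `(r + 1) σ₀(s)` divisors exactly
`σ₀(s)` are odd, so the total is `3 (r + 1) σ₀(s) - σ₀(s)`. -/
theorem sum_divisors_two_pow_mul (r : ℕ) {s : ℕ} (hs : Odd s) :
    (2 ^ r * s).divisors.card + ∑ d ∈ (2 ^ r * s).divisors, (if Even d then 2 else 1) =
      (3 * r + 2) * s.divisors.card := by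
  have hcop : (2 ^ r).Coprime s := Nat.Coprime.pow_left r (Nat.coprime_two_left.2 hs)
  have hcard : (2 ^ r * s).divisors.card = (r + 1) * s.divisors.card := by
    rw [hcop.card_divisors_mul, ← ArithmeticFunction.sigma_zero_apply (2 ^ r),
      ArithmeticFunction.sigma_zero_apply_prime_pow Nat.prime_two]
  have hodd : (2 ^ r * s).divisors.filter (fun d => ¬ Even d) = s.divisors := by
    ext d
    rw [Finset.mem_filter, Nat.mem_divisors, Nat.mem_divisors, Nat.not_even_iff_odd]
    constructor
    · rintro ⟨⟨h1, -⟩, h2⟩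
      exact ⟨(Nat.Coprime.pow_right r (Nat.coprime_two_right.2 h2)).dvd_of_dvd_mul_left h1,
        hs.pos.ne'⟩
    · rintro ⟨h1, -⟩
      exact ⟨⟨h1.mul_left _, (Nat.mul_pos (by positivity) hs.pos).ne'⟩, hs.of_dvd_nat h1⟩
  have hsum : ∑ d ∈ (2 ^ r * s).divisors, (if Even d then 2 else 1) + s.divisors.card =
      2 * (2 ^ r * s).divisors.card := by
    rw [← hodd, Finset.card_filter, ← Finset.sum_add_distrib, Finset.card_eq_sum_ones,
      Finset.mul_sum]
    refine Finset.sum_congr rfl fun d _ => ?_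
    by_cases h : Even d <;> simp [h]
  rw [hcard] at hsum ⊢
  nlinarith

/-- The factor of order `q` in `(ZMod p)ˣ` is coprime to the remaining order `2 (q - 1)` and doubles
the count; the rest is a product of `C_2` with the cyclic group `(ZMod q)ˣ`. -/
theorem card_subgroup_units {p q r s : ℕ} [Fact p.Prime] [Fact q.Prime] (hq3 : 3 ≤ q)
    (hpq : p = 2 * q + 1) (hs : Odd s) (hrs : q - 1 = 2 ^ r * s) :
    Nat.card (Subgroup ((ZMod p)ˣ × (ZMod q)ˣ)) = (6 * r + 4) * s.divisors.card := by
  have hq : q.Prime := Fact.out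
  have hcq : Nat.card (ZMod q)ˣ = 2 ^ r * s := by
    rw [Nat.card_eq_fintype_card, ZMod.card_units, hrs]
  have hcop : q.Coprime 2 := (Nat.coprime_primes hq Nat.prime_two).2 (by omega)
  let e₁ : (ZMod p)ˣ ≃* Cyc q × Cyc 2 :=
    (mulEquivOfCyclicCardEq (by
      rw [card_cyc, Nat.card_eq_fintype_card, ZMod.card_units, hpq, Nat.add_sub_cancel,
        mul_comm] : Nat.card (ZMod p)ˣ = Nat.card (Cyc (q * 2)))).trans
      ((ZMod.chineseRemainder hcop).toAddEquiv.toMultiplicative.trans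
        (MulEquiv.prodMultiplicative _ _))
  have e : (ZMod p)ˣ × (ZMod q)ˣ ≃* Cyc q × (Cyc 2 × (ZMod q)ˣ) :=
    (e₁.prodCongr (MulEquiv.refl _)).trans MulEquiv.prodAssoc
  have : Fact (Nat.Prime 2) := ⟨Nat.prime_two⟩
  have : Fintype (Subgroup (ZMod q)ˣ) := Fintype.ofFinite _
  have : ∀ P : Subgroup (ZMod q)ˣ, Finite (P →* Cyc 2) := fun P =>
    Finite.of_injective _ DFunLike.coe_injective
  rw [card_subgroup_congr e, card_subgroup_prod_of_coprime, card_subgroup_of_isCyclic, card_cyc,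
    hq.divisors, Finset.card_pair hq.one_lt.ne, card_subgroup_prod_of_card_eq_two (card_cyc 2),
    Nat.card_sum, card_subgroup_of_isCyclic, Nat.card_sigma]
  · simp_rw [card_monoidHom_of_card_eq_two (card_cyc 2)]
    rw [sum_subgroup_of_isCyclic fun d => if Even d then 2 else 1, hcq,
      sum_divisors_two_pow_mul r hs]
    ring
  · rw [card_cyc, Nat.card_prod, card_cyc, hcq, ← hrs]
    exact Nat.Coprime.mul_right hcop (coprime_self_sub_one q)

end SubgroupCount

/-! ### Permutation groups of degree `p q` -/

section Degree

variable {p q : ℕ} [Fact p.Prime] [Fact q.Prime]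

theorem TransPermGroup.isRegular_iff_map {n : ℕ} {X : Type*} {G : TransPermGroup n}
    (f : Fin n ≃ X) :
    G.IsRegular ↔ IsRegularSubgroup (G.1.map f.permCongrHom.toMonoidHom) := by
  constructor
  · exact fun h => isRegularSubgroup_map f h
  · intro h
    have := isRegularSubgroup_map f.symm h
    rwa [map_permCongrHom_symm] at this

/-- A regular group of degree `p q` normalises a regular cyclic group. -/
theorem TransPermGroup.IsRegular.regularSet_nonempty (hpq : p = 2 * q + 1)
    {G : TransPermGroup (p * q)} (hG : G.IsRegular) :
    (regularSet G.1 (Cyc (p * q))).Nonempty := by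
  obtain ⟨f, hf⟩ := exists_map_le_holGroup_of_isRegularSubgroup hpq (Nat.card_fin _)
    (G := G.1) hG
  have := map_mem_regularSet f.symm (translGroup_mem_regularSet (coprime_of_eq hpq) hf)
  rw [map_permCongrHom_symm] at this
  exact ⟨_, this⟩

variable (p q) in
/-- An enumeration of `ZMod p × ZMod q`. -/
def zmodProdEquivFin : ZMod p × ZMod q ≃ Fin (p * q) :=
  Fintype.equivFinOfCardEq (by rw [Fintype.card_prod, ZMod.card, ZMod.card])

/-- The transitive group of degree `p q` given by `modelGroup χ m`. -/
def modelPermGroup (χ : Multiplicative (ZMod q) →* (ZMod p)ˣ)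
    (m : Subgroup ((ZMod p)ˣ × (ZMod q)ˣ) ⊕ Bool) : TransPermGroup (p * q) :=
  TransPermGroup.ofSubgroup (zmodProdEquivFin p q) (modelGroup χ m)
    (isTransSubgroup_modelGroup χ m)

theorem map_modelPermGroup (χ : Multiplicative (ZMod q) →* (ZMod p)ˣ)
    (m : Subgroup ((ZMod p)ˣ × (ZMod q)ˣ) ⊕ Bool) :
    (modelPermGroup χ m).1.map (zmodProdEquivFin p q).symm.permCongrHom.toMonoidHom =
      modelGroup χ m :=
  map_permCongrHom_symm _ _

theorem isRegular_modelPermGroup_iff (hp : 3 ≤ p) {χ : Multiplicative (ZMod q) →* (ZMod p)ˣ}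
    {m : Subgroup ((ZMod p)ˣ × (ZMod q)ˣ) ⊕ Bool} :
    (modelPermGroup χ m).IsRegular ↔ m = .inl ⊥ ∨ m = .inr false := by
  rw [TransPermGroup.isRegular_iff_map (zmodProdEquivFin p q).symm, map_modelPermGroup,
    isRegularSubgroup_modelGroup_iff hp]

theorem regularSet_modelPermGroup_nonempty (hpq : p = 2 * q + 1)
    (χ : Multiplicative (ZMod q) →* (ZMod p)ˣ) (m : Subgroup ((ZMod p)ˣ × (ZMod q)ˣ) ⊕ Bool) :
    (regularSet (modelPermGroup χ m).1 (Cyc (p * q))).Nonempty :=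
  ⟨_, map_mem_regularSet (zmodProdEquivFin p q)
    (translGroup_mem_regularSet (coprime_of_eq hpq) (modelGroup_le χ m))⟩

theorem mk_modelPermGroup_injective (hq3 : 3 ≤ q) (hpq : p = 2 * q + 1)
    {χ : Multiplicative (ZMod q) →* (ZMod p)ˣ} (hχ : χ ≠ 1) :
    Function.Injective fun m =>
      (⟦modelPermGroup χ m⟧ : Quotient (TransPermGroup.setoid (p * q))) := by
  intro m m' h
  obtain ⟨f, hf⟩ := TransPermGroup.isom_iff.1 (Quotient.exact h)
  refine modelGroup_eq_of_map_eq hq3 hpq hχ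
    (f := (zmodProdEquivFin p q).trans (f.trans (zmodProdEquivFin p q).symm)) ?_
  rw [map_permCongrHom_trans, map_permCongrHom_trans]
  change ((modelPermGroup χ m).1.map _).map _ = _
  rw [hf, map_modelPermGroup]

theorem mk_modelPermGroup_eq {χ : Multiplicative (ZMod q) →* (ZMod p)ˣ}
    {G : TransPermGroup (p * q)} {f : Fin (p * q) ≃ ZMod p × ZMod q}
    {m : Subgroup ((ZMod p)ˣ × (ZMod q)ˣ) ⊕ Bool}
    (h : G.1.map f.permCongrHom.toMonoidHom = modelGroup χ m) :
    (⟦modelPermGroup χ m⟧ : Quotient (TransPermGroup.setoid (p * q))) = ⟦G⟧ := by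
  symm
  refine Quotient.sound (TransPermGroup.isom_iff.2 ⟨f.trans (zmodProdEquivFin p q), ?_⟩)
  rw [map_permCongrHom_trans, h]
  rfl

/-- The model groups represent the realised types without repetition; the two extra types are the
exceptional ones. -/
theorem ncard_realised_classes (hq3 : 3 ≤ q) (hpq : p = 2 * q + 1) :
    {c : Quotient (TransPermGroup.setoid (p * q)) | ∃ G : TransPermGroup (p * q), ⟦G⟧ = c ∧
      TransPermGroup.RealisedByType.{u} G (Cyc (p * q))}.ncard =
        Nat.card (Subgroup ((ZMod p)ˣ × (ZMod q)ˣ)) + 2 := by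
  obtain ⟨χ, hχ⟩ := exists_char_ne_one hpq
  have : {c : Quotient (TransPermGroup.setoid (p * q)) | ∃ G : TransPermGroup (p * q), ⟦G⟧ = c ∧
      TransPermGroup.RealisedByType.{u} G (Cyc (p * q))} =
      Set.range fun m => ⟦modelPermGroup χ m⟧ := by
    ext c
    constructor
    · rintro ⟨G, rfl, hG⟩
      obtain ⟨f, m, h⟩ := exists_map_eq_modelGroup hq3 hpq hχ G.isTransSubgroup
        (realisedByType_iff.1 hG)
      exact ⟨m, mk_modelPermGroup_eq h⟩
    · rintro ⟨m, rfl⟩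
      exact ⟨_, rfl, realisedByType_iff.2
        (regularSet_modelPermGroup_nonempty hpq χ m)⟩
  rw [this, ← Set.image_univ,
    Set.ncard_image_of_injective _ (mk_modelPermGroup_injective hq3 hpq hχ),
    Set.ncard_univ, Nat.card_sum, Nat.card_eq_fintype_card (α := Bool), Fintype.card_bool]

/-- Every regular group of degree `p q` normalises a regular cyclic group, so it appears among the
models, exactly two of which are regular. -/
theorem ncard_regular_classes (hq3 : 3 ≤ q) (hpq : p = 2 * q + 1) :
    {c : Quotient (TransPermGroup.setoid (p * q)) | ∃ G : TransPermGroup (p * q), ⟦G⟧ = c ∧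
      G.IsRegular}.ncard = 2 := by
  obtain ⟨χ, hχ⟩ := exists_char_ne_one hpq
  have hp3 : 3 ≤ p := by omega
  have : {c : Quotient (TransPermGroup.setoid (p * q)) | ∃ G : TransPermGroup (p * q), ⟦G⟧ = c ∧
      G.IsRegular} = (fun m => ⟦modelPermGroup χ m⟧) '' {.inl ⊥, .inr false} := by
    ext c
    constructor
    · rintro ⟨G, rfl, hG⟩
      obtain ⟨f, m, h⟩ := exists_map_eq_modelGroup hq3 hpq hχ G.isTransSubgroup
        (hG.regularSet_nonempty hpq)
      refine ⟨m, ?_, mk_modelPermGroup_eq h⟩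
      rw [TransPermGroup.isRegular_iff_map f, h, isRegularSubgroup_modelGroup_iff hp3] at hG
      exact hG
    · rintro ⟨m, hm, rfl⟩
      exact ⟨_, rfl, (isRegular_modelPermGroup_iff hp3).2 hm⟩
  rw [this, Set.ncard_image_of_injective _ (mk_modelPermGroup_injective hq3 hpq hχ),
    Set.ncard_pair Sum.inl_ne_inr]

theorem isCyclic_of_map_eq {n : ℕ} {X : Type*} {G : TransPermGroup n} {f : Fin n ≃ X}
    {H : Subgroup (Equiv.Perm X)} (h : G.1.map f.permCongrHom.toMonoidHom = H) :
    IsCyclic G.1 ↔ IsCyclic H :=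
  ((G.1.equivMapOfInjective f.permCongrHom.toMonoidHom f.permCongrHom.injective).trans
    (MulEquiv.subgroupCongr h)).isCyclic

omit [Fact p.Prime] [Fact q.Prime] in
theorem isCyclic_translGroup (hpq : p = 2 * q + 1) : IsCyclic (translGroup p q) :=
  (nonempty_translGroup_mulEquiv (coprime_of_eq hpq)).some.isCyclic.2 inferInstance

theorem not_isMulCommutative_excGroup_bot {χ : Multiplicative (ZMod q) →* (ZMod p)ˣ}
    (hχ : χ ≠ 1) : ¬ IsMulCommutative (excGroup χ ⊥) := by
  intro h
  obtain ⟨g, hg, g', hg', hne⟩ := not_commute_excGroup_bot hχ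
  exact hne (congrArg Subtype.val (h.is_comm.comm ⟨g, hg⟩ ⟨g', hg'⟩))

theorem isMulCommutative_of_mulEquiv {M M' : Type*} [Group M] [Group M'] (e : M ≃* M')
    (h : IsMulCommutative M) : IsMulCommutative M' :=
  ⟨⟨fun a b => e.symm.injective (by rw [map_mul, map_mul, h.is_comm.comm])⟩⟩

/-- The number of regular cyclic groups normalised by a regular group. -/
theorem ncard_regularSet_of_isRegular (hq3 : 3 ≤ q) (hpq : p = 2 * q + 1)
    {G : TransPermGroup (p * q)} (hG : G.IsRegular) :
    (IsCyclic G.1 → (regularSet G.1 (Cyc (p * q))).ncard = 1) ∧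
      (¬ IsMulCommutative G.1 → (regularSet G.1 (Cyc (p * q))).ncard = p) := by
  obtain ⟨χ, hχ⟩ := exists_char_ne_one hpq
  obtain ⟨f, m, h⟩ := exists_map_eq_modelGroup hq3 hpq hχ G.isTransSubgroup
    (hG.regularSet_nonempty hpq)
  let e := (G.1.equivMapOfInjective f.permCongrHom.toMonoidHom f.permCongrHom.injective).trans
    (MulEquiv.subgroupCongr h)
  rw [TransPermGroup.isRegular_iff_map f, h, isRegularSubgroup_modelGroup_iff (by omega)] at hG
  rw [← ncard_regularSet_map f, h]
  rcases hG with rfl | rfl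
  · refine ⟨fun _ => ?_, fun hc => absurd ?_ hc⟩
    · change (regularSet (holGroup p q ⊥) _).ncard = 1
      rw [regularSet_holGroup hpq, Set.ncard_singleton]
    · have h1 : IsCyclic (modelGroup χ (.inl ⊥)) := by
        change IsCyclic (holGroup p q ⊥)
        rw [holGroup_bot]
        exact isCyclic_translGroup hpq
      have := e.isCyclic.2 h1
      exact IsCyclic.isMulCommutative
  · refine ⟨fun hc => ?_, fun _ => ncard_regularSet_excGroup_bot hq3 hpq hχ⟩
    exact absurd (isMulCommutative_of_mulEquiv e IsCyclic.isMulCommutative)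
      (not_isMulCommutative_excGroup_bot hχ)

theorem ncard_regularSet_of_not_isRegular (hq3 : 3 ≤ q) (hpq : p = 2 * q + 1)
    {G : TransPermGroup (p * q)} (hne : (regularSet G.1 (Cyc (p * q))).Nonempty)
    (hG : ¬ G.IsRegular) : (regularSet G.1 (Cyc (p * q))).ncard = 1 := by
  obtain ⟨χ, hχ⟩ := exists_char_ne_one hpq
  obtain ⟨f, m, h⟩ := exists_map_eq_modelGroup hq3 hpq hχ G.isTransSubgroup hne
  rw [TransPermGroup.isRegular_iff_map f, h, isRegularSubgroup_modelGroup_iff (by omega)] at hG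
  rw [← ncard_regularSet_map f, h]
  rcases m with A | _ | _
  · change (regularSet (holGroup p q A) _).ncard = 1
    rw [regularSet_holGroup hpq, Set.ncard_singleton]
  · exact absurd (Or.inr rfl) hG
  · exact ncard_regularSet_excGroup hq3 hpq hχ (fun _ => sq_eq_one_of_mem_zpowers_neg_one)
      (zpowers_neg_one_ne_bot (by omega))

theorem exists_regular_normal (hq3 : 3 ≤ q) (hpq : p = 2 * q + 1)
    {G : TransPermGroup (p * q)} (hne : (regularSet G.1 (Cyc (p * q))).Nonempty) :
    ∃ C ≤ G.1, IsRegularSubgroup C ∧ ∀ g ∈ G.1, ∀ c ∈ C, g * c * g⁻¹ ∈ C := by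
  obtain ⟨χ, hχ⟩ := exists_char_ne_one hpq
  obtain ⟨f, m, h⟩ := exists_map_eq_modelGroup hq3 hpq hχ G.isTransSubgroup hne
  obtain ⟨C, hle, hreg, hnorm⟩ := exists_normal_modelGroup χ m
  have hG : (modelGroup χ m).map f.symm.permCongrHom.toMonoidHom = G.1 := by
    rw [← h, map_permCongrHom_symm]
  refine ⟨C.map f.symm.permCongrHom.toMonoidHom, hG ▸ Subgroup.map_mono hle,
    isRegularSubgroup_map f.symm hreg, ?_⟩
  rw [← hG]
  rintro _ ⟨g, hg, rfl⟩ _ ⟨c, hc, rfl⟩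
  exact ⟨g * c * g⁻¹, hnorm g hg c hc, by rw [map_mul, map_mul, map_inv]⟩

theorem exists_isRegular_isCyclic (hpq : p = 2 * q + 1) :
    ∃ G : TransPermGroup (p * q), G.IsRegular ∧ IsCyclic G.1 := by
  obtain ⟨χ, -⟩ := exists_char_ne_one hpq
  have := (Fact.out : q.Prime).two_le
  refine ⟨modelPermGroup χ (.inl ⊥), (isRegular_modelPermGroup_iff (by omega)).2 (Or.inl rfl), ?_⟩
  rw [isCyclic_of_map_eq (map_modelPermGroup χ _)]
  change IsCyclic (holGroup p q ⊥)
  rw [holGroup_bot]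
  exact isCyclic_translGroup hpq

theorem exists_isRegular_not_isMulCommutative (hpq : p = 2 * q + 1) :
    ∃ G : TransPermGroup (p * q), G.IsRegular ∧ ¬ IsMulCommutative G.1 := by
  obtain ⟨χ, hχ⟩ := exists_char_ne_one hpq
  have := (Fact.out : q.Prime).two_le
  refine ⟨modelPermGroup χ (.inr false), (isRegular_modelPermGroup_iff (by omega)).2 (Or.inr rfl),
    fun h => not_isMulCommutative_excGroup_bot hχ ?_⟩
  exact isMulCommutative_of_mulEquiv ((modelGroup χ (.inr false)).equivMapOfInjective
    (zmodProdEquivFin p q).permCongrHom.toMonoidHom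
    (zmodProdEquivFin p q).permCongrHom.injective).symm h

end Degree

end HopfGalois

end

/-! ### The main theorem -/

theorem mainTheorem3 (p q r s : ℕ) (hp : p.Prime) (hq : q.Prime) (hq3 : 3 ≤ q)
    (hpq : p = 2 * q + 1) (hs : Odd s) (hrs : q - 1 = 2 ^ r * s) :
    -- the number of isomorphism types of permutation groups realised by cyclic type
    {c : Quotient (HopfGalois.TransPermGroup.setoid (p * q)) |
        ∃ G : HopfGalois.TransPermGroup (p * q), ⟦G⟧ = c ∧
          HopfGalois.TransPermGroup.RealisedByType.{u} G (HopfGalois.Cyc (p * q))}.ncard =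
      (6 * r + 4) * ArithmeticFunction.sigma 0 s + 2 ∧
    -- there are two isomorphism types of regular groups, one cyclic and one non-abelian
    {c : Quotient (HopfGalois.TransPermGroup.setoid (p * q)) |
        ∃ G : HopfGalois.TransPermGroup (p * q), ⟦G⟧ = c ∧ G.IsRegular}.ncard = 2 ∧
    (∃ G : HopfGalois.TransPermGroup (p * q), G.IsRegular ∧ IsCyclic G.1) ∧
    (∃ G : HopfGalois.TransPermGroup (p * q), G.IsRegular ∧ ¬ IsMulCommutative G.1) ∧
    -- the regular groups are realised, and the extensions realising them are Galois with
    -- `1`, respectively `p`, Hopf-Galois structures of cyclic type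
    (∀ G : HopfGalois.TransPermGroup (p * q), G.IsRegular →
      HopfGalois.TransPermGroup.RealisedByType.{u} G (HopfGalois.Cyc (p * q)) ∧
      ∀ (K L : Type u) [Field K] [Field L] [Algebra K L] [FiniteDimensional K L]
        [Algebra.IsSeparable K L], HopfGalois.Realises K L G.1 (Fin (p * q)) →
        IsGalois K L ∧
        (IsCyclic G.1 → HopfGalois.numStructures K L (HopfGalois.Cyc (p * q)) = 1) ∧
        (¬ IsMulCommutative G.1 →
          HopfGalois.numStructures K L (HopfGalois.Cyc (p * q)) = p)) ∧
    -- all the remaining groups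
    (∀ G : HopfGalois.TransPermGroup (p * q),
      HopfGalois.TransPermGroup.RealisedByType.{u} G (HopfGalois.Cyc (p * q)) →
      ¬ G.IsRegular →
      ∀ (K L : Type u) [Field K] [Field L] [Algebra K L] [FiniteDimensional K L]
        [Algebra.IsSeparable K L], HopfGalois.Realises K L G.1 (Fin (p * q)) →
        HopfGalois.AlmostClassicallyGalois K L ∧
        HopfGalois.numStructures K L (HopfGalois.Cyc (p * q)) = 1) := by
  have : Fact p.Prime := ⟨hp⟩
  have : Fact q.Prime := ⟨hq⟩
  have : NeZero (p * q) := ⟨Nat.mul_ne_zero hp.ne_zero hq.ne_zero⟩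
  refine ⟨?_, HopfGalois.ncard_regular_classes hq3 hpq,
    HopfGalois.exists_isRegular_isCyclic hpq,
    HopfGalois.exists_isRegular_not_isMulCommutative hpq, ?_, ?_⟩
  · rw [HopfGalois.ncard_realised_classes hq3 hpq,
      HopfGalois.card_subgroup_units hq3 hpq hs hrs, ArithmeticFunction.sigma_zero_apply]
  · intro G hG
    refine ⟨HopfGalois.realisedByType_iff.2 (hG.regularSet_nonempty hpq), ?_⟩
    intro K L _ _ _ _ _ hR
    rw [HopfGalois.numStructures_of_realises hR]
    exact ⟨HopfGalois.isGalois_of_realises hR hG,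
      HopfGalois.ncard_regularSet_of_isRegular hq3 hpq hG⟩
  · intro G hG hreg K L _ _ _ _ _ hR
    have hne := HopfGalois.realisedByType_iff.1 hG
    obtain ⟨C, hle, hC, hnorm⟩ := HopfGalois.exists_regular_normal hq3 hpq hne
    rw [HopfGalois.numStructures_of_realises hR]
    exact ⟨HopfGalois.almostClassicallyGalois_of_realises hR hC hle hnorm,
      HopfGalois.ncard_regularSet_of_not_isRegular hq3 hpq hne hreg⟩
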